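/- Let $\mathcal{G}$ be a locally compact, Hausdorff, étale groupoid with base space $\mathcal{G}^{(0)}$, possibly infinite-dimensional. A $\mathcal{G}$-sheaf is a sheaf of abelian groups on $\mathcal{G}^{(0)}$ together with a continuous action of $\mathcal{G}$ on its étale space by homomorphisms between the stalks. A sheaf $\mathcal{S}$ on a locally compact Hausdorff space $X$ is $c$-soft if for every compact $K\subseteq X$, open $U\supseteq K$ and $s\in\Gamma(U;\mathcal{S})$ there are an open $V$ with $K\subseteq V\subseteq U$ and $t\in\Gamma(X;\mathcal{S})$ with $t|_V=s|_V$. Let $\mathcal{G}^{(p)}$ be the space of composable strings $x_0\xleftarrow{g_1}x_1\leftarrow\cdots\xleftarrow{g_p}x_p$, let $\tau_p:\mathcal{G}^{(p)}\to\mathcal{G}^{(0)}$ send such a string to $x_0$, and put $\mathcal{S}_p=\tau_p^*\mathcal{S}$ for a $\mathcal{G}$-sheaf $\mathcal{S}$. For a cochain complex $\mathcal{S}^\bullet=(\mathcal{S}^q)_{q\ge 0}$ of $\mathcal{G}$-sheaves let $H_n(\mathcal{G};\mathcal{S}^\bullet)$, $n\in\mathbb{Z}$, be the homology of the direct sum total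 complex, with $n$-th group $$\bigoplus_{p-q=n}\Gamma_c(\mathcal{G}^{(p)};\mathcal{S}^q_p),$$ of the double complex whose vertical differentials are induced by those of $\mathcal{S}^\bullet$ and whose horizontal differentials are $\delta=\sum_{i=0}^p(-1)^i\delta_i$, where $\delta_i$ is summation over the fibres of the $i$-th face map $d_i:\mathcal{G}^{(p)}\to\mathcal{G}^{(p-1)}$ (for $i=0$ after applying $g_1^{-1}$ to identify the stalk at $x_0$ with the stalk at $x_1$). A quasi-isomorphism of complexes of $\mathcal{G}$-sheaves is a morphism which induces isomorphisms on homology sheaves, and two complexes are in the same quasi-isomorphism class if they are connected by a finite zigzag of quasi-isomorphisms of complexes of $\mathcal{G}$-sheaves in degrees $q\ge 0$. Then: 1. If $f:\mathcal{S}^\bullet\to\mathcal{T}^\bullet$ is a quasi-isomorphism of complexes, in degrees $q\ge 0$, of $c$-soft $\mathcal{G}$-sheaves, then $f$ induces isomorphisms $H_n(\mathcal{G};\mathcal{S}^\bullet)\to H_n(\mathcal{G};\mathcal{T}^\bullet)$ for all $n\in\mathbb{Z}$. 2. If $\mathcal{S}^\bullet$ is a resolution of a $\mathcal{G}$-sheaf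 $\mathcal{A}$ by $c$-soft $\mathcal{G}$-sheaves, then $H_n(\mathcal{G};\mathcal{S}^\bullet)$ depends only on the quasi-isomorphism class of $\mathcal{S}^\bullet$: if $\mathcal{T}^\bullet$ is a complex, in degrees $q\ge0$, of $c$-soft $\mathcal{G}$-sheaves in the same quasi-isomorphism class, then $H_n(\mathcal{G};\mathcal{S}^\bullet)\cong H_n(\mathcal{G};\mathcal{T}^\bullet)$ for all $n\in\mathbb{Z}$. 3. In particular, the Crainic–Moerdijk homology groups $H_n(\mathcal{G};\mathcal{A})$ are well defined for every $\mathcal{G}$-sheaf $\mathcal{A}$: there is a resolution $0\to\mathcal{A}\to\mathcal{S}^0\to\mathcal{S}^1\to\cdots$ by $c$-soft $\mathcal{G}$-sheaves, and for any two such resolutions $\mathcal{S}^\bullet,\mathcal{T}^\bullet$ and every $n$ there are isomorphisms $\varphi_{\mathcal{S},\mathcal{T}}:H_n(\mathcal{G};\mathcal{S}^\bullet)\to H_n(\mathcal{G};\mathcal{T}^\bullet)$ such that $\varphi_{\mathcal{S},\mathcal{S}}=\mathrm{id}$, $\varphi_{\mathcal{T},\mathcal{U}}\circ\varphi_{\mathcal{S},\mathcal{T}}=\varphi_{\mathcal{S},\mathcal{U}}$,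 and $\varphi_{\mathcal{S},\mathcal{T}}$ is the map induced by $f$ whenever $f:\mathcal{S}^\bullet\to\mathcal{T}^\bullet$ is a morphism of complexes of $\mathcal{G}$-sheaves compatible with the augmentations from $\mathcal{A}$. -/

import Mathlib

open CategoryTheory Topology

universe u

namespace CMHomology

section Groupoids

/-- Pairs of composable arrows `x ⟶ y ⟶ z` of a category. -/
def ComposablePair (X : Type u) [Category.{u} X] : Type u :=
  Σ (x y z : X), (x ⟶ y) × (y ⟶ z)

/-- The first arrow of a composable pair. -/
def ComposablePair.fst {X : Type u} [Category.{u} X] (p : ComposablePair X) : Arrow X :=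
  Arrow.mk p.2.2.2.1

/-- The second arrow of a composable pair. -/
def ComposablePair.snd {X : Type u} [Category.{u} X] (p : ComposablePair X) : Arrow X :=
  Arrow.mk p.2.2.2.2

/-- The composite of a composable pair. -/
def ComposablePair.comp {X : Type u} [Category.{u} X] (p : ComposablePair X) : Arrow X :=
  Arrow.mk (p.2.2.2.1 ≫ p.2.2.2.2)

/-- The space of composable pairs is a subspace of the product of two copies of the space of
arrows. -/
instance {X : Type u} [Category.{u} X] [TopologicalSpace (Arrow X)] :
    TopologicalSpace (ComposablePair X) :=
  TopologicalSpace.induced (fun p => (p.fst, p.snd)) inferInstance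

/-- An open bisection: an open set of arrows which both the source map and the range map send
homeomorphically onto an open subset of the base space. -/
def IsOpenBisection {X : Type u} [TopologicalSpace X] [Groupoid.{u} X]
    [TopologicalSpace (Arrow X)] (B : Set (Arrow X)) : Prop :=
  IsOpen B ∧ IsOpenEmbedding (B.domRestrict fun g => g.left) ∧
    IsOpenEmbedding (B.domRestrict fun g => g.right)

/-- Locally compact Hausdorff étale groupoids. The base space is `X`, the space of arrows is
`Arrow X`; an arrow `g : x ⟶ y` has source `s(g) = x` and range `r(g) = y`, and the product
written `g h` in the groupoid literature (defined when `s(g) = r(h)`) is `h ≫ g`. By continuity of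
the unit map and of the source map, `X` is homeomorphic to the subspace of unit arrows. -/
class EtaleGroupoid (X : Type u) [TopologicalSpace X] [Groupoid.{u} X]
    [TopologicalSpace (Arrow X)] : Prop where
  t2_base : T2Space X
  locallyCompact_base : LocallyCompactSpace X
  t2_arrows : T2Space (Arrow X)
  locallyCompact_arrows : LocallyCompactSpace (Arrow X)
  continuous_source : Continuous fun g : Arrow X => g.left
  continuous_range : Continuous fun g : Arrow X => g.right
  continuous_unit : Continuous fun x : X => Arrow.mk (𝟙 x)
  continuous_inv : Continuous fun g : Arrow X => Arrow.mk (Groupoid.inv g.hom)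
  continuous_comp : Continuous (ComposablePair.comp (X := X))
  isTopologicalBasis_bisections :
    TopologicalSpace.IsTopologicalBasis {B : Set (Arrow X) | IsOpenBisection B}

end Groupoids

section Sheaves

/-- A sheaf of abelian groups on `X`, given by its étale space `Σ x, stalk x`: the projection to
`X` is a local homeomorphism, and the group operations of the stalks are continuous. The étale
space need not be Hausdorff. -/
structure EtaleSheaf (X : Type u) [TopologicalSpace X] where
  /-- the stalks -/
  stalk : X → Type u
  /-- the group structure of the stalks -/
  [group : ∀ x, AddCommGroup (stalk x)]
  /-- the topology of the étale space -/
  [top : TopologicalSpace (Σ x, stalk x)]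
  isLocalHomeomorph_proj : IsLocalHomeomorph fun a : Σ x, stalk x => a.1
  continuous_zero : Continuous fun x => (⟨x, 0⟩ : Σ x, stalk x)
  continuous_neg : Continuous fun a : Σ x, stalk x => (⟨a.1, -a.2⟩ : Σ x, stalk x)
  /-- Addition is continuous on the fibre product of two copies of the étale space. -/
  continuous_add :
    Continuous[TopologicalSpace.induced
      (fun p : Σ x, stalk x × stalk x =>
        (((⟨p.1, p.2.1⟩ : Σ x, stalk x), (⟨p.1, p.2.2⟩ : Σ x, stalk x)) :
          (Σ x, stalk x) × (Σ x, stalk x))) inferInstance, top]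
      fun p => ⟨p.1, p.2.1 + p.2.2⟩

attribute [instance] EtaleSheaf.group

variable {X : Type u} [TopologicalSpace X]

namespace EtaleSheaf

/-- The étale space of a sheaf. -/
def Total (S : EtaleSheaf X) : Type u := Σ x, S.stalk x

instance (S : EtaleSheaf X) : TopologicalSpace S.Total := S.top

/-- The point of the étale space given by an element of a stalk. -/
def pt (S : EtaleSheaf X) {x : X} (a : S.stalk x) : S.Total := ⟨x, a⟩

lemma isLocalHomeomorph_total (S : EtaleSheaf X) :
    IsLocalHomeomorph fun a : S.Total => a.1 :=
  let _ : TopologicalSpace (Σ x, S.stalk x) := S.top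
  S.isLocalHomeomorph_proj

section
variable (S : EtaleSheaf X) {Y : Type u} [TopologicalSpace Y]

lemma continuous_pt_zero {τ : Y → X} (hτ : Continuous τ) :
    Continuous fun y => S.pt (0 : S.stalk (τ y)) :=
  let _ : TopologicalSpace (Σ x, S.stalk x) := S.top
  S.continuous_zero.comp hτ

lemma continuous_pt_neg {τ : Y → X} {s : ∀ y, S.stalk (τ y)}
    (hs : Continuous fun y => S.pt (s y)) : Continuous fun y => S.pt (-s y) :=
  let _ : TopologicalSpace (Σ x, S.stalk x) := S.top
  S.continuous_neg.comp hs

lemma continuous_pt_add {τ : Y → X} {s t : ∀ y, S.stalk (τ y)}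
    (hs : Continuous fun y => S.pt (s y)) (ht : Continuous fun y => S.pt (t y)) :
    Continuous fun y => S.pt (s y + t y) := by
  let _ : TopologicalSpace (Σ x, S.stalk x) := S.top
  let _ : TopologicalSpace (Σ x, S.stalk x × S.stalk x) := TopologicalSpace.induced
      (fun p : Σ x, S.stalk x × S.stalk x =>
        (((⟨p.1, p.2.1⟩ : Σ x, S.stalk x), (⟨p.1, p.2.2⟩ : Σ x, S.stalk x)) :
          (Σ x, S.stalk x) × (Σ x, S.stalk x))) inferInstance
  have h : Continuous fun y => (⟨τ y, s y, t y⟩ : Σ x, S.stalk x × S.stalk x) :=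
    continuous_induced_rng.2 (hs.prodMk ht)
  exact S.continuous_add.comp h

lemma continuous_pt_sum {ι : Type*} (P : Finset ι) {τ : Y → X} (hτ : Continuous τ)
    {s : ι → ∀ y, S.stalk (τ y)} (hs : ∀ i ∈ P, Continuous fun y => S.pt (s i y)) :
    Continuous fun y => S.pt (∑ i ∈ P, s i y) := by
  classical
  induction P using Finset.induction_on with
  | empty => simpa using S.continuous_pt_zero hτ
  | insert i P hi ih =>
    simp only [Finset.sum_insert hi]
    exact S.continuous_pt_add (hs i (by simp)) (ih fun j hj => hs j (by simp [hj]))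

/-- The set where a section does not vanish is closed. -/
lemma isClosed_support {τ : Y → X} {s : ∀ y, S.stalk (τ y)}
    (hs : Continuous fun y => S.pt (s y)) : IsClosed {y | s y ≠ 0} := by
  let _ : TopologicalSpace (Σ x, S.stalk x) := S.top
  rw [← isOpen_compl_iff]
  have hopen : IsOpen (Set.range fun x => (⟨x, 0⟩ : Σ x, S.stalk x)) := by
    have h1 : IsOpenEmbedding fun x => (⟨x, 0⟩ : Σ x, S.stalk x) :=
      S.isLocalHomeomorph_proj.isOpenEmbedding_of_comp
        (f := fun x => (⟨x, 0⟩ : Σ x, S.stalk x)) IsOpenEmbedding.id S.continuous_zero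
    exact h1.isOpen_range
  convert hopen.preimage hs using 1
  ext y
  simp only [Set.mem_compl_iff, Set.mem_ofPred_eq, not_not]
  constructor
  · intro h
    exact ⟨τ y, by simp [pt, h]⟩
  · rintro ⟨x, hx⟩
    simp only [pt, Sigma.mk.injEq] at hx
    obtain ⟨rfl, hx⟩ := hx
    exact (eq_of_heq hx).symm
end

/-- Sections along a continuous map `τ : Y → X`, i.e. continuous maps from `Y` to the étale space
of `S` lying over `τ`. This is the group of global sections of the pullback sheaf `τ^* S` on `Y`
(whose étale space is the fibre product of `Y` and the étale space of `S` over `X`). For the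
inclusion of an open subset `U` of `X` it is the group `Γ(U; S)`. -/
def sections (S : EtaleSheaf X) {Y : Type u} [TopologicalSpace Y] (τ : C(Y, X)) :
    AddSubgroup (∀ y, S.stalk (τ y)) where
  carrier := {s | Continuous fun y => S.pt (s y)}
  zero_mem' := S.continuous_pt_zero τ.continuous
  add_mem' hs ht := S.continuous_pt_add hs ht
  neg_mem' hs := S.continuous_pt_neg hs

/-- The group `Γ_c(Y; τ^* S)` of sections with compact support of the pullback sheaf. -/
def sectionsC (S : EtaleSheaf X) {Y : Type u} [TopologicalSpace Y] (τ : C(Y, X)) :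
    AddSubgroup (∀ y, S.stalk (τ y)) where
  carrier := {s | s ∈ S.sections τ ∧ IsCompact (closure {y | s y ≠ 0})}
  zero_mem' := ⟨zero_mem _, by simp⟩
  add_mem' {s t} hs ht := by
    refine ⟨add_mem hs.1 ht.1, (hs.2.union ht.2).of_isClosed_subset isClosed_closure ?_⟩
    rw [← closure_union]
    refine closure_mono fun y hy => ?_
    by_contra h
    simp only [Set.mem_union, Set.mem_ofPred_eq, not_or, not_not] at h
    exact hy (by simp [h.1, h.2])
  neg_mem' {s} hs := ⟨neg_mem hs.1, by simpa using hs.2⟩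

/-- `c`-softness: a section over a neighbourhood of a compact set can be extended to a global
section, after restriction to a smaller neighbourhood of the compact set. -/
def IsCSoft (S : EtaleSheaf X) : Prop :=
  ∀ (K U : Set X), IsCompact K → IsOpen U → K ⊆ U →
    ∀ s ∈ S.sections (⟨Subtype.val, continuous_subtype_val⟩ : C(U, X)),
      ∃ V : Set X, IsOpen V ∧ K ⊆ V ∧ ∃ hVU : V ⊆ U,
        ∃ t ∈ S.sections (ContinuousMap.id X), ∀ x (hx : x ∈ V), t x = s ⟨x, hVU hx⟩

end EtaleSheaf

variable [Groupoid.{u} X] [TopologicalSpace (Arrow X)]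

variable (X) in
/-- A `G`-sheaf (of abelian groups) for a topological groupoid `G` with base space `X`: a sheaf of
abelian groups on `X` together with a continuous action of the groupoid on its étale space by
homomorphisms between the stalks; the arrow `g` sends the stalk at `s(g)` to the stalk at `r(g)`. -/
structure GSheaf extends EtaleSheaf X where
  /-- the action of an arrow -/
  act : ∀ {x y : X}, (x ⟶ y) → (stalk x →+ stalk y)
  act_id : ∀ x : X, act (𝟙 x) = AddMonoidHom.id _
  act_comp : ∀ {x y z : X} (g : x ⟶ y) (h : y ⟶ z), act (g ≫ h) = (act h).comp (act g)
  /-- The action map is continuous on the fibre product of the space of arrows (along the source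
  map) and the étale space. -/
  continuous_act :
    Continuous[TopologicalSpace.induced
      (fun p : Σ g : Arrow X, stalk g.left =>
        ((p.1, (⟨p.1.left, p.2⟩ : Σ x, stalk x)) : Arrow X × (Σ x, stalk x))) inferInstance, top]
      fun p => ⟨p.1.right, act p.1.hom p.2⟩

namespace GSheaf

/-- Morphisms of `G`-sheaves: equivariant morphisms of sheaves, i.e. continuous equivariant maps of
étale spaces over `X` which are homomorphisms on the stalks. -/
@[ext]
structure Hom (S T : GSheaf X) where
  /-- the homomorphisms of the stalks -/
  app : ∀ x, S.stalk x →+ T.stalk x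
  continuous_app : Continuous fun a : S.Total => T.pt (app a.1 a.2)
  equivariant : ∀ {x y : X} (g : x ⟶ y) (a : S.stalk x),
    app y (S.act g a) = T.act g (app x a)

instance : Category.{u} (GSheaf X) where
  Hom S T := Hom S T
  id S := ⟨fun _ => AddMonoidHom.id _, continuous_id, fun _ _ => rfl⟩
  comp f g := ⟨fun x => (g.app x).comp (f.app x), g.continuous_app.comp f.continuous_app,
    fun h a => by simp [f.equivariant, g.equivariant]⟩

/-- The stalk maps of a morphism of `G`-sheaves. -/
def app {S T : GSheaf X} (f : S ⟶ T) (x : X) : S.stalk x →+ T.stalk x := Hom.app f x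

@[ext]
lemma hom_ext {S T : GSheaf X} {f g : S ⟶ T} (h : ∀ x a, app f x a = app g x a) : f = g :=
  Hom.ext (funext fun x => AddMonoidHom.ext (h x))

@[simp] lemma id_app (S : GSheaf X) (x : X) : app (𝟙 S) x = AddMonoidHom.id _ := rfl

@[simp] lemma comp_app {S T U : GSheaf X} (f : S ⟶ T) (g : T ⟶ U) (x : X) :
    app (f ≫ g) x = (app g x).comp (app f x) := rfl

instance : Limits.HasZeroMorphisms (GSheaf X) where
  zero S T := ⟨⟨fun _ => 0, T.continuous_pt_zero S.isLocalHomeomorph_total.continuous,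
    fun _ _ => by simp⟩⟩
  comp_zero f U := rfl
  zero_comp S {T U} f := hom_ext fun x a => (app f x).map_zero

@[simp] lemma zero_app (S T : GSheaf X) (x : X) : app (0 : S ⟶ T) x = 0 := rfl

variable (X) in
/-- The stalk functor at a point. -/
def stalkFunctor (x : X) : GSheaf X ⥤ AddCommGrpCat.{u} where
  obj S := AddCommGrpCat.of (S.stalk x)
  map f := AddCommGrpCat.ofHom (app f x)

instance (x : X) : (stalkFunctor X x).PreservesZeroMorphisms where
  map_zero _ _ := rfl

lemma continuous_pt_act (S : GSheaf X) {Y : Type u} [TopologicalSpace Y]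
    {τ τ' : Y → X} {g : ∀ y, τ y ⟶ τ' y} (hg : Continuous fun y => Arrow.mk (g y))
    {s : ∀ y, S.stalk (τ y)} (hs : Continuous fun y => S.pt (s y)) :
    Continuous fun y => S.pt (S.act (g y) (s y)) := by
  let _ : TopologicalSpace (Σ x, S.stalk x) := S.top
  let _ : TopologicalSpace (Σ g : Arrow X, S.stalk g.left) := TopologicalSpace.induced
      (fun p : Σ g : Arrow X, S.stalk g.left =>
        ((p.1, (⟨p.1.left, p.2⟩ : Σ x, S.stalk x)) : Arrow X × (Σ x, S.stalk x))) inferInstance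
  have h : Continuous fun y => (⟨Arrow.mk (g y), s y⟩ : Σ g : Arrow X, S.stalk g.left) :=
    continuous_induced_rng.2 (hg.prodMk hs)
  exact S.continuous_act.comp h

lemma act_eqToHom_pt (S : GSheaf X) {x y z : X} (g : x ⟶ y) (h : y = z) (a : S.stalk x) :
    S.pt (S.act (g ≫ eqToHom h) a) = S.pt (S.act g a) := by
  subst h; simp

end GSheaf

end Sheaves

section Pushforward

variable {X : Type u} [TopologicalSpace X] [Groupoid.{u} X] [TopologicalSpace (Arrow X)]

namespace GSheaf

/-- Summation over the fibres of `f : Y → Z`. Given sections `s` of a `G`-sheaf along `τ : Y → X`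
and arrows `g y : τ y ⟶ τ' (f y)`, it is the section along `τ' : Z → X` whose value at `z` is
the sum of the elements `g y • s y` over all `y` with `f y = z` (the morphism `eqToHom` only
identifies the stalks at the equal points `τ' (f y)` and `τ' z`). -/
noncomputable def pushforward (S : GSheaf X) {Y Z : Type u} (f : Y → Z) {τ : Y → X} {τ' : Z → X}
    (g : ∀ y, τ y ⟶ τ' (f y)) (s : ∀ y, S.stalk (τ y)) (z : Z) : S.stalk (τ' z) :=
  ∑ᶠ (y : Y) (h : f y = z), S.act (g y ≫ eqToHom (congrArg τ' h)) (s y)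

variable (S : GSheaf X) {Y Z : Type u} {f : Y → Z} {τ : Y → X} {τ' : Z → X}
  (g : ∀ y, τ y ⟶ τ' (f y)) {s : ∀ y, S.stalk (τ y)}

lemma pushforward_eq_sum (s : ∀ y, S.stalk (τ y)) (z : Z) {ι : Type*} [Fintype ι] (σ : ι → Y)
    (hσ : Function.Injective σ) (hσz : ∀ i, f (σ i) = z)
    (hs : ∀ y, f y = z → s y ≠ 0 → ∃ i, σ i = y) :
    S.pushforward f g s z =
      ∑ i, S.act (g (σ i) ≫ eqToHom (congrArg τ' (hσz i))) (s (σ i)) := by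
  classical
  rw [pushforward, finsum_eq_sum_of_support_subset (s := Finset.univ.map ⟨σ, hσ⟩), Finset.sum_map]
  · refine Finset.sum_congr rfl fun i _ => ?_
    rw [finsum_eq_dif, Function.Embedding.coeFn_mk, dif_pos (hσz i)]
  · intro y hy
    rw [Function.mem_support, finsum_eq_dif] at hy
    by_cases h : f y = z
    · rw [dif_pos h] at hy
      obtain ⟨i, rfl⟩ := hs y h fun h0 => hy (by rw [h0, map_zero])
      simp
    · exact absurd (dif_neg h) hy

lemma pushforward_support_subset :
    {z | S.pushforward f g s z ≠ 0} ⊆ f '' {y | s y ≠ 0} := by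
  intro z hz
  by_contra h
  refine hz ?_
  rw [S.pushforward_eq_sum g s z (ι := Empty) Empty.elim (fun i => i.elim) (fun i => i.elim)
    (fun y hy hsy => absurd ⟨y, hsy, hy⟩ h)]
  simp

lemma act_act_eqToHom {x y y' z z' : X} (g : x ⟶ y) (h : y = y') (g' : y' ⟶ z) (h' : z = z')
    (k : y ⟶ z) (hk : k = eqToHom h ≫ g') (a : S.stalk x) :
    S.act (g' ≫ eqToHom h') (S.act (g ≫ eqToHom h) a) = S.act ((g ≫ k) ≫ eqToHom h') a := by
  subst h; subst h'; subst hk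
  simp [S.act_comp]

variable [TopologicalSpace Y] [TopologicalSpace Z]

lemma finite_fibre [T2Space Z] (hf : IsLocalHomeomorph f) {K : Set Y} (hK : IsCompact K) (z : Z) :
    (K ∩ f ⁻¹' {z}).Finite := by
  refine (hK.inter_right (isClosed_singleton.preimage hf.continuous)).finite ?_
  refine IsLocalHomeomorphOn.isDiscrete_of_image (f := f) (fun y _ => hf y) ?_
  refine Set.Subsingleton.isDiscrete ?_
  rintro _ ⟨y, hy, rfl⟩ _ ⟨y', hy', rfl⟩
  exact hy.2.trans hy'.2.symm

lemma pushforward_comp {W : Type u} [TopologicalSpace W] [T2Space W] {f' : Z → W}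
    (hf : IsLocalHomeomorph f) (hf' : IsLocalHomeomorph f') {τ : C(Y, X)} {τ' : C(Z, X)}
    {τ'' : C(W, X)} (g : ∀ y, τ y ⟶ τ' (f y)) (g' : ∀ z, τ' z ⟶ τ'' (f' z))
    {s : ∀ y, S.stalk (τ y)} (hs : s ∈ S.sectionsC τ) :
    S.pushforward f' g' (S.pushforward f g s) =
      S.pushforward (f' ∘ f) (τ' := τ'') (fun y => g y ≫ g' (f y)) s := by
  classical
  funext w
  have hfin := finite_fibre (hf'.comp hf) hs.2 w
  set P := hfin.toFinset with hP
  let F : P → P.image f := fun y => ⟨f y, Finset.mem_image_of_mem f y.2⟩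
  have hPw : ∀ y : P, f' (f y) = w := fun y => ((hfin.mem_toFinset).1 y.2).2
  have hQw : ∀ z : P.image f, f' z = w := by
    rintro ⟨z, hz⟩
    obtain ⟨y, hy, rfl⟩ := Finset.mem_image.1 hz
    exact hPw ⟨y, hy⟩
  have hmem : ∀ y, f' (f y) = w → s y ≠ 0 → y ∈ P := fun y h1 h2 =>
    (hfin.mem_toFinset).2 ⟨subset_closure h2, h1⟩
  rw [S.pushforward_eq_sum (f := f' ∘ f) (τ' := τ'') (fun y => g y ≫ g' (f y)) s w
      (Subtype.val : P → Y) Subtype.val_injective hPw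
      (fun y h1 h2 => ⟨⟨y, hmem y h1 h2⟩, rfl⟩),
    S.pushforward_eq_sum g' _ w (Subtype.val : P.image f → Z) Subtype.val_injective hQw]
  · rw [← Fintype.sum_equiv (Equiv.sigmaFiberEquiv F) _ _ (fun _ => rfl), Fintype.sum_sigma]
    refine Finset.sum_congr rfl fun z _ => ?_
    rw [S.pushforward_eq_sum g s z (ι := {y : P // F y = z}) (fun y => y.1.1)
      (fun a b h => Subtype.ext (Subtype.ext h)) (fun y => congrArg Subtype.val y.2), map_sum]
    · refine Finset.sum_congr rfl ?_
      rintro ⟨y, rfl⟩ _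
      exact S.act_act_eqToHom _ _ _ _ _ (Category.id_comp _).symm _
    · intro y h1 h2
      have hy : y ∈ P := hmem y (by rw [h1]; exact hQw z) h2
      exact ⟨⟨⟨y, hy⟩, Subtype.ext h1⟩, rfl⟩
  · intro z hz h
    obtain ⟨y, hy, rfl⟩ := S.pushforward_support_subset g h
    exact ⟨⟨f y, Finset.mem_image_of_mem f (hmem y hz hy)⟩, rfl⟩

variable [T2Space Z]

lemma pushforward_add (hf : IsLocalHomeomorph f) {τ : C(Y, X)} {τ' : C(Z, X)}
    {g : ∀ y, τ y ⟶ τ' (f y)} {s t : ∀ y, S.stalk (τ y)} (hs : s ∈ S.sectionsC τ)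
    (ht : t ∈ S.sectionsC τ) :
    S.pushforward f g (s + t) = S.pushforward f g s + S.pushforward f g t := by
  funext z
  have hfin := finite_fibre hf (hs.2.union ht.2) z
  have key : ∀ r : ∀ y, S.stalk (τ y), (∀ y, r y ≠ 0 → s y ≠ 0 ∨ t y ≠ 0) →
      S.pushforward f g r z = ∑ i : hfin.toFinset,
        S.act (g i ≫ eqToHom (congrArg τ' (((hfin.mem_toFinset).1 i.2).2))) (r i) := by
    intro r hr
    refine S.pushforward_eq_sum g r z Subtype.val Subtype.val_injective
      (fun i => ((hfin.mem_toFinset).1 i.2).2) fun y hyz hy => ?_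
    refine ⟨⟨y, (hfin.mem_toFinset).2 ⟨?_, hyz⟩⟩, rfl⟩
    exact (hr y hy).imp (fun h => subset_closure h) fun h => subset_closure h
  rw [Pi.add_apply, key s (fun y h => Or.inl h), key t (fun y h => Or.inr h), key (s + t),
    ← Finset.sum_add_distrib]
  · exact Finset.sum_congr rfl fun i _ => by rw [Pi.add_apply, map_add]
  · intro y hy
    by_contra h
    simp only [not_or, not_not] at h
    exact hy (by rw [Pi.add_apply, h.1, h.2, add_zero])

variable [T2Space Y]

lemma continuous_pushforward (hf : IsLocalHomeomorph f) (hτ' : Continuous τ')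
    (hg : Continuous fun y => Arrow.mk (g y))
    (hs : Continuous fun y => S.pt (s y)) (hK : IsCompact (closure {y | s y ≠ 0})) :
    Continuous fun z => S.pt (S.pushforward f g s z) := by
  classical
  set K := closure {y | s y ≠ 0} with hKdef
  rw [continuous_iff_continuousAt]
  intro z₀
  have hfin := finite_fibre hf hK z₀
  obtain ⟨W, hW, hWd⟩ := hfin.t2_separation
  choose e he hfe using hf
  let O : Y → Set Y := fun p => (e p).source ∩ W p
  have hO : ∀ p, IsOpen (O p) := fun p => (e p).open_source.inter (hW p).2
  have hpO : ∀ p, p ∈ O p := fun p => ⟨he p, (hW p).1⟩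
  have hf' : IsLocalHomeomorph f := fun y => ⟨e y, he y, hfe y⟩
  set P := hfin.toFinset with hP
  let V : Set Z := (⋂ p ∈ P, f '' O p) ∩ (f '' (K \ ⋃ p ∈ P, O p))ᶜ
  have hVo : IsOpen V := by
    refine IsOpen.inter (isOpen_biInter_finset fun p _ => hf'.isOpenMap _ (hO p)) ?_
    have hc : IsCompact (K \ ⋃ p ∈ P, O p) :=
      hK.diff (isOpen_biUnion fun p _ => hO p)
    exact (hc.image hf'.continuous).isClosed.isOpen_compl
  have hzV : z₀ ∈ V := by
    refine ⟨?_, ?_⟩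
    · simp only [Set.mem_iInter]
      intro p hp
      exact ⟨p, hpO p, ((hfin.mem_toFinset).1 hp).2⟩
    · rintro ⟨y, ⟨hyK, hy⟩, hyz⟩
      refine hy (Set.mem_biUnion (x := y) ?_ (hpO y))
      exact (hfin.mem_toFinset).2 ⟨hyK, hyz⟩
  let σ : P → V → Y := fun p z => (e p).symm z
  have hσ : ∀ (p : P) (z : V), σ p z ∈ O p ∧ f (σ p z) = z := by
    intro p z
    obtain ⟨y, hy, hyz⟩ := Set.mem_iInter₂.1 z.2.1 p p.2
    have : σ p z = y := by
      simp only [σ]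
      rw [← hyz, congrFun (hfe p) y, (e p).left_inv hy.1]
    rw [this]
    exact ⟨hy, hyz⟩
  have hσc : ∀ p, Continuous (σ p) := by
    intro p
    refine (e p).continuousOn_symm.comp_continuous continuous_subtype_val fun z => ?_
    have := (e p).map_source (hσ p z).1.1
    rwa [← congrFun (hfe p), (hσ p z).2] at this
  have hinj : ∀ z, Function.Injective fun p => σ p z := by
    intro z p q hpq
    by_contra hne
    have := hWd ((hfin.mem_toFinset).1 p.2) ((hfin.mem_toFinset).1 q.2)
      (fun h => hne (Subtype.ext h))
    refine Set.disjoint_left.1 this (hσ p z).1.2 ?_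
    simp only at hpq
    rw [hpq]
    exact (hσ q z).1.2
  have key : ∀ z : V, S.pushforward f g s z =
      ∑ p : P, S.act (g (σ p z) ≫ eqToHom (congrArg τ' (hσ p z).2)) (s (σ p z)) := by
    intro z
    refine S.pushforward_eq_sum g s z (fun p => σ p z) (hinj z) (fun p => (hσ p z).2) ?_
    intro y hyz hy
    have hyO : y ∈ ⋃ p ∈ P, O p := by
      by_contra h
      exact z.2.2 ⟨y, ⟨subset_closure hy, h⟩, hyz⟩
    obtain ⟨p, hp, hyp⟩ := Set.mem_iUnion₂.1 hyO
    refine ⟨⟨p, hp⟩, ?_⟩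
    have h1 := hσ ⟨p, hp⟩ z
    refine (e p).injOn h1.1.1 hyp.1 ?_
    rw [← congrFun (hfe p), ← congrFun (hfe p), h1.2, hyz]
  have hcont : Continuous fun z : V => S.pt (S.pushforward f g s z) := by
    simp only [key]
    refine S.continuous_pt_sum _ (hτ'.comp continuous_subtype_val) fun p _ => ?_
    simp only [act_eqToHom_pt]
    exact (S.continuous_pt_act hg hs).comp (hσc p)
  exact (continuousOn_iff_continuous_domRestrict.2 hcont).continuousAt (hVo.mem_nhds hzV)

lemma pushforward_mem (hf : IsLocalHomeomorph f) {τ : C(Y, X)} {τ' : C(Z, X)}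
    {g : ∀ y, τ y ⟶ τ' (f y)} (hg : Continuous fun y => Arrow.mk (g y))
    {s : ∀ y, S.stalk (τ y)} (hs : s ∈ S.sectionsC τ) :
    S.pushforward f g s ∈ S.sectionsC τ' := by
  refine ⟨S.continuous_pushforward g hf τ'.continuous hg hs.1 hs.2, ?_⟩
  refine (hs.2.image hf.continuous).of_isClosed_subset isClosed_closure ?_
  refine closure_minimal ?_ (hs.2.image hf.continuous).isClosed
  exact (S.pushforward_support_subset g).trans (Set.image_mono subset_closure)

end GSheaf

end Pushforward

section Strings

variable {X : Type u} [TopologicalSpace X] [Groupoid.{u} X] [TopologicalSpace (Arrow X)]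

/-- The objects and the consecutive arrows of a functor from `Fin (n + 1)`. -/
def stringData {n : ℕ} (F : ComposableArrows X n) : (Fin (n + 1) → X) × (Fin n → Arrow X) :=
  (fun i => F.obj i, fun i => Arrow.mk (F.map (homOfLE (Fin.castSucc_lt_succ (i := i)).le)))

/-- The space of composable strings `x₀ ← x₁ ← ⋯ ← xₙ` with arrows `gᵢ : xᵢ ⟶ xᵢ₋₁`. Such a string
is recorded as the functor from `Fin (n + 1)` with objects `x₀, …, xₙ` whose arrows
`xᵢ₋₁ ⟶ xᵢ` are the inverses `gᵢ⁻¹`. The topology is that of a subspace of the product of copies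
of `X` and of `Arrow X`, via the objects and the `n` consecutive arrows (for `n = 0` this is the
topology of `X`, for `n ≥ 1` that of a subspace of the product of `n` copies of `Arrow X`, because
inversion is a homeomorphism and the source and range maps are continuous). -/
instance stringsTopology (n : ℕ) : TopologicalSpace (ComposableArrows X n) :=
  TopologicalSpace.induced stringData inferInstance

/-- The map on strings given by a monotone map `θ : {0, …, m} → {0, …, n}`. If `θ` is the
injective map which leaves out `i`, it is the face map `dᵢ`: it omits `xᵢ`, composing the two
adjacent arrows if `0 < i < n`. -/
def stringMap {m n : SimplexCategory} (θ : m ⟶ n) (F : ComposableArrows X n.len) :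
    ComposableArrows X m.len :=
  θ.toOrderHom.monotone.functor ⋙ F

lemma continuous_stringData (n : ℕ) :
    Continuous (stringData : ComposableArrows X n → (Fin (n + 1) → X) × (Fin n → Arrow X)) :=
  continuous_induced_dom

lemma continuous_strings {Y : Type u} [TopologicalSpace Y] {n : ℕ} {σ : Y → ComposableArrows X n}
    (h0 : ∀ i, Continuous fun y => (σ y).obj i)
    (h1 : ∀ i : Fin n, Continuous fun y =>
      Arrow.mk ((σ y).map (homOfLE (Fin.castSucc_lt_succ (i := i)).le))) : Continuous σ :=
  continuous_induced_rng.2 ((continuous_pi h0).prodMk (continuous_pi h1))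

lemma continuous_obj {n : ℕ} (i : Fin (n + 1)) :
    Continuous fun F : ComposableArrows X n => F.obj i :=
  ((continuous_apply i).comp continuous_fst).comp ((continuous_stringData n))

variable [EtaleGroupoid X]

lemma continuous_mk_comp {Y : Type u} [TopologicalSpace Y] {a b c : Y → X} {g : ∀ y, a y ⟶ b y}
    {h : ∀ y, b y ⟶ c y} (hg : Continuous fun y => Arrow.mk (g y))
    (hh : Continuous fun y => Arrow.mk (h y)) : Continuous fun y => Arrow.mk (g y ≫ h y) := by
  let p : Y → ComposablePair X := fun y => ⟨a y, b y, c y, g y, h y⟩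
  have : Continuous p := continuous_induced_rng.2 (hg.prodMk hh)
  exact EtaleGroupoid.continuous_comp.comp this

lemma continuous_map {n : ℕ} (i j : Fin (n + 1)) (hij : i ≤ j) :
    Continuous fun F : ComposableArrows X n => Arrow.mk (F.map (homOfLE hij)) := by
  induction j using Fin.induction with
  | zero =>
    obtain rfl : i = 0 := le_antisymm hij (Fin.zero_le _)
    have : ∀ F : ComposableArrows X n, F.map (homOfLE hij) = 𝟙 _ := fun F => F.map_id _
    simp only [this]
    exact EtaleGroupoid.continuous_unit.comp (continuous_obj 0)
  | succ j ih =>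
    rcases hij.eq_or_lt with rfl | h
    · have : ∀ F : ComposableArrows X n, F.map (homOfLE hij) = 𝟙 _ := fun F => F.map_id _
      simp only [this]
      exact EtaleGroupoid.continuous_unit.comp (continuous_obj _)
    · have h' : i ≤ j.castSucc := Fin.le_castSucc_iff.2 h
      have : ∀ F : ComposableArrows X n, F.map (homOfLE hij) =
          F.map (homOfLE h') ≫ F.map (homOfLE (Fin.castSucc_lt_succ (i := j)).le) :=
        fun F => F.map_comp _ _
      simp only [this]
      refine continuous_mk_comp (ih h') ?_
      exact ((continuous_apply j).comp continuous_snd).comp ((continuous_stringData n))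

lemma continuous_stringMap {m n : SimplexCategory} (θ : m ⟶ n) :
    Continuous (stringMap (X := X) θ) :=
  continuous_strings (fun _ => continuous_obj _) fun _ => continuous_map _ _ _

instance (n : ℕ) : T2Space (ComposableArrows X n) := by
  have := EtaleGroupoid.t2_base (X := X)
  have := EtaleGroupoid.t2_arrows (X := X)
  refine T2Space.of_injective_continuous ?_ (continuous_stringData n)
  intro F G h
  simp only [stringData, Prod.mk.injEq] at h
  have h0 : ∀ i, F.obj i = G.obj i := congrFun h.1
  refine ComposableArrows.ext h0 fun i hi => ?_
  have h1 := congrFun h.2 ⟨i, hi⟩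
  have key : ∀ {a b a' b' : X} (f : a ⟶ b) (g : a' ⟶ b') (ha : a = a') (hb : b = b'),
      Arrow.mk f = Arrow.mk g → f = eqToHom ha ≫ g ≫ eqToHom hb.symm := by
    rintro a b a' b' f g rfl rfl hfg
    simpa using Arrow.mk_injective _ _ hfg
  exact key _ _ (h0 _) (h0 _) h1

lemma isLocalHomeomorph_source : IsLocalHomeomorph fun g : Arrow X => g.left := by
  refine isLocalHomeomorph_iff_isOpenEmbedding_restrict.2 fun g => ?_
  obtain ⟨B, hB, hg, -⟩ := EtaleGroupoid.isTopologicalBasis_bisections.exists_subset_of_mem_open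
    (Set.mem_univ g) isOpen_univ
  exact ⟨B, hB.1.mem_nhds hg, hB.2.1⟩

lemma isLocalHomeomorph_range : IsLocalHomeomorph fun g : Arrow X => g.right := by
  refine isLocalHomeomorph_iff_isOpenEmbedding_restrict.2 fun g => ?_
  obtain ⟨B, hB, hg, -⟩ := EtaleGroupoid.isTopologicalBasis_bisections.exists_subset_of_mem_open
    (Set.mem_univ g) isOpen_univ
  exact ⟨B, hB.1.mem_nhds hg, hB.2.2⟩

lemma isLocalHomeomorph_obj_zero (n : ℕ) :
    IsLocalHomeomorph fun F : ComposableArrows X n => F.obj 0 := by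
  induction n with
  | zero =>
    have hc : Continuous fun x : X => ComposableArrows.mk₀ x := by
      exact continuous_strings (fun _ => continuous_id) fun i => i.elim0
    let e : ComposableArrows X 0 ≃ₜ X :=
      { toFun := fun F => F.obj 0
        invFun := fun x => ComposableArrows.mk₀ x
        left_inv := fun F => ComposableArrows.ext₀ rfl
        right_inv := fun _ => rfl
        continuous_toFun := continuous_obj 0
        continuous_invFun := hc }
    exact e.isLocalHomeomorph
  | succ n ih =>
    let q : ComposableArrows X (n + 1) → ComposableArrows X n := fun F => F.δ₀
    let a : ComposableArrows X (n + 1) → Arrow X := fun F =>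
      Arrow.mk (F.map (homOfLE (Fin.zero_le (1 : Fin (n + 2)))))
    have hac : Continuous a := continuous_map _ _ _
    have hqc : Continuous q := continuous_strings (fun _ => continuous_obj _) fun _ => continuous_map _ _ _
    have hq : IsLocalHomeomorph q := by
      refine isLocalHomeomorph_iff_isOpenEmbedding_restrict.2 fun F₀ => ?_
      obtain ⟨B, hB, hF₀, -⟩ :=
        EtaleGroupoid.isTopologicalBasis_bisections.exists_subset_of_mem_open
          (Set.mem_univ (a F₀)) isOpen_univ
      let r : B → X := B.domRestrict fun g => g.right
      have hr : IsOpenEmbedding r := hB.2.2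
      refine ⟨a ⁻¹' B, (hB.1.preimage hac).mem_nhds hF₀, ?_⟩
      let W : Set (ComposableArrows X n) := (fun F => F.obj 0) ⁻¹' Set.range r
      have hW : IsOpen W := hr.isOpen_range.preimage (continuous_obj 0)
      let ψ : W → B := fun F => hr.isEmbedding.toHomeomorph.symm ⟨F.1.obj 0, F.2⟩
      have hψ : ∀ F : W, (ψ F).1.right = F.1.obj 0 := fun F =>
        congrArg Subtype.val (hr.isEmbedding.toHomeomorph.apply_symm_apply ⟨F.1.obj 0, F.2⟩)
      have hψc : Continuous ψ := hr.isEmbedding.toHomeomorph.symm.continuous.comp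
        (((continuous_obj 0).comp continuous_subtype_val).subtype_mk _)
      let σ : W → ComposableArrows X (n + 1) := fun F =>
        F.1.precomp ((ψ F).1.hom ≫ eqToHom (hψ F))
      have haσ : ∀ F : W, a (σ F) = (ψ F).1 := by
        have key : ∀ {x y z : X} (g : x ⟶ y) (h : y = z), Arrow.mk (g ≫ eqToHom h) = Arrow.mk g := by
          rintro x y z g rfl; simp
        exact fun F => key _ (hψ F)
      have hσB : ∀ F : W, σ F ∈ a ⁻¹' B := fun F => by
        rw [Set.mem_preimage, haσ]; exact (ψ F).2
      have hσc : Continuous σ := by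
        refine continuous_strings (fun i => ?_) fun i => ?_
        · refine Fin.cases ?_ (fun i => ?_) i
          · exact EtaleGroupoid.continuous_source.comp (continuous_subtype_val.comp hψc)
          · exact (continuous_obj i).comp continuous_subtype_val
        · refine Fin.cases ?_ (fun i => ?_) i
          · exact (continuous_subtype_val.comp hψc).congr fun F => (haσ F).symm
          · exact (continuous_map _ _ (Fin.castSucc_lt_succ (i := i)).le).comp
              continuous_subtype_val
      have hinj : ∀ F G, a F ∈ B → a G ∈ B → q F = q G → F = G := by
        intro F G hF hG hFG
        have h1 : (⟨a F, hF⟩ : B) = ⟨a G, hG⟩ :=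
          hr.injective (congrArg (fun H : ComposableArrows X n => H.obj 0) hFG)
        have h2 : a F = a G := congrArg Subtype.val h1
        have key : ∀ {a b a' b' : X} (f : a ⟶ b) (g : a' ⟶ b') (ha : a = a') (hb : b = b'),
            Arrow.mk f = Arrow.mk g → f = eqToHom ha ≫ g ≫ eqToHom hb.symm := by
          rintro a b a' b' f g rfl rfl hfg
          simpa using Arrow.mk_injective _ _ hfg
        exact ComposableArrows.ext_succ (congrArg (fun g : Arrow X => g.left) h2) hFG
          (key _ _ _ (congrArg (fun g : Arrow X => g.right) h2) h2)
      let e : (a ⁻¹' B) ≃ₜ W :=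
        { toFun := fun F => ⟨q F.1, ⟨⟨a F.1, F.2⟩, rfl⟩⟩
          invFun := fun F => ⟨σ F, hσB F⟩
          left_inv := fun F => Subtype.ext
            (hinj _ _ (hσB _) F.2 (ComposableArrows.precomp_δ₀ _ _))
          right_inv := fun F => Subtype.ext (ComposableArrows.precomp_δ₀ _ _)
          continuous_toFun := (hqc.comp continuous_subtype_val).subtype_mk _
          continuous_invFun := hσc.subtype_mk hσB }
      exact (hW.isOpenEmbedding_subtypeVal).comp e.isOpenEmbedding
    have h1 : IsLocalHomeomorph fun F : ComposableArrows X (n + 1) => F.obj 1 := ih.comp hq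
    have ha : IsLocalHomeomorph a := IsLocalHomeomorph.of_comp (g := fun g : Arrow X => g.right)
      h1 isLocalHomeomorph_range hac
    exact isLocalHomeomorph_source.comp ha

lemma isLocalHomeomorph_obj {n : ℕ} (i : Fin (n + 1)) :
    IsLocalHomeomorph fun F : ComposableArrows X n => F.obj i :=
  isLocalHomeomorph_range.comp (IsLocalHomeomorph.of_comp
    (g := fun g : Arrow X => g.left) (isLocalHomeomorph_obj_zero n) isLocalHomeomorph_source (continuous_map 0 i (Fin.zero_le i)))

lemma isLocalHomeomorph_stringMap {m n : SimplexCategory} (θ : m ⟶ n) :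
    IsLocalHomeomorph (stringMap (X := X) θ) :=
  IsLocalHomeomorph.of_comp (g := fun F : ComposableArrows X m.len => F.obj 0)
    (isLocalHomeomorph_obj (θ.toOrderHom 0)) (isLocalHomeomorph_obj_zero _) (continuous_stringMap θ)

end Strings

section Homology

variable {X : Type u} [TopologicalSpace X] [Groupoid.{u} X] [TopologicalSpace (Arrow X)]
  [EtaleGroupoid X]

variable (X) in
/-- The map `τₙ` from the space of strings of length `n` to the base space, which sends the string
`x₀ ← ⋯ ← xₙ` to `x₀`. -/
def tau (n : ℕ) : C(ComposableArrows X n, X) := ⟨fun F => F.obj 0, continuous_obj 0⟩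

/-- For a string `F` with objects `x₀, …, xₙ`, the arrow `x₀ ⟶ x_{θ(0)}`. For a face map `dᵢ` with
`i ≠ 0` it is a unit, for `d₀` it is the inverse of `g₁`. -/
def vertexArrow {m n : SimplexCategory} (θ : m ⟶ n) (F : ComposableArrows X n.len) :
    tau X n.len F ⟶ tau X m.len (stringMap θ F) :=
  F.map (homOfLE (Fin.zero_le (θ.toOrderHom 0)))

namespace GSheaf

/-- The group `Γ_c(G⁽ⁿ⁾; Sₙ)`, where `Sₙ = τₙ^* S`. -/
abbrev barGroup (S : GSheaf X) (n : ℕ) :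
    AddSubgroup (∀ F : ComposableArrows X n, S.stalk (tau X n F)) :=
  S.sectionsC (tau X n)

lemma continuous_vertexArrow {m n : SimplexCategory} (θ : m ⟶ n) :
    Continuous fun F : ComposableArrows X n.len => Arrow.mk (vertexArrow θ F) :=
  continuous_map _ _ _

/-- The homomorphism `Γ_c(G⁽ⁿ⁾; Sₙ) → Γ_c(G⁽ᵐ⁾; Sₘ)` given by `θ : {0, …, m} → {0, …, n}`: the stalks
of `Sₙ` and of the pullback of `Sₘ` along `stringMap θ` are identified through the groupoid action,
followed by summation over the fibres of the local homeomorphism `stringMap θ`. -/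
noncomputable def barMap (S : GSheaf X) {m n : SimplexCategory} (θ : m ⟶ n) :
    S.barGroup n.len →+ S.barGroup m.len where
  toFun s := ⟨S.pushforward (stringMap θ) (vertexArrow θ) s.1,
    S.pushforward_mem (isLocalHomeomorph_stringMap θ) (continuous_vertexArrow θ) s.2⟩
  map_zero' := Subtype.ext <| funext fun z =>
    S.pushforward_eq_sum (vertexArrow θ) 0 z (ι := Empty) Empty.elim (fun i => i.elim)
      (fun i => i.elim) (fun _ _ hy => absurd rfl hy)
  map_add' s t := Subtype.ext <|
    S.pushforward_add (isLocalHomeomorph_stringMap θ) s.2 t.2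

lemma barMap_id (S : GSheaf X) (n : SimplexCategory) :
    S.barMap (𝟙 n) = AddMonoidHom.id _ := by
  refine AddMonoidHom.ext fun s => Subtype.ext <| funext fun z => ?_
  refine (S.pushforward_eq_sum _ _ z (ι := Unit) (fun _ => z) (fun _ _ _ => rfl)
    (fun _ => rfl) (fun y hy _ => ⟨(), hy.symm⟩)).trans ?_
  have h : vertexArrow (𝟙 n) z = 𝟙 _ := z.map_id _
  rw [Finset.univ_unique, Finset.sum_singleton, h]
  change S.act (𝟙 (z.obj 0) ≫ 𝟙 (z.obj 0)) (s.1 z) = s.1 z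
  rw [Category.comp_id, S.act_id]
  rfl

lemma barMap_comp (S : GSheaf X) {l m n : SimplexCategory} (η : l ⟶ m) (θ : m ⟶ n) :
    S.barMap (η ≫ θ) = (S.barMap η).comp (S.barMap θ) := by
  refine AddMonoidHom.ext fun s => Subtype.ext ?_
  refine Eq.trans ?_ (S.pushforward_comp (isLocalHomeomorph_stringMap θ)
    (isLocalHomeomorph_stringMap η) (vertexArrow θ) (vertexArrow η) s.2).symm
  have h : ∀ F : ComposableArrows X n.len, vertexArrow (η ≫ θ) F =
      vertexArrow θ F ≫ vertexArrow η (stringMap θ F) := fun F => F.map_comp _ _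
  exact congrArg (fun g => S.pushforward (stringMap (η ≫ θ)) (τ' := tau X l.len) g s.1) (funext h)

/-- The simplicial abelian group `n ↦ Γ_c(G⁽ⁿ⁾; Sₙ)`. -/
noncomputable def bar (S : GSheaf X) : SimplicialObject AddCommGrpCat.{u} where
  obj n := AddCommGrpCat.of (S.barGroup n.unop.len)
  map θ := AddCommGrpCat.ofHom (S.barMap θ.unop)
  map_id n := by rw [unop_id, barMap_id]; rfl
  map_comp θ η := by rw [unop_comp, barMap_comp]; rfl

/-- The map on compactly supported sections induced by a morphism of `G`-sheaves. -/
def barGroupMap {S T : GSheaf X} (f : S ⟶ T) (n : ℕ) : S.barGroup n →+ T.barGroup n where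
  toFun s := ⟨fun F => app f _ (s.1 F), (Hom.continuous_app f).comp s.2.1,
    s.2.2.of_isClosed_subset isClosed_closure <| closure_mono fun F hF h => hF (by simp [h])⟩
  map_zero' := Subtype.ext <| funext fun F => (app f _).map_zero
  map_add' s t := Subtype.ext <| funext fun F => (app f _).map_add _ _

lemma barGroupMap_barMap {S T : GSheaf X} (f : S ⟶ T) {m n : SimplexCategory} (θ : m ⟶ n)
    (s : S.barGroup n.len) :
    barGroupMap f m.len (S.barMap θ s) = T.barMap θ (barGroupMap f n.len s) := by
  refine Subtype.ext <| funext fun z => ?_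
  have hfin := finite_fibre (isLocalHomeomorph_stringMap θ) s.2.2 z
  have hz : ∀ i : hfin.toFinset, stringMap θ i.1 = z := fun i => ((hfin.mem_toFinset).1 i.2).2
  change app f _ (S.pushforward _ _ _ z) = T.pushforward _ _ _ z
  rw [S.pushforward_eq_sum _ _ z (ι := hfin.toFinset) Subtype.val Subtype.val_injective hz,
    T.pushforward_eq_sum _ _ z (ι := hfin.toFinset) Subtype.val Subtype.val_injective hz, map_sum]
  · exact Finset.sum_congr rfl fun i _ => Hom.equivariant f _ _
  · intro y hy hs
    exact ⟨⟨y, (hfin.mem_toFinset).2 ⟨subset_closure fun h => hs (by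
      change app f _ (s.1 y) = 0
      rw [h, map_zero]), hy⟩⟩, rfl⟩
  · intro y hy hs
    exact ⟨⟨y, (hfin.mem_toFinset).2 ⟨subset_closure hs, hy⟩⟩, rfl⟩

variable (X) in
/-- The bar complex of a `G`-sheaf `S`, as a functor: in degree `n` it is `Γ_c(G⁽ⁿ⁾; Sₙ)`, and the
differential is the alternating sum `∑ (-1)ⁱ δᵢ` of the maps `δᵢ` induced by the face maps `dᵢ`. -/
noncomputable def barComplex : GSheaf X ⥤ ChainComplex AddCommGrpCat.{u} ℕ :=
  { obj := fun S => S.bar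
    map := fun f =>
      { app := fun n => AddCommGrpCat.ofHom (barGroupMap f n.unop.len)
        naturality := fun n m θ => by
          ext s
          exact barGroupMap_barMap f θ.unop s } :
    GSheaf X ⥤ SimplicialObject AddCommGrpCat.{u} } ⋙
  AlgebraicTopology.alternatingFaceMapComplex AddCommGrpCat.{u}

instance : (barComplex X).PreservesZeroMorphisms where
  map_zero S T := by
    ext n s
    rfl

end GSheaf

/-- Indexing and signs for the total complex of the double complex with entries
`Γ_c(G⁽ᵖ⁾; S^q_p)`: the entry of index `(q, p)` has total degree `p - q`, the differential of the
bar complex (lowering `p`) is taken with sign `1`, and the differential induced by that of `S`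
(raising `q`) with sign `(-1) ^ p`. -/
instance totalShape :
    TotalComplexShape (ComplexShape.up ℕ) (ComplexShape.down ℕ) (ComplexShape.down ℤ) where
  π i := (i.2 : ℤ) - i.1
  ε₁ i := (-1) ^ i.2
  ε₂ _ := 1
  rel₁ {q q'} h p := by
    obtain rfl : q + 1 = q' := h
    change (p : ℤ) - (q + 1 : ℕ) + 1 = p - q
    push_cast; ring
  rel₂ q {p p'} h := by
    obtain rfl : p' + 1 = p := h
    change (p' : ℤ) - q + 1 = (p' + 1 : ℕ) - q
    push_cast; ring
  ε₂_ε₁ {q q' p p'} _ h := by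
    obtain rfl : p' + 1 = p := h
    simp [pow_succ]

variable (X) in
/-- The direct sum total complex of the double complex with entries `Γ_c(G⁽ᵖ⁾; S^q_p)`, as a functor
of the cochain complex `S` of `G`-sheaves. Its `n`-th group is the direct sum of the groups
`Γ_c(G⁽ᵖ⁾; S^q_p)` with `p - q = n`. -/
noncomputable def totalComplex :
    CochainComplex (GSheaf X) ℕ ⥤ ChainComplex AddCommGrpCat.{u} ℤ :=
  (GSheaf.barComplex X).mapHomologicalComplex (ComplexShape.up ℕ) ⋙
    HomologicalComplex₂.totalFunctor AddCommGrpCat.{u} (ComplexShape.up ℕ) (ComplexShape.down ℕ)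
      (ComplexShape.down ℤ)

variable (X) in
/-- The homology of the direct sum total complex in degree `n : ℤ`. -/
noncomputable def totalHomology (n : ℤ) : CochainComplex (GSheaf X) ℕ ⥤ AddCommGrpCat.{u} :=
  totalComplex X ⋙ HomologicalComplex.homologyFunctor _ _ n

end Homology

section Resolutions

variable {X : Type u} [TopologicalSpace X] [Groupoid.{u} X] [TopologicalSpace (Arrow X)]

/-- A morphism of complexes of `G`-sheaves is a quasi-isomorphism if it induces isomorphisms on the
homology sheaves, i.e. on the homology of the complexes of stalks at every point. -/
def IsQuasiIso {S T : CochainComplex (GSheaf X) ℕ} (f : S ⟶ T) : Prop :=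
  ∀ x : X, QuasiIso
    (((GSheaf.stalkFunctor X x).mapHomologicalComplex (ComplexShape.up ℕ)).map f)

/-- Two complexes of `G`-sheaves are in the same quasi-isomorphism class if they are connected by a
finite zigzag of quasi-isomorphisms. -/
def SameQuasiIsoClass (S T : CochainComplex (GSheaf X) ℕ) : Prop :=
  Relation.EqvGen (fun S T : CochainComplex (GSheaf X) ℕ => ∃ f : S ⟶ T, IsQuasiIso f) S T

/-- A complex of `c`-soft `G`-sheaves. -/
def IsCSoftComplex (S : CochainComplex (GSheaf X) ℕ) : Prop :=
  ∀ q, (S.X q).IsCSoft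

/-- A resolution `0 → A → S⁰ → S¹ → ⋯` of a `G`-sheaf `A` by `c`-soft `G`-sheaves; exactness of the
sequence of sheaves means exactness of the sequences of stalks. -/
structure CSoftResolution (A : GSheaf X) where
  /-- the complex `S⁰ → S¹ → ⋯` -/
  complex : CochainComplex (GSheaf X) ℕ
  /-- the augmentation `A → S⁰` -/
  aug : A ⟶ complex.X 0
  isCSoft : IsCSoftComplex complex
  injective_aug : ∀ x, Function.Injective (GSheaf.app aug x)
  exact_zero : ∀ x, Function.Exact (GSheaf.app aug x) (GSheaf.app (complex.d 0 1) x)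
  exact_succ : ∀ q x, Function.Exact (GSheaf.app (complex.d q (q + 1)) x)
    (GSheaf.app (complex.d (q + 1) (q + 2)) x)

end Resolutions

end CMHomology

/-! Fix `p`. The map `tau X p` is a local homeomorphism, so the pullback of a `c`-soft sheaf along
it is again `c`-soft (`EtaleSheaf.IsCSoft.exists_extension_pullback`). The mapping cone of a
quasi-isomorphism `f`, pulled back to the strings of length `p`, is therefore an exact complex of
`c`-soft sheaves that vanishes in negative degrees (`coneD_injective`, `coneD_exact`). On such a
complex the functor of compactly supported sections is exact. By induction upwards on the degree, a
section of a kernel sheaf near a compact set agrees near this set with a global section of the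
kernel (`SoftGerms.exists_closed_extension`). This makes it possible to glue local primitives and to
cut them off outside a compact set (`SoftGerms.exists_primitive`). The induction starts at the lower
end of the complex, so no bound on the dimension is needed. Hence `f` induces quasi-isomorphisms on
all columns (`isConeExact_columnMap`).

An element of a direct sum total complex involves only finitely many columns, and the bar
differential lowers `p` towards `0`. A cocycle of the cone of total complexes can thus be reduced to
`0` by removing its top column repeatedly (`DoubleComplex.exists_of_columns`). This proves the first
claim.

For the other claims a resolution by relatively injective `c`-soft `G`-sheaves is constructed. The
functor from `G`-sheaves to families of abelian groups that keeps only the stalks has a right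
adjoint `cofree`, whose values are flabby. Embedding the cokernels of stalk maps into injective
groups and applying `cofree` yields `cofreeResolution`. Every resolution maps to it, uniquely up to
homotopy (`IsResolution.exists_lift`, `IsResolution.exists_homotopy`), and such a map is a
quasi-isomorphism. The canonical isomorphisms are obtained by passing through the homology of the
cofree resolution.

In the second claim the complexes inside the zigzag need not be `c`-soft, so the first claim cannot
be applied to its steps. What passes along the zigzag is the existence of an augmentation from `A`
which gives a resolution (`SameQuasiIsoClass.exists_isResolution_iff`). -/

namespace CMHomology

/-! ### Elementwise criteria for quasi-isomorphisms of complexes of abelian groups. -/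

section QuasiIsomorphisms

lemma ab_comp_apply {A B C : AddCommGrpCat.{u}} {f : A ⟶ B} {g : B ⟶ C} {h : A ⟶ C}
    (e : f ≫ g = h) (x : A) : g (f x) = h x := by
  rw [← e]; rfl

lemma ab_exists_homologyπ_eq (S : ShortComplex AddCommGrpCat.{u}) (z : S.homology) :
    ∃ c, S.homologyπ c = z :=
  (AddCommGrpCat.epi_iff_surjective _).1 inferInstance z

lemma ab_iCycles_injective (S : ShortComplex AddCommGrpCat.{u}) :
    Function.Injective S.iCycles :=
  (AddCommGrpCat.mono_iff_injective _).1 inferInstance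

lemma ab_exists_cycle (S : ShortComplex AddCommGrpCat.{u}) (x : S.X₂) (hx : S.g x = 0) :
    ∃ c : S.cycles, S.iCycles c = x :=
  ⟨_, S.abCyclesIso_inv_apply_iCycles ⟨x, hx⟩⟩

lemma ab_g_iCycles (S : ShortComplex AddCommGrpCat.{u}) (c : S.cycles) :
    S.g (S.iCycles c) = 0 :=
  ab_comp_apply S.iCycles_g c

lemma ab_homologyπ_eq_zero_iff (S : ShortComplex AddCommGrpCat.{u}) (c : S.cycles) :
    S.homologyπ c = 0 ↔ ∃ x, S.f x = S.iCycles c := by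
  have hex : (ShortComplex.mk S.toCycles S.homologyπ (by simp)).Exact :=
    ShortComplex.exact_of_g_is_cokernel _ S.homologyIsCokernel
  rw [ShortComplex.ab_exact_iff] at hex
  constructor
  · intro h
    obtain ⟨x, hx⟩ := hex c h
    exact ⟨x, by rw [← hx]; exact (ab_comp_apply S.toCycles_i x).symm⟩
  · rintro ⟨x, hx⟩
    obtain rfl : S.toCycles x = c :=
      ab_iCycles_injective S ((ab_comp_apply S.toCycles_i x).trans hx)
    exact ab_comp_apply S.toCycles_comp_homologyπ x

/-- An elementwise criterion for a morphism of short complexes of abelian groups to be a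
quasi-isomorphism. -/
lemma ab_quasiIso_iff {S T : ShortComplex AddCommGrpCat.{u}} (φ : S ⟶ T) :
    ShortComplex.QuasiIso φ ↔
      (∀ x : S.X₂, S.g x = 0 → (∃ y, φ.τ₂ x = T.f y) → ∃ x', x = S.f x') ∧
      (∀ y : T.X₂, T.g y = 0 → ∃ x, S.g x = 0 ∧ ∃ y', y = φ.τ₂ x + T.f y') := by
  have hi : ∀ c : S.cycles, T.iCycles (ShortComplex.cyclesMap φ c) = φ.τ₂ (S.iCycles c) :=
    fun c => ab_comp_apply (ShortComplex.cyclesMap_i φ) c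
  have hπ : ∀ c : S.cycles, ShortComplex.homologyMap φ (S.homologyπ c) =
      T.homologyπ (ShortComplex.cyclesMap φ c) :=
    fun c => ab_comp_apply (ShortComplex.homologyπ_naturality φ) c
  rw [ShortComplex.quasiIso_iff, ConcreteCategory.isIso_iff_bijective, Function.Bijective,
    injective_iff_map_eq_zero]
  refine and_congr ⟨fun h x hx ⟨y, hy⟩ => ?_, fun h z hz => ?_⟩ ⟨fun h y hy => ?_, fun h z => ?_⟩
  · obtain ⟨c, rfl⟩ := ab_exists_cycle S x hx
    have h1 := h (S.homologyπ c) ((hπ c).trans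
      ((ab_homologyπ_eq_zero_iff T _).2 ⟨y, hy.symm.trans (hi c).symm⟩))
    obtain ⟨x', hx'⟩ := (ab_homologyπ_eq_zero_iff S c).1 h1
    exact ⟨x', hx'.symm⟩
  · obtain ⟨c, rfl⟩ := ab_exists_homologyπ_eq S z
    obtain ⟨y, hy⟩ := (ab_homologyπ_eq_zero_iff T _).1 ((hπ c).symm.trans hz)
    obtain ⟨x', hx'⟩ := h _ (ab_g_iCycles S c) ⟨y, (hy.trans (hi c)).symm⟩
    exact (ab_homologyπ_eq_zero_iff S c).2 ⟨x', hx'.symm⟩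
  · obtain ⟨c, rfl⟩ := ab_exists_cycle T y hy
    obtain ⟨z, hz⟩ := h (T.homologyπ c)
    obtain ⟨b, rfl⟩ := ab_exists_homologyπ_eq S z
    rw [hπ] at hz
    have h1 : T.homologyπ (c - ShortComplex.cyclesMap φ b) = 0 := by
      rw [map_sub, hz, sub_self]
    obtain ⟨y', hy'⟩ := (ab_homologyπ_eq_zero_iff T _).1 h1
    refine ⟨S.iCycles b, ab_g_iCycles S b, y', ?_⟩
    rw [hy', map_sub, hi, add_sub_cancel]
  · obtain ⟨c, rfl⟩ := ab_exists_homologyπ_eq T z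
    obtain ⟨x, hx, y', hy'⟩ := h _ (ab_g_iCycles T c)
    obtain ⟨b, rfl⟩ := ab_exists_cycle S x hx
    refine ⟨S.homologyπ b, ?_⟩
    rw [hπ, ← sub_eq_zero, ← map_sub, ab_homologyπ_eq_zero_iff]
    refine ⟨-y', ?_⟩
    rw [map_sub, hi, hy', map_neg]
    abel

/-- The mapping cone of a morphism of complexes of abelian groups is acyclic, expressed through
elements, for cochain complexes in nonnegative degrees. -/
structure IsConeExact {K L : CochainComplex AddCommGrpCat.{u} ℕ} (f : K ⟶ L) : Prop where
  zero : ∀ a : K.X 0, K.d 0 1 a = 0 → f.f 0 a = 0 → a = 0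
  succ : ∀ (r : ℕ) (a : K.X (r + 1)) (b : L.X r), K.d (r + 1) (r + 2) a = 0 →
    f.f (r + 1) a = L.d r (r + 1) b →
      -- For `r = 0` there is no group in degree `-1`; `prev 0` is then a default index, and the
      -- differential from it to degree `0` is zero.
      ∃ (a' : K.X r) (b' : L.X ((ComplexShape.up ℕ).prev r)),
        a = K.d r (r + 1) a' ∧ b = f.f r a' + L.d _ r b'

lemma next_nat (r : ℕ) : (ComplexShape.up ℕ).next r = r + 1 :=
  (ComplexShape.up ℕ).next_eq' rfl

lemma ab_quasiIsoAt_iff {ι : Type*} {c : ComplexShape ι}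
    {K L : HomologicalComplex AddCommGrpCat.{u} c} (f : K ⟶ L) (i j k : ι)
    (hi : c.prev j = i) (hk : c.next j = k) :
    QuasiIsoAt f j ↔
      (∀ x : K.X j, K.d j k x = 0 → (∃ y, f.f j x = L.d i j y) → ∃ x', x = K.d i j x') ∧
      (∀ y : L.X j, L.d j k y = 0 → ∃ x, K.d j k x = 0 ∧ ∃ y', y = f.f j x + L.d i j y') := by
  rw [quasiIsoAt_iff' f i j k hi hk]
  exact ab_quasiIso_iff _

lemma d_d_apply {ι : Type*} {c : ComplexShape ι} (K : HomologicalComplex AddCommGrpCat.{u} c)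
    (i j k : ι) (x : K.X i) : K.d j k (K.d i j x) = 0 :=
  ab_comp_apply (K.d_comp_d i j k) x

lemma f_d_apply {ι : Type*} {c : ComplexShape ι} {K L : HomologicalComplex AddCommGrpCat.{u} c}
    (f : K ⟶ L) (i j : ι) (x : K.X i) : f.f j (K.d i j x) = L.d i j (f.f i x) :=
  (ab_comp_apply (f.comm i j).symm x)

/-- Makes the default index `prev 0` in `IsConeExact` harmless. -/
lemma prev_nat_zero (C : CochainComplex AddCommGrpCat.{u} ℕ) (j : ℕ) : C.d j 0 = 0 :=
  C.shape _ _ (Nat.succ_ne_zero _)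

lemma prev_nat_succ (r : ℕ) : (ComplexShape.up ℕ).prev (r + 1) = r :=
  (ComplexShape.up ℕ).prev_eq' rfl

/-- The long exact sequence of the cone in terms of elements. Testing the cone on a pair `(a, b)`
gives injectivity on homology, and testing it on `(0, b)` gives surjectivity. -/
lemma quasiIso_iff_isConeExact {K L : CochainComplex AddCommGrpCat.{u} ℕ} (f : K ⟶ L) :
    QuasiIso f ↔ IsConeExact f := by
  rw [quasiIso_iff]
  constructor
  · intro h
    have h' := fun j => (ab_quasiIsoAt_iff f _ j (j + 1) rfl (next_nat j)).1 (h j)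
    refine ⟨fun a ha hfa => ?_, fun r a b ha hab => ?_⟩
    · obtain ⟨x', hx'⟩ := (h' 0).1 a ha ⟨0, by rw [hfa, map_zero]⟩
      rwa [prev_nat_zero] at hx'
    · obtain ⟨x, hx⟩ : ∃ x, a = K.d r (r + 1) x := by
        have h1 := (ab_quasiIsoAt_iff f r (r + 1) (r + 2) (prev_nat_succ r)
          (next_nat (r + 1))).1 (h (r + 1))
        exact h1.1 a ha ⟨b, hab⟩
      -- The primitive `x` of `a` need not be compatible with `b`, but `b - f x` is a cocycle;
      -- surjectivity on homology corrects `x` by a cocycle `z`.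
      obtain ⟨z, hz, y', hy'⟩ := (h' r).2 (b - f.f r x) (by
        rw [map_sub, ← f_d_apply, ← hx, hab, sub_self])
      refine ⟨x + z, y', by rw [map_add, hz, add_zero, hx], ?_⟩
      rw [map_add, add_assoc, ← hy', add_sub_cancel]
  · intro h j
    obtain ⟨i, hi⟩ : ∃ i, (ComplexShape.up ℕ).prev j = i := ⟨_, rfl⟩
    rw [ab_quasiIsoAt_iff f i j (j + 1) hi (next_nat j)]
    constructor
    · rintro x hx ⟨y, hy⟩
      cases j with
      | zero =>
        rw [prev_nat_zero] at hy
        exact ⟨0, by rw [map_zero]; exact h.zero x hx hy⟩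
      | succ r =>
        obtain rfl : r = i := (prev_nat_succ r).symm.trans hi
        obtain ⟨a', -, ha', -⟩ := h.succ r x y hx hy
        exact ⟨a', ha'⟩
    · intro y hy
      subst hi
      obtain ⟨a', b', ha', hb'⟩ := h.succ j 0 y (map_zero _) (by rw [map_zero, hy])
      exact ⟨a', ha'.symm, b', hb'⟩

/-- Only cycles matter on homology, so the half of a homotopy which involves the differential of `K`
disappears from the hypothesis. -/
lemma ab_homologyMap_eq {ι : Type*} {c : ComplexShape ι}
    {K L : HomologicalComplex AddCommGrpCat.{u} c} (f g : K ⟶ L) (i j k : ι)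
    (hi : c.prev j = i) (hk : c.next j = k)
    (h : ∀ x : K.X j, K.d j k x = 0 → ∃ y, f.f j x = g.f j x + L.d i j y) :
    HomologicalComplex.homologyMap f j = HomologicalComplex.homologyMap g j := by
  subst hi hk
  ext z
  obtain ⟨c, rfl⟩ := ab_exists_homologyπ_eq (K.sc j) z
  let φ := (HomologicalComplex.shortComplexFunctor AddCommGrpCat.{u} _ j).map f
  let ψ := (HomologicalComplex.shortComplexFunctor AddCommGrpCat.{u} _ j).map g
  have hπ : ∀ φ : K.sc j ⟶ L.sc j, ShortComplex.homologyMap φ ((K.sc j).homologyπ c) =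
      (L.sc j).homologyπ (ShortComplex.cyclesMap φ c) :=
    fun φ => ab_comp_apply (ShortComplex.homologyπ_naturality φ) c
  change ShortComplex.homologyMap φ _ = ShortComplex.homologyMap ψ _
  rw [hπ, hπ, ← sub_eq_zero, ← map_sub, ab_homologyπ_eq_zero_iff]
  obtain ⟨y, hy⟩ := h ((K.sc j).iCycles c) (ab_g_iCycles (K.sc j) c)
  refine ⟨y, ?_⟩
  have hi : ∀ φ : K.sc j ⟶ L.sc j, (L.sc j).iCycles (ShortComplex.cyclesMap φ c) =
      φ.τ₂ ((K.sc j).iCycles c) := fun φ => ab_comp_apply (ShortComplex.cyclesMap_i φ) c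
  rw [map_sub, hi, hi]
  exact (sub_eq_of_eq_add' hy).symm

end QuasiIsomorphisms

/-! ### Direct sum total complexes, filtered by columns. -/

section TotalComplexes

/-- Double complexes of abelian groups with a cohomological index `q ≥ 0` and a homological index
`p ≥ 0`. -/
abbrev DoubleComplex := HomologicalComplex₂ AddCommGrpCat.{u} (ComplexShape.up ℕ)
  (ComplexShape.down ℕ)

/-- The direct sum total complex. -/
noncomputable abbrev DoubleComplex.tot (K : DoubleComplex.{u}) :
    ChainComplex AddCommGrpCat.{u} ℤ :=
  K.total (ComplexShape.down ℤ)

namespace DoubleComplex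

variable (K : DoubleComplex.{u}) {L : DoubleComplex.{u}}

/-- The inclusion of a summand of the total complex. -/
noncomputable abbrev incl (q p : ℕ) (n : ℤ) (h : (p : ℤ) - q = n) : (K.X q).X p ⟶ K.tot.X n :=
  K.ιTotal (ComplexShape.down ℤ) q p n h

/-- The projection to a summand of the total complex. -/
noncomputable def proj (q p : ℕ) (n : ℤ) : K.tot.X n ⟶ (K.X q).X p :=
  K.totalDesc fun q' p' _ => if h : q' = q ∧ p' = p then (K.XXIsoOfEq _ _ _ h.1 h.2).hom else 0

lemma proj_incl_self (q p : ℕ) (n : ℤ) (h : (p : ℤ) - q = n) (a : (K.X q).X p) :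
    K.proj q p n (K.incl q p n h a) = a := by
  refine (ab_comp_apply (K.ι_totalDesc _ q p h) a).trans ?_
  rw [dif_pos ⟨rfl, rfl⟩, HomologicalComplex₂.XXIsoOfEq_rfl]
  rfl

lemma proj_incl_of_ne {q p : ℕ} {n : ℤ} {q' p' : ℕ} (h : (p' : ℤ) - q' = n) (hp : p' ≠ p)
    (a : (K.X q').X p') : K.proj q p n (K.incl q' p' n h a) = 0 := by
  refine (ab_comp_apply (K.ι_totalDesc _ q' p' h) a).trans ?_
  rw [dif_neg fun h => hp h.2]
  rfl

/-- The part of the total complex which comes from the columns of index `p < P`. -/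
noncomputable def columns (n : ℤ) (P : ℕ) : AddSubgroup (K.tot.X n) :=
  AddSubgroup.closure {x | ∃ (q p : ℕ) (h : (p : ℤ) - q = n) (a : (K.X q).X p),
    p < P ∧ K.incl q p n h a = x}

variable {K}

lemma incl_mem_columns {q p : ℕ} {n : ℤ} (h : (p : ℤ) - q = n) (a : (K.X q).X p) {P : ℕ}
    (hp : p < P) : K.incl q p n h a ∈ K.columns n P :=
  AddSubgroup.subset_closure ⟨q, p, h, a, hp, rfl⟩

lemma columns_mono {n : ℤ} {P P' : ℕ} (h : P ≤ P') : K.columns n P ≤ K.columns n P' := by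
  refine (AddSubgroup.closure_le _).2 ?_
  rintro _ ⟨q, p, hn, a, hp, rfl⟩
  exact incl_mem_columns hn a (hp.trans_le h)

lemma columns_zero {n : ℤ} {x : K.tot.X n} (hx : x ∈ K.columns n 0) : x = 0 := by
  refine (AddSubgroup.mem_bot).1 ((AddSubgroup.closure_le ⊥).2 ?_ hx)
  rintro _ ⟨q, p, hn, a, hp, rfl⟩
  exact absurd hp (Nat.not_lt_zero _)

/-- This is where the total complex has to be formed with direct sums: every element lies in
finitely many columns. -/
lemma exists_mem_columns {n : ℤ} (x : K.tot.X n) : ∃ P, x ∈ K.columns n P := by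
  let F : AddSubgroup (K.tot.X n) := AddSubgroup.closure
    {x | ∃ (q p : ℕ) (h : (p : ℤ) - q = n) (a : (K.X q).X p), K.incl q p n h a = x}
  have hF : x ∈ F := by
    -- A morphism out of the total complex is determined on the summands, and the quotient map by
    -- `F` vanishes on each of them.
    have h0 : (AddCommGrpCat.ofHom (QuotientAddGroup.mk' F) : K.tot.X n ⟶ _) =
        AddCommGrpCat.ofHom 0 := by
      refine HomologicalComplex₂.total.hom_ext _ fun q p h => ?_
      ext a
      exact (QuotientAddGroup.eq_zero_iff _).2 (AddSubgroup.subset_closure ⟨q, p, h, a, rfl⟩)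
    exact (QuotientAddGroup.eq_zero_iff x).1 (congrArg (fun g => g x) h0)
  induction hF using AddSubgroup.closure_induction with
  | mem x hx =>
    obtain ⟨q, p, h, a, rfl⟩ := hx
    exact ⟨p + 1, incl_mem_columns h a p.lt_succ_self⟩
  | zero => exact ⟨0, zero_mem _⟩
  | add x y _ _ hx hy =>
    obtain ⟨P, hP⟩ := hx
    obtain ⟨Q, hQ⟩ := hy
    exact ⟨max P Q, add_mem (columns_mono (le_max_left _ _) hP)
      (columns_mono (le_max_right _ _) hQ)⟩
  | neg x _ hx =>
    obtain ⟨P, hP⟩ := hx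
    exact ⟨P, neg_mem hP⟩

lemma proj_columns {n : ℤ} {q P : ℕ} {x : K.tot.X n} (hx : x ∈ K.columns n P) :
    K.proj q P n x = 0 := by
  refine AddMonoidHom.mem_ker.1 ((AddSubgroup.closure_le (K.proj q P n).hom.ker).2 ?_ hx)
  rintro _ ⟨q', p', hn, a, hp, rfl⟩
  exact proj_incl_of_ne K hn hp.ne a

/-- In a fixed total degree `n`, column `P` meets the total complex in a single summand, the one
with `q = P - n`. -/
lemma exists_top_column {n : ℤ} {P : ℕ} {x : K.tot.X n} (hx : x ∈ K.columns n (P + 1)) {q : ℕ}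
    (h : (P : ℤ) - q = n) : ∃ a, x - K.incl q P n h a ∈ K.columns n P := by
  induction hx using AddSubgroup.closure_induction with
  | mem x hx =>
    obtain ⟨q', p', h', a, hp, rfl⟩ := hx
    rcases Nat.lt_succ_iff_lt_or_eq.1 hp with hp | rfl
    · exact ⟨0, by rw [map_zero, sub_zero]; exact incl_mem_columns h' a hp⟩
    · obtain rfl : q' = q := by omega
      exact ⟨a, by rw [sub_self]; exact zero_mem _⟩
  | zero => exact ⟨0, by rw [map_zero, sub_zero]; exact zero_mem _⟩
  | add x y _ _ hx hy =>
    obtain ⟨a, ha⟩ := hx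
    obtain ⟨b, hb⟩ := hy
    exact ⟨a + b, by rw [map_add, add_sub_add_comm]; exact add_mem ha hb⟩
  | neg x _ hx =>
    obtain ⟨a, ha⟩ := hx
    exact ⟨-a, by rw [map_neg, sub_neg_eq_add, neg_add_eq_sub, ← neg_sub]; exact neg_mem ha⟩

/-- For `P < n` the summand of column `P` would need the negative index `q = P - n`. -/
lemma mem_columns_of_lt {n : ℤ} {P : ℕ} (hP : (P : ℤ) < n) {x : K.tot.X n}
    (hx : x ∈ K.columns n (P + 1)) : x ∈ K.columns n P := by
  refine (AddSubgroup.closure_le _).2 ?_ hx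
  rintro _ ⟨q, p, h, a, hp, rfl⟩
  exact incl_mem_columns h a (by omega)

variable (K) in
/-- The restriction to a summand of the differential of the total complex which lowers `p`. -/
noncomputable def barD (q P : ℕ) (n' : ℤ) : (K.X q).X P ⟶ K.tot.X n' :=
  K.d₂ (ComplexShape.down ℤ) q P n'

lemma incl_d (q P : ℕ) (n n' : ℤ) (h : (P : ℤ) - q = n) (h' : (P : ℤ) - (q + 1 : ℕ) = n') :
    K.incl q P n h ≫ K.tot.d n n' =
      (-1 : ℤˣ) ^ P • ((K.d q (q + 1)).f P ≫ K.incl (q + 1) P n' h') +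
        K.barD q P n' := by
  rw [HomologicalComplex₂.total_d]
  refine (Preadditive.comp_add _ _ _ _ _ _).trans ?_
  rw [HomologicalComplex₂.ι_D₁, HomologicalComplex₂.ι_D₂,
    K.d₁_eq (ComplexShape.down ℤ) (i₁' := q + 1) rfl P n' h']
  rfl

/-- The bar differential lowers `p`, so modulo the columns below `P` only the differential in the
direction of `q` remains. -/
lemma d_incl (q P : ℕ) (n n' : ℤ) (h : (P : ℤ) - q = n) (h' : (P : ℤ) - (q + 1 : ℕ) = n')
    (a : (K.X q).X P) :
    ∃ e ∈ K.columns n' P, K.tot.d n n' (K.incl q P n h a) =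
      (-1 : ℤˣ) ^ P • K.incl (q + 1) P n' h' ((K.d q (q + 1)).f P a) + e := by
  refine ⟨K.barD q P n' a, ?_, ab_comp_apply (incl_d q P n n' h h') a⟩
  rw [barD]
  cases P with
  | zero =>
    rw [K.d₂_eq_zero _ _ _ _ (fun h => Nat.succ_ne_zero _ h)]
    exact zero_mem _
  | succ P =>
    have hn' : (P : ℤ) - q = n' := by omega
    rw [K.d₂_eq (ComplexShape.down ℤ) q (i₂' := P) rfl n' hn']
    change (1 : ℤˣ) • K.incl q P n' hn' ((K.X q).d (P + 1) P a) ∈ _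
    rw [one_smul]
    exact incl_mem_columns hn' _ P.lt_succ_self

lemma units_smul_mem {A : Type*} [AddCommGroup A] (F : AddSubgroup A) (ε : ℤˣ) {x : A}
    (hx : x ∈ F) : ε • x ∈ F :=
  F.zsmul_mem hx _

lemma d_mem_columns {n n' : ℤ} (hn : n' + 1 = n) {P : ℕ} {x : K.tot.X n}
    (hx : x ∈ K.columns n P) : K.tot.d n n' x ∈ K.columns n' P := by
  refine (AddSubgroup.closure_le ((K.columns n' P).comap (K.tot.d n n').hom)).2 ?_ hx
  rintro _ ⟨q, p, h, a, hp, rfl⟩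
  have h' : (p : ℤ) - (q + 1 : ℕ) = n' := by push_cast; omega
  obtain ⟨e, he, h1⟩ := d_incl q p n n' h h' a
  change K.tot.d n n' (K.incl q p n h a) ∈ K.columns n' P
  rw [h1]
  exact add_mem (units_smul_mem _ _ (incl_mem_columns h' _ hp)) (columns_mono hp.le he)

/-- The morphism of total complexes induced by a morphism of double complexes. -/
noncomputable abbrev totMap {K L : DoubleComplex.{u}} (φ : K ⟶ L) : K.tot ⟶ L.tot :=
  HomologicalComplex₂.total.map φ (ComplexShape.down ℤ)

lemma totMap_incl (φ : K ⟶ L) (q p : ℕ) (n : ℤ) (h : (p : ℤ) - q = n)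
    (a : (K.X q).X p) :
    (totMap φ).f n (K.incl q p n h a) = L.incl q p n h ((φ.f q).f p a) :=
  (ab_comp_apply (HomologicalComplex₂.ιTotal_map K L φ _ q p n h) a).trans rfl

lemma totMap_mem_columns (φ : K ⟶ L) {n : ℤ} {P : ℕ} {x : K.tot.X n} (hx : x ∈ K.columns n P) :
    (totMap φ).f n x ∈ L.columns n P := by
  refine (AddSubgroup.closure_le ((L.columns n P).comap ((totMap φ).f n).hom)).2 ?_ hx
  rintro _ ⟨q, p, h, a, hp, rfl⟩
  change (totMap φ).f n (K.incl q p n h a) ∈ L.columns n P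
  rw [totMap_incl]
  exact incl_mem_columns h _ hp

/-- The morphism between the columns of index `p` induced by a morphism of double complexes. -/
noncomputable abbrev columnMap (φ : K ⟶ L) (p : ℕ) :=
  ((HomologicalComplex.eval AddCommGrpCat.{u} (ComplexShape.down ℕ) p).mapHomologicalComplex
    (ComplexShape.up ℕ)).map φ

lemma units_smul_smul {A : Type*} [AddCommGroup A] (P : ℕ) (x : A) :
    (-1 : ℤˣ) ^ P • (-1 : ℤˣ) ^ P • x = x := by
  rw [smul_smul, Int.units_mul_self, one_smul]

lemma map_units_smul {A B : AddCommGrpCat.{u}} (f : A ⟶ B) (ε : ℤˣ) (x : A) :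
    f (ε • x) = ε • f x :=
  map_zsmul f.hom (ε : ℤ) x

/-- Covers the lower end `r = 0` together with the general case: there the term with `b` is zero and
`t = 0` works. -/
lemma exists_d_incl_prev (P r : ℕ) (n n' : ℤ) (hn : n' + 1 = n) (h : (P : ℤ) - r = n')
    (b : (K.X ((ComplexShape.up ℕ).prev r)).X P) :
    ∃ t, ∃ e ∈ K.columns n' P, K.tot.d n n' t =
      (-1 : ℤˣ) ^ P • K.incl r P n' h ((K.d _ r).f P b) + e := by
  cases r with
  | zero =>
    refine ⟨0, 0, zero_mem _, ?_⟩
    rw [K.shape _ _ (Nat.succ_ne_zero _)]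
    change K.tot.d n n' 0 = (-1 : ℤˣ) ^ P • K.incl 0 P n' h 0 + 0
    rw [map_zero, map_zero, smul_zero, add_zero]
  | succ r =>
    obtain ⟨i, hi⟩ : ∃ i, (ComplexShape.up ℕ).prev (r + 1) = i := ⟨_, rfl⟩
    revert b
    rw [hi]
    obtain rfl : r = i := (prev_nat_succ r).symm.trans hi
    exact fun b => ⟨_, d_incl r P n n' (by push_cast at h; omega) h b⟩

/-- The pair `(s, t)` is a cocycle of the cone of total complexes. Its component in the top column
is a cocycle of the cone of that column, hence a coboundary; subtracting the corresponding total
coboundary leaves a pair in lower columns. The process stops because `p ≥ 0`. -/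
lemma exists_of_columns (φ : K ⟶ L) (hφ : ∀ p, IsConeExact (columnMap φ p)) (P : ℕ)
    (n₀ n₁ n₂ n₃ : ℤ) (h₁ : n₀ + 1 = n₁) (h₂ : n₁ + 1 = n₂) (h₃ : n₂ + 1 = n₃)
    (s : K.tot.X n₁) (t : L.tot.X n₂) (hs : s ∈ K.columns n₁ P) (ht : t ∈ L.columns n₂ P)
    (hds : K.tot.d n₁ n₀ s = 0) (hst : (totMap φ).f n₁ s = L.tot.d n₂ n₁ t) :
    ∃ (s' : K.tot.X n₂) (t' : L.tot.X n₃),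
      s = K.tot.d n₂ n₁ s' ∧ t = (totMap φ).f n₂ s' + L.tot.d n₃ n₂ t' := by
  induction P generalizing s t with
  | zero =>
    rw [columns_zero hs, columns_zero ht]
    exact ⟨0, 0, by rw [map_zero], by rw [map_zero, map_zero, add_zero]⟩
  | succ P ih =>
    -- In this case column `P` contributes neither to degree `n₁` nor to degree `n₂`.
    by_cases hP : (P : ℤ) < n₁
    · exact ih s t (mem_columns_of_lt hP hs) (mem_columns_of_lt (by omega) ht) hds hst
    obtain ⟨q, hq⟩ : ∃ q : ℕ, (P : ℤ) - q = n₁ := ⟨((P : ℤ) - n₁).toNat, by omega⟩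
    obtain ⟨a, ha⟩ := exists_top_column hs hq
    have hq' : (P : ℤ) - (q + 1 : ℕ) = n₀ := by push_cast; omega
    have hda : (K.d q (q + 1)).f P a = 0 := by
      obtain ⟨e, he, h1⟩ := d_incl q P n₁ n₀ hq hq' a
      -- The component of `d s = 0` in column `P` is `± d a`, since all other terms lie in lower
      -- columns.
      have h2 := proj_columns (q := q + 1) (add_mem (d_mem_columns h₁ ha) he)
      rw [map_sub, hds, zero_sub, h1, neg_add, add_assoc, neg_add_cancel, add_zero, map_neg,
        neg_eq_zero, map_units_smul, proj_incl_self] at h2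
      rw [← units_smul_smul P ((K.d q (q + 1)).f P a), h2, smul_zero]
    have hφs : (totMap φ).f n₁ s - L.incl q P n₁ hq ((φ.f q).f P a) ∈ L.columns n₁ P := by
      rw [← totMap_incl, ← map_sub]
      exact totMap_mem_columns φ ha
    cases q with
    | zero =>
      -- For `q = 0` the matching component of `t` would have `q = -1`, so `t` already lies in the
      -- lower columns and the lowest degree of the cone forces `a = 0`.
      have ht' : t ∈ L.columns n₂ P := mem_columns_of_lt (by push_cast at hq; omega) ht
      have hφa : (φ.f 0).f P a = 0 := by
        have h2 := proj_columns (q := 0) (sub_mem (d_mem_columns h₂ ht') hφs)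
        rwa [hst, sub_sub_cancel, proj_incl_self] at h2
      have ha0 : a = 0 := (hφ P).zero a hda hφa
      rw [ha0, map_zero, sub_zero] at ha
      exact ih s t ha ht' hds hst
    | succ r =>
      have hr : (P : ℤ) - r = n₂ := by push_cast at hq; omega
      obtain ⟨b, hb⟩ := exists_top_column ht hr
      obtain ⟨e, he, h1⟩ := d_incl r P n₂ n₁ hr hq b
      -- The sign enters because the total differential carries `(-1) ^ P` on the part which raises
      -- `q`.
      have hab : (φ.f (r + 1)).f P a = (L.d r (r + 1)).f P ((-1 : ℤˣ) ^ P • b) := by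
        have h2 := proj_columns (q := r + 1) (sub_mem (add_mem (d_mem_columns h₂ hb) he) hφs)
        rw [map_sub (L.tot.d n₂ n₁).hom, h1, hst, sub_add_eq_sub_sub, sub_add_cancel,
          sub_sub_sub_cancel_left, map_sub, map_units_smul, proj_incl_self, proj_incl_self,
          sub_eq_zero] at h2
        rw [map_units_smul, h2]
      obtain ⟨a', b', ha', hb'⟩ : ∃ (a' : (K.X r).X P)
          (b' : (L.X ((ComplexShape.up ℕ).prev r)).X P), a = (K.d r (r + 1)).f P a' ∧
            (-1 : ℤˣ) ^ P • b = (φ.f r).f P a' + (L.d _ r).f P b' :=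
        (hφ P).succ r a ((-1 : ℤˣ) ^ P • b) hda hab
      obtain ⟨t₁, e₁, he₁, ht₁⟩ := exists_d_incl_prev P r n₃ n₂ h₃ hr b'
      obtain ⟨e₂, he₂, h2⟩ := d_incl r P n₂ n₁ hr hq a'
      let s₁ : K.tot.X n₂ := (-1 : ℤˣ) ^ P • K.incl r P n₂ hr a'
      have hs₁ : K.tot.d n₂ n₁ s₁ = K.incl (r + 1) P n₁ hq a + (-1 : ℤˣ) ^ P • e₂ := by
        rw [map_units_smul, h2, ← ha', smul_add, units_smul_smul]
      have hφs₁ : (totMap φ).f n₂ s₁ = (-1 : ℤˣ) ^ P • L.incl r P n₂ hr ((φ.f r).f P a') := by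
        rw [map_units_smul, totMap_incl]
      have hinclb : L.incl r P n₂ hr b =
          (totMap φ).f n₂ s₁ + (-1 : ℤˣ) ^ P • L.incl r P n₂ hr ((L.d _ r).f P b') := by
        rw [hφs₁, ← smul_add, ← map_add, ← hb', map_units_smul, units_smul_smul]
      -- After the coboundary of `(s₁, t₁)` is subtracted, the components in column `P` cancel and
      -- the induction hypothesis applies to the rest.
      obtain ⟨s', t', h3, h4⟩ := ih (s - K.tot.d n₂ n₁ s₁)
        (t - (totMap φ).f n₂ s₁ - L.tot.d n₃ n₂ t₁)
        (by
          rw [hs₁, ← sub_sub]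
          exact sub_mem ha (units_smul_mem _ _ he₂))
        (by
          rw [ht₁, sub_sub, ← add_assoc, ← hinclb, ← sub_sub]
          exact sub_mem hb he₁)
        (by rw [map_sub, hds, d_d_apply, sub_zero])
        (by rw [map_sub, map_sub, map_sub, f_d_apply, d_d_apply, sub_zero, hst])
      refine ⟨s₁ + s', t₁ + t', ?_, ?_⟩
      · rw [map_add, ← h3, add_sub_cancel]
      · rw [sub_sub, sub_eq_iff_eq_add] at h4
        rw [h4, map_add, map_add]
        abel

theorem quasiIso_totMap (φ : K ⟶ L) (hφ : ∀ p, IsConeExact (columnMap φ p)) :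
    QuasiIso (totMap φ) := by
  have key : ∀ (n₀ n₁ n₂ n₃ : ℤ), n₀ + 1 = n₁ → n₁ + 1 = n₂ → n₂ + 1 = n₃ →
      ∀ (s : K.tot.X n₁) (t : L.tot.X n₂), K.tot.d n₁ n₀ s = 0 →
        (totMap φ).f n₁ s = L.tot.d n₂ n₁ t → ∃ (s' : K.tot.X n₂) (t' : L.tot.X n₃),
          s = K.tot.d n₂ n₁ s' ∧ t = (totMap φ).f n₂ s' + L.tot.d n₃ n₂ t' := by
    intro n₀ n₁ n₂ n₃ h₁ h₂ h₃ s t hds hst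
    obtain ⟨P, hP⟩ := exists_mem_columns s
    obtain ⟨Q, hQ⟩ := exists_mem_columns t
    exact exists_of_columns φ hφ (max P Q) n₀ n₁ n₂ n₃ h₁ h₂ h₃ s t
      (columns_mono (le_max_left _ _) hP) (columns_mono (le_max_right _ _) hQ) hds hst
  rw [quasiIso_iff]
  intro n
  rw [ab_quasiIsoAt_iff (totMap φ) (n + 1) n (n - 1) ((ComplexShape.down ℤ).prev_eq' rfl)
    ((ComplexShape.down ℤ).next_eq' (by simp))]
  constructor
  · rintro s hs ⟨t, hst⟩
    obtain ⟨s', -, h, -⟩ := key (n - 1) n (n + 1) (n + 2) (by omega) rfl (by omega) s t hs hst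
    exact ⟨s', h⟩
  · intro t ht
    -- Surjectivity is the cone condition for the pair `(0, t)`, one degree lower.
    obtain ⟨s', t', h, h'⟩ := key (n - 2) (n - 1) n (n + 1) (by omega) (by omega) rfl 0 t
      (map_zero _) (by rw [map_zero, ht])
    exact ⟨s', h.symm, t', h'⟩

lemma barD_zero (q : ℕ) (n' : ℤ) (a : (K.X q).X 0) : K.barD q 0 n' a = 0 := by
  rw [barD, K.d₂_eq_zero _ _ _ _ (fun h => Nat.succ_ne_zero _ h)]
  rfl

lemma barD_succ (q P : ℕ) (n' : ℤ) (h : (P : ℤ) - q = n') (a : (K.X q).X (P + 1)) :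
    K.barD q (P + 1) n' a = K.incl q P n' h ((K.X q).d (P + 1) P a) := by
  rw [barD, K.d₂_eq (ComplexShape.down ℤ) q (i₂' := P) rfl n' h]
  change (1 : ℤˣ) • K.incl q P n' h ((K.X q).d (P + 1) P a) = _
  rw [one_smul]

lemma d_incl_eq (q P : ℕ) (n n' : ℤ) (h : (P : ℤ) - q = n) (h' : (P : ℤ) - (q + 1 : ℕ) = n')
    (a : (K.X q).X P) :
    K.tot.d n n' (K.incl q P n h a) =
      (-1 : ℤˣ) ^ P • K.incl (q + 1) P n' h' ((K.d q (q + 1)).f P a) + K.barD q P n' a :=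
  ab_comp_apply (incl_d q P n n' h h') a

lemma tot_induction {n : ℤ} {A : AddCommGrpCat.{u}} {f g : K.tot.X n ⟶ A}
    (h : ∀ q p h a, f (K.incl q p n h a) = g (K.incl q p n h a)) (x : K.tot.X n) : f x = g x := by
  have : f = g := by
    refine HomologicalComplex₂.total.hom_ext _ fun q p hn => ?_
    ext a
    exact h q p hn a
  rw [this]

/-- The homotopy operator on total complexes given by a homotopy in the direction of `q`. -/
noncomputable def totHomotopy (k : ∀ q, K.X (q + 1) ⟶ L.X q) (n n' : ℤ) (hn : n + 1 = n') :
    K.tot.X n ⟶ L.tot.X n' :=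
  K.totalDesc fun q p h => match q, h with
    | 0, _ => 0
    | r + 1, h => (-1 : ℤˣ) ^ p • ((k r).f p ≫ L.incl r p n' (by
        change (p : ℤ) - (r + 1 : ℕ) = n at h
        push_cast at h; omega))

lemma totHomotopy_zero (k : ∀ q, K.X (q + 1) ⟶ L.X q) (n n' : ℤ) (hn : n + 1 = n') (p : ℕ)
    (h : (p : ℤ) - (0 : ℕ) = n) (a : (K.X 0).X p) :
    totHomotopy k n n' hn (K.incl 0 p n h a) = 0 :=
  ab_comp_apply (K.ι_totalDesc _ 0 p h) a

lemma totHomotopy_succ (k : ∀ q, K.X (q + 1) ⟶ L.X q) (n n' : ℤ) (hn : n + 1 = n') (r p : ℕ)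
    (h : (p : ℤ) - (r + 1 : ℕ) = n) (h' : (p : ℤ) - r = n') (a : (K.X (r + 1)).X p) :
    totHomotopy k n n' hn (K.incl (r + 1) p n h a) =
      (-1 : ℤˣ) ^ p • L.incl r p n' h' ((k r).f p a) :=
  ab_comp_apply (K.ι_totalDesc _ (r + 1) p h) a

/-- Each `k r` commutes with the bar differential, which lowers `p` by one; the factor `(-1) ^ p` in
`totHomotopy` turns this into anticommutation, so that these terms cancel in `d h + h d`. -/
lemma totHomotopy_barD (k : ∀ q, K.X (q + 1) ⟶ L.X q) (n n' : ℤ) (hn : n + 1 = n') (r p : ℕ)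
    (h : (p : ℤ) - r = n' + 1) (a : (K.X (r + 1)).X p) :
    totHomotopy k n n' hn (K.barD (r + 1) p n a) =
      - ((-1 : ℤˣ) ^ p • L.barD r p n' ((k r).f p a)) := by
  cases p with
  | zero => rw [barD_zero, barD_zero, map_zero, smul_zero, neg_zero]
  | succ p =>
    rw [barD_succ _ _ _ (by push_cast at h ⊢; omega), barD_succ _ _ _ (by push_cast at h; omega),
      totHomotopy_succ, ← f_d_apply, pow_succ, mul_smul, Units.neg_smul, one_smul, smul_neg,
      neg_neg]

lemma totHomotopy_barD_zero (k : ∀ q, K.X (q + 1) ⟶ L.X q) (n n' : ℤ) (hn : n + 1 = n') (p : ℕ)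
    (h : (p : ℤ) = n' ) (a : (K.X 0).X p) :
    totHomotopy k n n' hn (K.barD 0 p n a) = 0 := by
  cases p with
  | zero => rw [barD_zero, map_zero]
  | succ p => rw [barD_succ _ _ _ (by push_cast at h ⊢; omega), totHomotopy_zero]

lemma totMap_eq_add_homotopy (φ ψ : K ⟶ L) (k : ∀ q, K.X (q + 1) ⟶ L.X q)
    (h0 : ∀ p (a : (K.X 0).X p), (φ.f 0).f p a = (ψ.f 0).f p a + (k 0).f p ((K.d 0 1).f p a))
    (h1 : ∀ r p (a : (K.X (r + 1)).X p), (φ.f (r + 1)).f p a = (ψ.f (r + 1)).f p a +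
      (L.d r (r + 1)).f p ((k r).f p a) + (k (r + 1)).f p ((K.d (r + 1) (r + 2)).f p a))
    (n₀ n₁ n₂ : ℤ) (hn₁ : n₀ + 1 = n₁) (hn₂ : n₁ + 1 = n₂) (x : K.tot.X n₁) :
    (totMap φ).f n₁ x = (totMap ψ).f n₁ x + L.tot.d n₂ n₁ (totHomotopy k n₁ n₂ hn₂ x) +
      totHomotopy k n₀ n₁ hn₁ (K.tot.d n₁ n₀ x) := by
  refine tot_induction (f := (totMap φ).f n₁) (g := (totMap ψ).f n₁ +
    totHomotopy k n₁ n₂ hn₂ ≫ L.tot.d n₂ n₁ + K.tot.d n₁ n₀ ≫ totHomotopy k n₀ n₁ hn₁) ?_ x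
  intro q p h a
  change _ = (totMap ψ).f n₁ (K.incl q p n₁ h a) +
    L.tot.d n₂ n₁ (totHomotopy k n₁ n₂ hn₂ (K.incl q p n₁ h a)) +
    totHomotopy k n₀ n₁ hn₁ (K.tot.d n₁ n₀ (K.incl q p n₁ h a))
  rw [totMap_incl, totMap_incl, d_incl_eq q p n₁ n₀ h (by push_cast; omega), map_add,
    map_units_smul]
  cases q with
  | zero =>
    rw [totHomotopy_zero, map_zero, totHomotopy_barD_zero _ _ _ _ _ (by push_cast at h; omega),
      totHomotopy_succ k n₀ n₁ hn₁ 0 p _ h, units_smul_smul, h0, map_add, add_zero, add_zero]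
  | succ r =>
    rw [totHomotopy_succ k n₁ n₂ hn₂ r p h (by push_cast at h; omega), map_units_smul,
      d_incl_eq r p n₂ n₁ _ h, totHomotopy_barD _ _ _ _ _ _ (by push_cast at h; omega),
      totHomotopy_succ k n₀ n₁ hn₁ (r + 1) p _ h, smul_add, units_smul_smul, units_smul_smul, h1,
      map_add, map_add]
    abel

lemma homologyMap_totMap_eq (φ ψ : K ⟶ L) (k : ∀ q, K.X (q + 1) ⟶ L.X q)
    (h0 : ∀ p (a : (K.X 0).X p), (φ.f 0).f p a = (ψ.f 0).f p a + (k 0).f p ((K.d 0 1).f p a))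
    (h1 : ∀ r p (a : (K.X (r + 1)).X p), (φ.f (r + 1)).f p a = (ψ.f (r + 1)).f p a +
      (L.d r (r + 1)).f p ((k r).f p a) + (k (r + 1)).f p ((K.d (r + 1) (r + 2)).f p a)) (n : ℤ) :
    HomologicalComplex.homologyMap (totMap φ) n = HomologicalComplex.homologyMap (totMap ψ) n := by
  refine ab_homologyMap_eq _ _ (n + 1) n (n - 1) ((ComplexShape.down ℤ).prev_eq' rfl)
    ((ComplexShape.down ℤ).next_eq' (by simp)) fun x hx => ⟨totHomotopy k n (n + 1) rfl x, ?_⟩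
  rw [totMap_eq_add_homotopy φ ψ k h0 h1 (n - 1) n (n + 1) (by omega) rfl, hx, map_zero, add_zero]

end DoubleComplex
end TotalComplexes

/-! ### Compactly supported sections of exact complexes of `c`-soft sheaves. -/

section SoftSequences

open Filter

/-- A predicate on compact subsets of a compact set which holds locally and is stable under unions
holds for the whole set. -/
lemma isCompact_union_induction {Y : Type*} [TopologicalSpace Y] [R1Space Y] {P : Set Y → Prop}
    {K : Set Y} (hK : IsCompact K) (empty : P ∅)
    (nhd : ∀ y ∈ K, ∃ U ∈ 𝓝 y, ∀ L ⊆ U, IsCompact L → P L)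
    (union : ∀ K₁ K₂, IsCompact K₁ → IsCompact K₂ → P K₁ → P K₂ → P (K₁ ∪ K₂)) : P K := by
  classical
  choose! U hU hP using nhd
  obtain ⟨t, htK⟩ := hK.elim_nhds_subcover' (fun y _ => interior (U y))
    (fun y hy => interior_mem_nhds.2 (hU y hy))
  -- The cover is shrunk to compact pieces, since `P` is known only for compact subsets of the
  -- neighbourhoods.
  obtain ⟨L, hL, hLU, hKL⟩ := hK.finite_compact_cover t (fun y => interior (U y))
    (fun _ _ => isOpen_interior) htK
  have key : ∀ t' ⊆ t, IsCompact (⋃ i ∈ t', L i) ∧ P (⋃ i ∈ t', L i) := by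
    intro t'
    induction t' using Finset.induction_on with
    | empty => intro _; simpa using empty
    | insert i t' _ ih =>
      intro h
      obtain ⟨h1, h2⟩ := ih ((Finset.subset_insert _ _).trans h)
      rw [Finset.set_biUnion_insert]
      refine ⟨(hL i).union h1, union _ _ (hL i) h1 ?_ h2⟩
      exact hP i i.2 _ ((hLU i).trans interior_subset) (hL i)
  rw [hKL]
  exact (key t subset_rfl).2

/-- A `c`-soft sheaf of abelian groups on `Y`, described by its stalks and by the (possibly
discontinuous) global sections which are continuous near a given point. -/
structure SoftGerms (Y : Type u) [TopologicalSpace Y] where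
  /-- the stalks -/
  stalk : Y → Type u
  /-- the group structure of the stalks -/
  [group : ∀ y, AddCommGroup (stalk y)]
  /-- the section `s` is continuous near `y` -/
  IsSec : (∀ y, stalk y) → Y → Prop
  isSec_zero : ∀ y, IsSec 0 y
  isSec_add : ∀ {s t y}, IsSec s y → IsSec t y → IsSec (s + t) y
  isSec_neg : ∀ {s y}, IsSec s y → IsSec (-s) y
  isSec_congr : ∀ {s t y}, (∀ᶠ y' in 𝓝 y, s y' = t y') → IsSec s y → IsSec t y
  eventually_isSec : ∀ {s y}, IsSec s y → ∀ᶠ y' in 𝓝 y, IsSec s y'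
  eventually_eq_zero : ∀ {s y}, IsSec s y → s y = 0 → ∀ᶠ y' in 𝓝 y, s y' = 0
  exists_isSec : ∀ {y} (m : stalk y), ∃ s, IsSec s y ∧ s y = m
  exists_extension : ∀ {K : Set Y}, IsCompact K → ∀ s, (∀ y ∈ K, IsSec s y) →
    ∃ t, (∀ y, IsSec t y) ∧ IsCompact (closure {y | t y ≠ 0}) ∧ ∀ᶠ y in 𝓝ˢ K, t y = s y

attribute [instance] SoftGerms.group

namespace SoftGerms

variable {Y : Type u} [TopologicalSpace Y]

lemma isSec_sub (M : SoftGerms Y) {s t : ∀ y, M.stalk y} {y : Y} (hs : M.IsSec s y)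
    (ht : M.IsSec t y) : M.IsSec (s - t) y := by
  rw [sub_eq_add_neg]
  exact M.isSec_add hs (M.isSec_neg ht)

lemma eventually_eq (M : SoftGerms Y) {s t : ∀ y, M.stalk y} {y : Y} (hs : M.IsSec s y)
    (ht : M.IsSec t y) (h : s y = t y) : ∀ᶠ y' in 𝓝 y, s y' = t y' := by
  filter_upwards [M.eventually_eq_zero (M.isSec_sub hs ht) (sub_eq_zero.2 h)] with y' hy'
  exact sub_eq_zero.1 hy'

/-- The direct sum of two `c`-soft sheaves. -/
def prod (M N : SoftGerms Y) : SoftGerms Y where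
  stalk y := M.stalk y × N.stalk y
  IsSec s y := M.IsSec (fun y => (s y).1) y ∧ N.IsSec (fun y => (s y).2) y
  isSec_zero y := ⟨M.isSec_zero y, N.isSec_zero y⟩
  isSec_add hs ht := ⟨M.isSec_add hs.1 ht.1, N.isSec_add hs.2 ht.2⟩
  isSec_neg hs := ⟨M.isSec_neg hs.1, N.isSec_neg hs.2⟩
  isSec_congr h hs := ⟨M.isSec_congr (h.mono fun _ h => congrArg Prod.fst h) hs.1,
    N.isSec_congr (h.mono fun _ h => congrArg Prod.snd h) hs.2⟩
  eventually_isSec hs := (M.eventually_isSec hs.1).and (N.eventually_isSec hs.2)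
  eventually_eq_zero hs h := ((M.eventually_eq_zero hs.1 (congrArg Prod.fst h)).and
    (N.eventually_eq_zero hs.2 (congrArg Prod.snd h))).mono fun _ h => Prod.ext h.1 h.2
  exists_isSec m := by
    obtain ⟨s, hs, h⟩ := M.exists_isSec m.1
    obtain ⟨t, ht, h'⟩ := N.exists_isSec m.2
    exact ⟨fun y => (s y, t y), ⟨hs, ht⟩, Prod.ext h h'⟩
  exists_extension hK s hs := by
    obtain ⟨t, ht, htK, hts⟩ := M.exists_extension hK _ fun y hy => (hs y hy).1
    obtain ⟨t', ht', htK', hts'⟩ := N.exists_extension hK _ fun y hy => (hs y hy).2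
    refine ⟨fun y => (t y, t' y), fun y => ⟨ht y, ht' y⟩,
      (htK.union htK').of_isClosed_subset isClosed_closure ?_,
      (hts.and hts').mono fun _ h => Prod.ext h.1 h.2⟩
    rw [← closure_union]
    refine closure_mono fun y hy => ?_
    by_contra h
    simp only [Set.mem_union, Set.mem_ofPred_eq, not_or, not_not] at h
    exact hy (Prod.ext h.1 h.2)

/-- Morphisms between sheaves described by germs: homomorphisms of the stalks which preserve
continuous sections. -/
structure Hom (M N : SoftGerms Y) where
  /-- the homomorphisms of the stalks -/
  app : ∀ y, M.stalk y →+ N.stalk y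
  isSec_app : ∀ {s y}, M.IsSec s y → N.IsSec (fun y => app y (s y)) y

/-- For compact sets in a Hausdorff space the neighbourhoods of `K₁ ∩ K₂` are generated by
intersections of neighbourhoods of `K₁` and of `K₂`. Agreement on one such `U₁ ∩ U₂` allows `s` to
be used on `U₁` and `t` elsewhere; no continuity is at stake, because families may be discontinuous.
-/
lemma exists_glue [T2Space Y] (M : SoftGerms Y) {K₁ K₂ : Set Y} (hK₁ : IsCompact K₁)
    (hK₂ : IsCompact K₂) {s t : ∀ y, M.stalk y} (h : ∀ᶠ y in 𝓝ˢ (K₁ ∩ K₂), s y = t y) :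
    ∃ r : ∀ y, M.stalk y, (∀ᶠ y in 𝓝ˢ K₁, r y = s y) ∧ ∀ᶠ y in 𝓝ˢ K₂, r y = t y := by
  classical
  rw [hK₁.nhdsSet_inter_eq hK₂, Filter.eventually_inf] at h
  obtain ⟨U₁, hU₁, U₂, hU₂, h⟩ := h
  refine ⟨fun y => if y ∈ U₁ then s y else t y, ?_, ?_⟩
  · filter_upwards [hU₁] with y hy
    exact if_pos hy
  · filter_upwards [hU₂] with y hy
    by_cases hy' : y ∈ U₁
    · simpa [hy'] using h y ⟨hy', hy⟩
    · exact if_neg hy'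

lemma isSec_congr_nhdsSet (M : SoftGerms Y) {K : Set Y} {s t : ∀ y, M.stalk y}
    (h : ∀ᶠ y in 𝓝ˢ K, s y = t y) {y : Y} (hy : y ∈ K) (hs : M.IsSec t y) : M.IsSec s y :=
  M.isSec_congr ((eventually_nhdsSet_iff_forall.1 h y hy).mono fun _ h => h.symm) hs

variable {M N R : SoftGerms Y} (f : Hom M N) (g : Hom N R)

/-- A section over a neighbourhood of a compact set which is killed by `g` is in the image of `f`
near this compact set, if every section of the kernel of `f` over a neighbourhood of a compact set
extends to a global section of this kernel. -/
lemma exists_primitive_near [T2Space Y] (hfg : ∀ y, Function.Exact (f.app y) (g.app y))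
    (hf : ∀ (K : Set Y), IsCompact K → ∀ s, (∀ y ∈ K, M.IsSec s y) →
      (∀ᶠ y in 𝓝ˢ K, f.app y (s y) = 0) →
        ∃ t, (∀ y, M.IsSec t y) ∧ (∀ y, f.app y (t y) = 0) ∧ ∀ᶠ y in 𝓝ˢ K, t y = s y)
    {K : Set Y} (hK : IsCompact K) {s : ∀ y, N.stalk y} (hs : ∀ y ∈ K, N.IsSec s y)
    (hgs : ∀ y ∈ K, g.app y (s y) = 0) :
    ∃ t, (∀ y ∈ K, M.IsSec t y) ∧ ∀ᶠ y in 𝓝ˢ K, f.app y (t y) = s y := by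
  refine isCompact_union_induction (P := fun K => ∃ t, (∀ y ∈ K, M.IsSec t y) ∧
    ∀ᶠ y in 𝓝ˢ K, f.app y (t y) = s y) hK ⟨0, by simp, by simp⟩ (fun y hy => ?_) ?_
  -- Locally, stalkwise exactness gives a germ of a primitive, and an equality of germs of sections
  -- at `y` persists near `y`.
  · obtain ⟨m, hm⟩ := (hfg y _).1 (hgs y hy)
    obtain ⟨t, ht, rfl⟩ := M.exists_isSec m
    refine ⟨_, (M.eventually_isSec ht).and (N.eventually_eq (f.isSec_app ht) (hs y hy)
      hm).eventually_nhds, fun L hL _ => ⟨t, fun y hy => (hL hy).1, ?_⟩⟩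
    exact eventually_nhdsSet_iff_forall.2 fun y hy => (hL hy).2
  -- Two primitives differ near `K₁ ∩ K₂` by a section of the kernel of `f`; its global extension
  -- `c` corrects the second primitive so that it can be glued to the first.
  · rintro K₁ K₂ hK₁ hK₂ ⟨t₁, ht₁, hs₁⟩ ⟨t₂, ht₂, hs₂⟩
    obtain ⟨c, hc, hfc, hct⟩ := hf (K₁ ∩ K₂) (hK₁.inter_right hK₂.isClosed) (t₁ - t₂)
      (fun y hy => M.isSec_sub (ht₁ y hy.1) (ht₂ y hy.2)) (by
        filter_upwards [nhdsSet_mono Set.inter_subset_left hs₁,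
          nhdsSet_mono Set.inter_subset_right hs₂] with y h1 h2
        rw [Pi.sub_apply, map_sub, h1, h2, sub_self])
    obtain ⟨t, h1, h2⟩ := M.exists_glue hK₁ hK₂ (s := t₁) (t := t₂ + c) (by
      filter_upwards [hct] with y hy
      rw [Pi.add_apply, hy, Pi.sub_apply, add_sub_cancel])
    refine ⟨t, ?_, ?_⟩
    · rintro y (hy | hy)
      · exact M.isSec_congr_nhdsSet h1 hy (ht₁ y hy)
      · exact M.isSec_congr_nhdsSet h2 hy (M.isSec_add (ht₂ y hy) (hc y))
    · rw [nhdsSet_union]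
      refine Filter.eventually_sup.2 ⟨?_, ?_⟩
      · filter_upwards [h1, hs₁] with y h1 h2
        rw [h1, h2]
      · filter_upwards [h2, hs₂] with y h1 h2
        rw [h1, Pi.add_apply, map_add, h2, hfc, add_zero]

/-- Compactly supported sections killed by `g` have a compactly supported primitive. -/
lemma exists_primitive [T2Space Y] [LocallyCompactSpace Y]
    (hfg : ∀ y, Function.Exact (f.app y) (g.app y))
    (hf : ∀ (K : Set Y), IsCompact K → ∀ s, (∀ y ∈ K, M.IsSec s y) →
      (∀ᶠ y in 𝓝ˢ K, f.app y (s y) = 0) →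
        ∃ t, (∀ y, M.IsSec t y) ∧ (∀ y, f.app y (t y) = 0) ∧ ∀ᶠ y in 𝓝ˢ K, t y = s y)
    {s : ∀ y, N.stalk y} (hs : ∀ y, N.IsSec s y) (hsK : IsCompact (closure {y | s y ≠ 0}))
    (hgs : ∀ y, g.app y (s y) = 0) :
    ∃ t, (∀ y, M.IsSec t y) ∧ IsCompact (closure {y | t y ≠ 0}) ∧ ∀ y, f.app y (t y) = s y := by
  classical
  obtain ⟨K, hK, hsK'⟩ := exists_compact_superset hsK
  have hs0 : ∀ y, y ∉ interior K → ∀ᶠ y' in 𝓝 y, s y' = 0 := fun y hy => by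
    filter_upwards [isClosed_closure.isOpen_compl.mem_nhds fun h => hy (hsK' h)] with y' hy'
    by_contra h
    exact hy' (subset_closure h)
  obtain ⟨t, ht, hts⟩ := exists_primitive_near f g hfg hf hK (fun y _ => hs y) fun y _ => hgs y
  -- Near the boundary of `K` the section `s` vanishes, so there the primitive `t` lies in the
  -- kernel of `f`. Subtracting a global extension of it makes the primitive vanish near the
  -- boundary, and it can be continued by zero.
  obtain ⟨c, hc, hfc, hct⟩ := hf (K \ interior K) (hK.diff isOpen_interior) t
    (fun y hy => ht y hy.1) (eventually_nhdsSet_iff_forall.2 fun y hy => by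
      filter_upwards [hs0 y hy.2, eventually_nhdsSet_iff_forall.1 hts y hy.1] with y' h1 h2
      rw [h2, h1])
  let r : ∀ y, M.stalk y := fun y => if y ∈ K then t y - c y else 0
  refine ⟨r, fun y => ?_, hK.of_isClosed_subset isClosed_closure
    (closure_minimal (fun y hy => by_contra fun h => hy (if_neg h)) hK.isClosed), fun y => ?_⟩
  · by_cases hy : y ∈ interior K
    · refine M.isSec_congr (s := t - c) ?_ (M.isSec_sub (ht y (interior_subset hy)) (hc y))
      filter_upwards [isOpen_interior.mem_nhds hy] with y' hy'
      exact (if_pos (interior_subset hy')).symm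
    · refine M.isSec_congr (s := 0) ?_ (M.isSec_zero y)
      by_cases hyK : y ∈ K
      · filter_upwards [eventually_nhdsSet_iff_forall.1 hct y ⟨hyK, hy⟩] with y' hy'
        simp [r, hy']
      · filter_upwards [hK.isClosed.isOpen_compl.mem_nhds hyK] with y' hy'
        exact (if_neg hy').symm
  · by_cases hy : y ∈ K
    · simp only [r, if_pos hy]
      rw [map_sub, hfc, sub_zero, hts.self_of_nhdsSet y hy]
    · simp only [r, if_neg hy, map_zero]
      exact ((hs0 y fun h => hy (interior_subset h)).self_of_nhds).symm

/-- Supplies the extension hypothesis of the two preceding lemmas. The kernel in degree `q + 1` is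
the image of `M q`: a closed section near `K` has a primitive near `K` by the induction hypothesis,
the primitive extends by softness, and the differential of that extension is closed. In degree `0`
the kernel is zero. -/
lemma exists_closed_extension [T2Space Y] {M : ℕ → SoftGerms Y} (d : ∀ q, Hom (M q) (M (q + 1)))
    (h0 : ∀ y, Function.Injective ((d 0).app y))
    (hd : ∀ q y, Function.Exact ((d q).app y) ((d (q + 1)).app y)) (q : ℕ) (K : Set Y)
    (hK : IsCompact K) (s : ∀ y, (M q).stalk y) (hs : ∀ y ∈ K, (M q).IsSec s y)
    (hds : ∀ᶠ y in 𝓝ˢ K, (d q).app y (s y) = 0) :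
    ∃ t, (∀ y, (M q).IsSec t y) ∧ (∀ y, (d q).app y (t y) = 0) ∧ ∀ᶠ y in 𝓝ˢ K, t y = s y := by
  induction q generalizing K with
  | zero =>
    refine ⟨0, (M 0).isSec_zero, fun y => map_zero _, hds.mono fun y hy => ?_⟩
    exact (h0 y (hy.trans (map_zero _).symm)).symm
  | succ q ih =>
    obtain ⟨t, ht, hts⟩ := exists_primitive_near (d q) (d (q + 1)) (hd q) ih hK hs
      hds.self_of_nhdsSet
    obtain ⟨v, hv, -, hvt⟩ := (M q).exists_extension hK t ht
    refine ⟨fun y => (d q).app y (v y), fun y => (d q).isSec_app (hv y),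
      fun y => (hd q y).apply_apply_eq_zero _, ?_⟩
    filter_upwards [hts, hvt] with y h1 h2
    rw [h2, h1]

end SoftGerms

end SoftSequences

/-! ### Local sections, and `c`-softness of pullbacks along local homeomorphisms. -/

namespace EtaleSheaf

open Filter

variable {X : Type u} [TopologicalSpace X] (S : EtaleSheaf X) {Y : Type u} [TopologicalSpace Y]
  {τ : Y → X}

/-- The family `s` of elements of the stalks is a section of the pullback sheaf `τ^* S` near `y`. -/
def IsSecAt (s : ∀ y, S.stalk (τ y)) (y : Y) : Prop :=
  ∃ U, IsOpen U ∧ y ∈ U ∧ ContinuousOn (fun y => S.pt (s y)) U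

variable {S} {s t : ∀ y, S.stalk (τ y)} {y : Y}

lemma isSecAt_of_continuous (h : Continuous fun y => S.pt (s y)) (y : Y) : S.IsSecAt s y :=
  ⟨Set.univ, isOpen_univ, trivial, h.continuousOn⟩

lemma continuous_of_isSecAt (h : ∀ y, S.IsSecAt s y) : Continuous fun y => S.pt (s y) :=
  continuous_iff_continuousAt.2 fun y => by
    obtain ⟨U, hU, hy, h⟩ := h y
    exact h.continuousAt (hU.mem_nhds hy)

lemma IsSecAt.congr (h : ∀ᶠ y' in 𝓝 y, s y' = t y') (hs : S.IsSecAt s y) : S.IsSecAt t y := by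
  obtain ⟨U, hU, hy, hs⟩ := hs
  obtain ⟨V, hV, hVo, hyV⟩ := eventually_nhds_iff.1 h
  refine ⟨U ∩ V, hU.inter hVo, ⟨hy, hyV⟩, (hs.mono Set.inter_subset_left).congr ?_⟩
  intro y' hy'
  exact congrArg S.pt (hV y' hy'.2).symm

lemma IsSecAt.eventually (hs : S.IsSecAt s y) : ∀ᶠ y' in 𝓝 y, S.IsSecAt s y' := by
  obtain ⟨U, hU, hy, hs⟩ := hs
  filter_upwards [hU.mem_nhds hy] with y' hy'
  exact ⟨U, hU, hy', hs⟩

lemma IsSecAt.add (hs : S.IsSecAt s y) (ht : S.IsSecAt t y) :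
    S.IsSecAt (s + t) y := by
  obtain ⟨U, hU, hy, hs⟩ := hs
  obtain ⟨V, hV, hyV, ht⟩ := ht
  refine ⟨U ∩ V, hU.inter hV, ⟨hy, hyV⟩, continuousOn_iff_continuous_domRestrict.2 ?_⟩
  exact S.continuous_pt_add (τ := fun y : ↑(U ∩ V) => τ y) (s := fun y => s y) (t := fun y => t y)
    (continuousOn_iff_continuous_domRestrict.1 (hs.mono Set.inter_subset_left))
    (continuousOn_iff_continuous_domRestrict.1 (ht.mono Set.inter_subset_right))

lemma IsSecAt.neg (hs : S.IsSecAt s y) : S.IsSecAt (-s) y := by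
  obtain ⟨U, hU, hy, hs⟩ := hs
  refine ⟨U, hU, hy, continuousOn_iff_continuous_domRestrict.2 ?_⟩
  exact S.continuous_pt_neg (τ := fun y : U => τ y) (s := fun y => s y)
    (continuousOn_iff_continuous_domRestrict.1 hs)

/-- The zero section is open in the étale space. -/
lemma IsSecAt.eventually_eq_zero (hs : S.IsSecAt s y) (h : s y = 0) :
    ∀ᶠ y' in 𝓝 y, s y' = 0 := by
  obtain ⟨U, hU, hy, hs⟩ := hs
  have h1 := S.isClosed_support (τ := fun y : U => τ y) (s := fun y => s y)
    (continuousOn_iff_continuous_domRestrict.1 hs)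
  have h2 := h1.isOpen_compl.mem_nhds (x := ⟨y, hy⟩) (by simpa using h)
  have h3 := hU.isOpenEmbedding_subtypeVal.image_mem_nhds.2 h2
  filter_upwards [h3] with y' hy'
  obtain ⟨z, hz, rfl⟩ := hy'
  simpa using hz

-- A local inverse of the projection is a section through the given germ; outside its domain the
-- family is set to zero.
variable (S) in
lemma exists_isSecAt (x : X) (m : S.stalk x) :
    ∃ s : ∀ x, S.stalk x, S.IsSecAt (τ := fun x => x) s x ∧ s x = m := by
  classical
  have hS := S.isLocalHomeomorph_total
  let a : S.Total := S.pt m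
  let e := hS.localInverseAt a
  have he : ∀ x' ∈ e.source, (e x').1 = x' := fun x' hx' => hS.apply_localInverseAt_of_mem hx'
  let s : ∀ x, S.stalk x := fun x' => if h : (e x').1 = x' then h ▸ (e x').2 else 0
  have hs : ∀ x' ∈ e.source, S.pt (s x') = e x' := by
    intro x' hx'
    have h := he x' hx'
    have key : ∀ (b : S.Total) (h : b.1 = x'), S.pt (h ▸ b.2 : S.stalk x') = b := by
      rintro ⟨_, b⟩ rfl
      rfl
    simp only [s, dif_pos h]
    exact key _ h
  have hx : x ∈ e.source := hS.apply_self_mem_localInverseAt_source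
  refine ⟨s, ⟨e.source, e.open_source, hx, e.continuousOn.congr hs⟩, ?_⟩
  have h1 : S.pt (s x) = S.pt m := (hs x hx).trans hS.localInverseAt_apply_self
  exact eq_of_heq (Sigma.mk.inj h1).2

lemma IsSecAt.comp {Z : Type u} [TopologicalSpace Z] {g : Z → Y} (hg : Continuous g) {z : Z}
    (hs : S.IsSecAt s (g z)) : S.IsSecAt (τ := τ ∘ g) (fun z => s (g z)) z := by
  obtain ⟨U, hU, hy, hs⟩ := hs
  exact ⟨g ⁻¹' U, hU.preimage hg, hy, hs.comp hg.continuousOn fun _ h => h⟩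

/-- The points near which `s` is a section form an open set, to which softness applies. -/
lemma IsCSoft.exists_extension (hS : S.IsCSoft) {K : Set X} (hK : IsCompact K)
    (s : ∀ x, S.stalk x) (hs : ∀ x ∈ K, S.IsSecAt (τ := fun x => x) s x) :
    ∃ t : ∀ x, S.stalk x, (∀ x, S.IsSecAt (τ := fun x => x) t x) ∧ ∀ᶠ x in 𝓝ˢ K, t x = s x := by
  let U : Set X := {x | S.IsSecAt (τ := fun x => x) s x}
  have hU : IsOpen U := isOpen_iff_mem_nhds.2 fun x hx => IsSecAt.eventually hx
  obtain ⟨V, hV, hKV, hVU, t, ht, hts⟩ := hS K U hK hU hs (fun x => s x) (by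
    refine continuous_iff_continuousAt.2 fun x => ?_
    obtain ⟨W, hW, hx, h⟩ := x.2
    exact (h.continuousAt (hW.mem_nhds hx)).comp continuousAt_subtype_val)
  exact ⟨t, isSecAt_of_continuous ht, mem_nhdsSet_iff_exists.2 ⟨V, hV, hKV, hts⟩⟩

/-- Transport of sections along a local homeomorphism which is injective on a compact set. -/
lemma exists_isSecAt_image (hτ : IsLocalHomeomorph τ) {O : Set Y} (hO : IsOpen O)
    (hinj : Set.InjOn τ O) (s : ∀ y, S.stalk (τ y)) :
    ∃ σ : ∀ x, S.stalk x, (∀ y ∈ O, σ (τ y) = s y) ∧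
      ∀ y ∈ O, S.IsSecAt s y → S.IsSecAt (τ := fun x => x) σ (τ y) := by
  classical
  let σ : ∀ x, S.stalk x := fun x =>
    if h : ∃ y ∈ O, τ y = x then h.choose_spec.2 ▸ s h.choose else 0
  have hσ : ∀ y ∈ O, σ (τ y) = s y := by
    intro y hy
    have h : ∃ y' ∈ O, τ y' = τ y := ⟨y, hy, rfl⟩
    have key : ∀ (y' : Y) (h : τ y' = τ y), y' = y → (h ▸ s y' : S.stalk (τ y)) = s y := by
      rintro _ h rfl
      rfl
    simp only [σ, dif_pos h]
    exact key _ _ (hinj h.choose_spec.1 hy h.choose_spec.2)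
  refine ⟨σ, hσ, fun y hy hs => ?_⟩
  obtain ⟨U, hU, hyU, hs⟩ := hs
  refine ⟨τ '' (U ∩ O), hτ.isOpenMap _ (hU.inter hO), ⟨y, ⟨hyU, hy⟩, rfl⟩, ?_⟩
  rintro _ ⟨z, ⟨hzU, hzO⟩, rfl⟩
  refine ContinuousAt.continuousWithinAt ?_
  have h1 : ContinuousAt (fun y => S.pt (s y)) z := hs.continuousAt (hU.mem_nhds hzU)
  rw [ContinuousAt, ← hτ.map_nhds_eq, tendsto_map'_iff, hσ z hzO]
  refine h1.congr' ?_
  filter_upwards [hO.mem_nhds hzO] with z' hz'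
  exact congrArg S.pt (hσ z' hz').symm

variable [T2Space Y] [LocallyCompactSpace Y]

/-- The local case: on `O` a section can be moved to `X`, extended there, pulled back and cut off.
The set `L'` records where earlier corrections already agree with the section, so that the new
correction has to vanish near it. -/
lemma IsCSoft.exists_extension_of_injOn (hS : S.IsCSoft) (hτ : IsLocalHomeomorph τ) {O : Set Y}
    (hO : IsOpen O) (hinj : Set.InjOn τ O) {L L' : Set Y} (hL : IsCompact L) (hLO : L ⊆ O)
    (hL' : IsCompact L') (s : ∀ y, S.stalk (τ y)) (hs : ∀ y ∈ L, S.IsSecAt s y)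
    (hs' : ∀ᶠ y in 𝓝ˢ L', s y = 0) :
    ∃ t : ∀ y, S.stalk (τ y), (∀ y, S.IsSecAt t y) ∧ IsCompact (closure {y | t y ≠ 0}) ∧
      ∀ᶠ y in 𝓝ˢ (L ∪ L'), t y = s y := by
  classical
  obtain ⟨N, hN, hLN, hNO⟩ := exists_compact_between hL hO hLO
  obtain ⟨N₀, hN₀, hLN₀, hN₀N⟩ := exists_compact_between hL isOpen_interior hLN
  have hN₀N' : N₀ ⊆ N := hN₀N.trans interior_subset
  let s₁ : ∀ y, S.stalk (τ y) := fun y => if y ∈ N₀ then s y else 0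
  have h1 : ∀ y ∈ L, ∀ᶠ y' in 𝓝 y, s₁ y' = s y' := fun y hy => by
    filter_upwards [isOpen_interior.mem_nhds (hLN₀ hy)] with y' hy'
    exact if_pos (interior_subset hy')
  have h2 : ∀ y ∈ L', ∀ᶠ y' in 𝓝 y, s₁ y' = 0 := fun y hy => by
    filter_upwards [eventually_nhdsSet_iff_forall.1 hs' y hy] with y' hy'
    simp [s₁, hy']
  have h3 : ∀ y ∉ N₀, ∀ᶠ y' in 𝓝 y, s₁ y' = 0 := fun y hy => by
    filter_upwards [hN₀.isClosed.isOpen_compl.mem_nhds hy] with y' hy'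
    exact if_neg hy'
  -- Prescribing values also on `L' ∩ N` and on the boundary of `N`, both times zero, ensures that
  -- the pullback vanishes near `L'` inside `N` and can be continued by zero outside `N`.
  let D : Set Y := L ∪ (L' ∩ N) ∪ (N \ interior N)
  have hD : IsCompact D :=
    (hL.union (hL'.inter_right hN.isClosed)).union (hN.diff isOpen_interior)
  have hDN : D ⊆ N := by
    rintro y ((hy | hy) | hy)
    · exact interior_subset (hLN hy)
    · exact hy.2
    · exact hy.1
  have hzero : ∀ y, S.IsSecAt (τ := τ) 0 y :=
    isSecAt_of_continuous (S.continuous_pt_zero hτ.continuous)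
  have hs₁ : ∀ y ∈ D, S.IsSecAt s₁ y := by
    rintro y ((hy | hy) | hy)
    · exact (hs y hy).congr ((h1 y hy).mono fun _ h => h.symm)
    · exact (hzero y).congr ((h2 y hy.1).mono fun _ h => h.symm)
    · exact (hzero y).congr ((h3 y fun h => hy.2 (hN₀N h)).mono fun _ h => h.symm)
  obtain ⟨σ, hσ, hσs⟩ := exists_isSecAt_image hτ hO hinj s₁
  obtain ⟨t, ht, htσ⟩ := hS.exists_extension (hD.image hτ.continuous) σ (by
    rintro _ ⟨y, hy, rfl⟩
    exact hσs y (hNO (hDN hy)) (hs₁ y hy))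
  have htD : ∀ y ∈ D, ∀ᶠ y' in 𝓝 y, t (τ y') = s₁ y' := fun y hy => by
    have h4 := eventually_nhdsSet_iff_forall.1 htσ (τ y) ⟨y, hy, rfl⟩
    filter_upwards [hτ.continuous.continuousAt.eventually h4,
      hO.mem_nhds (hNO (hDN hy))] with y' h5 h6
    rw [h5, hσ y' h6]
  -- The pullback of `t` may be nonzero on other sheets of `τ`, hence the cutoff at `N`.
  let r : ∀ y, S.stalk (τ y) := fun y => if y ∈ N then t (τ y) else 0
  have hr : ∀ y ∉ interior N, ∀ᶠ y' in 𝓝 y, r y' = 0 := fun y hy => by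
    by_cases hyN : y ∈ N
    · filter_upwards [htD y (Or.inr ⟨hyN, hy⟩), h3 y fun h => hy (hN₀N h)] with y' h4 h5
      simp [r, h4, h5]
    · filter_upwards [hN.isClosed.isOpen_compl.mem_nhds hyN] with y' hy'
      exact if_neg hy'
  have hr' : ∀ y ∈ interior N, ∀ᶠ y' in 𝓝 y, r y' = t (τ y') := fun y hy => by
    filter_upwards [isOpen_interior.mem_nhds hy] with y' hy'
    exact if_pos (interior_subset hy')
  refine ⟨r, fun y => ?_, hN.of_isClosed_subset isClosed_closure
    (closure_minimal (fun y hy => by_contra fun h => hy (if_neg h)) hN.isClosed), ?_⟩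
  · by_cases hy : y ∈ interior N
    · exact ((ht (τ y)).comp hτ.continuous).congr ((hr' y hy).mono fun _ h => h.symm)
    · exact (hzero y).congr ((hr y hy).mono fun _ h => h.symm)
  · refine eventually_nhdsSet_iff_forall.2 ?_
    rintro y (hy | hy)
    · filter_upwards [hr' y (hLN hy), htD y (Or.inl (Or.inl hy)), h1 y hy] with y' h4 h5 h6
      rw [h4, h5, h6]
    · by_cases hyN : y ∈ interior N
      · filter_upwards [hr' y hyN, htD y (Or.inl (Or.inr ⟨hy, interior_subset hyN⟩)), h2 y hy,
          eventually_nhdsSet_iff_forall.1 hs' y hy] with y' h4 h5 h6 h7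
        rw [h4, h5, h6, h7]
      · filter_upwards [hr y hyN, eventually_nhdsSet_iff_forall.1 hs' y hy] with y' h4 h5
        rw [h4, h5]

/-- The pullback of a `c`-soft sheaf along a local homeomorphism is `c`-soft. -/
lemma IsCSoft.exists_extension_pullback (hS : S.IsCSoft) (hτ : IsLocalHomeomorph τ) {K : Set Y}
    (hK : IsCompact K) (s : ∀ y, S.stalk (τ y)) (hs : ∀ y ∈ K, S.IsSecAt s y) :
    ∃ t : ∀ y, S.stalk (τ y), (∀ y, S.IsSecAt t y) ∧ IsCompact (closure {y | t y ≠ 0}) ∧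
      ∀ᶠ y in 𝓝ˢ K, t y = s y := by
  have hadd : ∀ {t t' : ∀ y, S.stalk (τ y)}, IsCompact (closure {y | t y ≠ 0}) →
      IsCompact (closure {y | t' y ≠ 0}) → IsCompact (closure {y | (t + t') y ≠ 0}) := by
    intro t t' ht ht'
    refine (ht.union ht').of_isClosed_subset isClosed_closure ?_
    rw [← closure_union]
    refine closure_mono fun y hy => ?_
    by_contra h
    simp only [Set.mem_union, Set.mem_ofPred_eq, not_or, not_not] at h
    exact hy (by simp [h.1, h.2])
  -- The additional set `L'` makes the claim stable under unions: the extension from `K₂` is made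
  -- for the remainder `s - t₁`, relative to `K₁ ∪ L'`, and so does not disturb what was achieved
  -- near `K₁`.
  have key : ∀ L' : Set Y, IsCompact L' → ∀ s : ∀ y, S.stalk (τ y), (∀ y ∈ K, S.IsSecAt s y) →
      (∀ᶠ y in 𝓝ˢ L', s y = 0) →
        ∃ t : ∀ y, S.stalk (τ y), (∀ y, S.IsSecAt t y) ∧ IsCompact (closure {y | t y ≠ 0}) ∧
          ∀ᶠ y in 𝓝ˢ (K ∪ L'), t y = s y := by
    refine isCompact_union_induction (P := fun K => ∀ L' : Set Y, IsCompact L' →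
      ∀ s : ∀ y, S.stalk (τ y), (∀ y ∈ K, S.IsSecAt s y) → (∀ᶠ y in 𝓝ˢ L', s y = 0) →
        ∃ t : ∀ y, S.stalk (τ y), (∀ y, S.IsSecAt t y) ∧ IsCompact (closure {y | t y ≠ 0}) ∧
          ∀ᶠ y in 𝓝ˢ (K ∪ L'), t y = s y) hK ?_ ?_ ?_
    · intro L' _ s _ hs
      refine ⟨0, isSecAt_of_continuous (S.continuous_pt_zero hτ.continuous), by simp, ?_⟩
      rw [Set.empty_union]
      exact hs.mono fun y hy => hy.symm
    · intro y _
      obtain ⟨e, hye, rfl⟩ := hτ y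
      exact ⟨e.source, e.open_source.mem_nhds hye, fun L hL hLc L' hL' s hs hs' =>
        hS.exists_extension_of_injOn hτ e.open_source e.injOn hLc hL hL' s hs hs'⟩
    · intro K₁ K₂ hK₁ hK₂ h₁ h₂ L' hL' s hs hs'
      obtain ⟨t₁, ht₁, ht₁K, hts₁⟩ := h₁ L' hL' s (fun y hy => hs y (Or.inl hy)) hs'
      obtain ⟨t₂, ht₂, ht₂K, hts₂⟩ := h₂ (K₁ ∪ L') (hK₁.union hL') (s + -t₁)
        (fun y hy => (hs y (Or.inr hy)).add (ht₁ y).neg) (by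
          filter_upwards [hts₁] with y hy
          simp [hy])
      refine ⟨t₁ + t₂, fun y => (ht₁ y).add (ht₂ y), hadd ht₁K ht₂K, ?_⟩
      rw [Set.union_comm K₁, Set.union_assoc]
      filter_upwards [hts₂] with y hy
      simp [hy]
  obtain ⟨t, ht, htK, hts⟩ := key ∅ isCompact_empty s hs (by simp)
  exact ⟨t, ht, htK, by rwa [Set.union_empty] at hts⟩

/-- The pullback of a `c`-soft sheaf along a local homeomorphism, described by germs. -/
def IsCSoft.softGerms (hS : S.IsCSoft) (hτ : IsLocalHomeomorph τ) : SoftGerms Y where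
  stalk y := S.stalk (τ y)
  IsSec s y := S.IsSecAt s y
  isSec_zero := isSecAt_of_continuous (S.continuous_pt_zero hτ.continuous)
  isSec_add hs ht := hs.add ht
  isSec_neg hs := hs.neg
  isSec_congr h hs := hs.congr h
  eventually_isSec hs := hs.eventually
  eventually_eq_zero hs h := hs.eventually_eq_zero h
  exists_isSec {y} m := by
    obtain ⟨s, hs, h⟩ := S.exists_isSecAt (τ y) m
    exact ⟨fun y => s (τ y), hs.comp hτ.continuous, h⟩
  exists_extension hK s hs := hS.exists_extension_pullback hτ hK s hs

end EtaleSheaf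

/-! ### Quasi-isomorphisms of `c`-soft complexes induce isomorphisms on homology. -/

section QuasiIsoInvariance

variable {X : Type u} [TopologicalSpace X] [Groupoid.{u} X] [TopologicalSpace (Arrow X)]

lemma EtaleSheaf.IsSecAt.app {S T : GSheaf X} (f : S ⟶ T) {Y : Type u} [TopologicalSpace Y]
    {τ : Y → X} {s : ∀ y, S.stalk (τ y)} {y : Y} (hs : S.IsSecAt s y) :
    T.IsSecAt (fun y => GSheaf.app f _ (s y)) y := by
  obtain ⟨U, hU, hy, hs⟩ := hs
  exact ⟨U, hU, hy, (GSheaf.Hom.continuous_app f).comp_continuousOn hs⟩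

section Stalks

variable {S T : CochainComplex (GSheaf X) ℕ}

lemma isQuasiIso_iff (f : S ⟶ T) : IsQuasiIso f ↔ ∀ x, IsConeExact
    (((GSheaf.stalkFunctor X x).mapHomologicalComplex (ComplexShape.up ℕ)).map f) :=
  forall_congr' fun _ => quasiIso_iff_isConeExact _

lemma app_d_d (S : CochainComplex (GSheaf X) ℕ) (i j k : ℕ) (x : X) (a : (S.X i).stalk x) :
    GSheaf.app (S.d j k) x (GSheaf.app (S.d i j) x a) = 0 := by
  have h := congrArg (fun g => GSheaf.app g x a) (S.d_comp_d i j k)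
  exact h

lemma app_f_d (f : S ⟶ T) (i j : ℕ) (x : X) (a : (S.X i).stalk x) :
    GSheaf.app (f.f j) x (GSheaf.app (S.d i j) x a) =
      GSheaf.app (T.d i j) x (GSheaf.app (f.f i) x a) := by
  have h := congrArg (fun g => GSheaf.app g x a) (f.comm i j)
  exact h.symm

lemma IsQuasiIso.eq_zero {f : S ⟶ T} (hf : IsQuasiIso f) {x : X} {a : (S.X 0).stalk x}
    (ha : GSheaf.app (S.d 0 1) x a = 0) (hfa : GSheaf.app (f.f 0) x a = 0) : a = 0 :=
  (((isQuasiIso_iff f).1 hf) x).zero a ha hfa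

lemma IsQuasiIso.exists_zero {f : S ⟶ T} (hf : IsQuasiIso f) {x : X} {a : (S.X 1).stalk x}
    {b : (T.X 0).stalk x} (ha : GSheaf.app (S.d 1 2) x a = 0)
    (hab : GSheaf.app (f.f 1) x a = GSheaf.app (T.d 0 1) x b) :
    ∃ a', a = GSheaf.app (S.d 0 1) x a' ∧ b = GSheaf.app (f.f 0) x a' := by
  obtain ⟨a', b', h, h'⟩ := (((isQuasiIso_iff f).1 hf) x).succ 0 a b ha hab
  refine ⟨a', h, h'.trans ?_⟩
  rw [prev_nat_zero]
  exact add_zero _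

lemma IsQuasiIso.exists_succ {f : S ⟶ T} (hf : IsQuasiIso f) {q : ℕ} {x : X}
    {a : (S.X (q + 2)).stalk x} {b : (T.X (q + 1)).stalk x}
    (ha : GSheaf.app (S.d (q + 2) (q + 3)) x a = 0)
    (hab : GSheaf.app (f.f (q + 2)) x a = GSheaf.app (T.d (q + 1) (q + 2)) x b) :
    ∃ (a' : (S.X (q + 1)).stalk x) (b' : (T.X q).stalk x),
      a = GSheaf.app (S.d (q + 1) (q + 2)) x a' ∧
        b = GSheaf.app (f.f (q + 1)) x a' + GSheaf.app (T.d q (q + 1)) x b' := by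
  have h := (((isQuasiIso_iff f).1 hf) x).succ (q + 1) a b ha hab
  rw [prev_nat_succ] at h
  exact h

end Stalks

section Cone

variable {Y : Type u} [TopologicalSpace Y] [T2Space Y] [LocallyCompactSpace Y] {τ : Y → X}
  (hτ : IsLocalHomeomorph τ) {S T : CochainComplex (GSheaf X) ℕ}

variable (hS : IsCSoftComplex S) (hT : IsCSoftComplex T) (f : S ⟶ T)

/-- The shifted mapping cone of a morphism of complexes of `c`-soft `G`-sheaves, pulled back
along a local homeomorphism. -/
def coneGerms : ℕ → SoftGerms Y
  | 0 => (hS 0).softGerms hτ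
  | q + 1 => ((hS (q + 1)).softGerms hτ).prod ((hT q).softGerms hτ)

/-- The differential of the mapping cone. -/
def coneD : ∀ q, SoftGerms.Hom (coneGerms hτ hS hT q) (coneGerms hτ hS hT (q + 1))
  | 0 =>
    { app y := AddMonoidHom.prod (GSheaf.app (S.d 0 1) (τ y)) (GSheaf.app (f.f 0) (τ y))
      isSec_app hs := ⟨EtaleSheaf.IsSecAt.app (S.d 0 1) hs, EtaleSheaf.IsSecAt.app (f.f 0) hs⟩ }
  | q + 1 =>
    { app y := AddMonoidHom.prod
        ((GSheaf.app (S.d (q + 1) (q + 2)) (τ y)).comp (AddMonoidHom.fst _ _))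
        ((GSheaf.app (f.f (q + 1)) (τ y)).comp (AddMonoidHom.fst _ _) -
          (GSheaf.app (T.d q (q + 1)) (τ y)).comp (AddMonoidHom.snd _ _))
      isSec_app hs := ⟨EtaleSheaf.IsSecAt.app (S.d (q + 1) (q + 2)) hs.1,
        SoftGerms.isSec_sub _ (EtaleSheaf.IsSecAt.app (f.f (q + 1)) hs.1)
          (EtaleSheaf.IsSecAt.app (T.d q (q + 1)) hs.2)⟩ }

variable {f} (hf : IsQuasiIso f)
include hf

/-- The shift puts the lowest term of the cone in degree `0`, where exactness is injectivity; this
is the start of the induction in `SoftGerms.exists_closed_extension`. -/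
lemma coneD_injective (y : Y) : Function.Injective ((coneD hτ hS hT f 0).app y) := by
  refine (injective_iff_map_eq_zero _).2 fun a ha => ?_
  exact hf.eq_zero (congrArg Prod.fst ha) (congrArg Prod.snd ha)

lemma coneD_exact (q : ℕ) (y : Y) :
    Function.Exact ((coneD hτ hS hT f q).app y) ((coneD hτ hS hT f (q + 1)).app y) := by
  cases q with
  | zero =>
    rintro ⟨a, b⟩
    constructor
    · intro h
      obtain ⟨a', h1, h2⟩ := hf.exists_zero (congrArg Prod.fst h)
        (sub_eq_zero.1 (congrArg Prod.snd h))
      exact ⟨a', (Prod.ext h1 h2).symm⟩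
    · rintro ⟨a', h⟩
      obtain rfl : GSheaf.app (S.d 0 1) (τ y) a' = a := congrArg Prod.fst h
      obtain rfl : GSheaf.app (f.f 0) (τ y) a' = b := congrArg Prod.snd h
      exact Prod.ext (app_d_d S 0 1 2 (τ y) a') (sub_eq_zero.2 (app_f_d f 0 1 (τ y) a'))
  | succ q =>
    rintro ⟨a, b⟩
    constructor
    · intro h
      obtain ⟨a', b', h1, h2⟩ := hf.exists_succ (congrArg Prod.fst h)
        (sub_eq_zero.1 (congrArg Prod.snd h))
      -- The differential of `T` is subtracted in `coneD` but added in the exactness condition for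
      -- quasi-isomorphisms.
      refine ⟨(a', -b'), (Prod.ext h1 (h2.trans ?_)).symm⟩
      change _ = GSheaf.app (f.f (q + 1)) (τ y) a' - GSheaf.app (T.d q (q + 1)) (τ y) (-b')
      rw [map_neg, sub_neg_eq_add]
    · rintro ⟨⟨a', b'⟩, h⟩
      obtain rfl : GSheaf.app (S.d (q + 1) (q + 2)) (τ y) a' = a := congrArg Prod.fst h
      obtain rfl : GSheaf.app (f.f (q + 1)) (τ y) a' - GSheaf.app (T.d q (q + 1)) (τ y) b' = b :=
        congrArg Prod.snd h
      refine Prod.ext (app_d_d S _ _ _ (τ y) a') (sub_eq_zero.2 ?_)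
      have key : ∀ (a : (S.X (q + 1)).stalk (τ y)) (b : (T.X q).stalk (τ y)),
          GSheaf.app (f.f (q + 2)) (τ y) (GSheaf.app (S.d (q + 1) (q + 2)) (τ y) a) =
          GSheaf.app (T.d (q + 1) (q + 2)) (τ y)
            (GSheaf.app (f.f (q + 1)) (τ y) a - GSheaf.app (T.d q (q + 1)) (τ y) b) := by
        intro a b
        rw [map_sub, app_d_d, sub_zero, app_f_d]
      exact key a' b'

lemma exists_cone_primitive (q : ℕ) {s : ∀ y, (coneGerms hτ hS hT (q + 1)).stalk y}
    (hs : ∀ y, (coneGerms hτ hS hT (q + 1)).IsSec s y) (hsK : IsCompact (closure {y | s y ≠ 0}))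
    (hds : ∀ y, (coneD hτ hS hT f (q + 1)).app y (s y) = 0) :
    ∃ t, (∀ y, (coneGerms hτ hS hT q).IsSec t y) ∧ IsCompact (closure {y | t y ≠ 0}) ∧
      ∀ y, (coneD hτ hS hT f q).app y (t y) = s y :=
  SoftGerms.exists_primitive _ _ (coneD_exact hτ hS hT hf q)
    (SoftGerms.exists_closed_extension (coneD hτ hS hT f) (coneD_injective hτ hS hT hf)
      (coneD_exact hτ hS hT hf) q) hs hsK hds

end Cone

variable [EtaleGroupoid X]

/-- Compact neighbourhoods are carried over from the base space by local inverses of `F ↦ F.obj 0`.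
-/
instance (n : ℕ) : LocallyCompactSpace (ComposableArrows X n) := by
  have := EtaleGroupoid.locallyCompact_base (X := X)
  choose e he _ using isLocalHomeomorph_obj_zero (X := X) n
  have h : ∀ F : ComposableArrows X n, (𝓝 F).HasBasis
      (fun s => s ∈ 𝓝 (e F F) ∧ IsCompact s ∧ s ⊆ (e F).target) fun s => (e F).symm '' s := by
    intro F
    rw [← (e F).symm_map_nhds_eq (he F)]
    exact ((compact_basis_nhds (e F F)).hasBasis_self_subset (((e F).open_target.mem_nhds ((e F).map_source (he F))))).map _
  exact .of_hasBasis h fun F s hs =>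
    hs.2.1.image_of_continuousOn ((e F).continuousOn_symm.mono hs.2.2)

variable (X) in
/-- The double complex with entries `Γ_c(G⁽ᵖ⁾; S^q_p)`, as a functor. -/
noncomputable abbrev barDoubleComplex : CochainComplex (GSheaf X) ℕ ⥤ DoubleComplex.{u} :=
  (GSheaf.barComplex X).mapHomologicalComplex (ComplexShape.up ℕ)

/-- A cocycle of the cone of the column is a compactly supported section, killed by `coneD`, of the
cone pulled back along `tau X p`. The compactly supported primitive of `exists_cone_primitive`
splits into its two components. -/
theorem isConeExact_columnMap {S T : CochainComplex (GSheaf X) ℕ} (hS : IsCSoftComplex S)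
    (hT : IsCSoftComplex T) {f : S ⟶ T} (hf : IsQuasiIso f) (p : ℕ) :
    IsConeExact (DoubleComplex.columnMap ((barDoubleComplex X).map f) p) := by
  have hτ : IsLocalHomeomorph (tau X p) := isLocalHomeomorph_obj_zero p
  constructor
  · intro (a : (S.X 0).barGroup p) ha hfa
    refine Subtype.ext (funext fun F => ?_)
    exact hf.eq_zero (congrArg (fun b : (S.X 1).barGroup p => b.1 F) ha)
      (congrArg (fun b : (T.X 0).barGroup p => b.1 F) hfa)
  · intro r (a : (S.X (r + 1)).barGroup p) (b : (T.X r).barGroup p) ha hab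
    obtain ⟨t, ht, htK, hts⟩ := exists_cone_primitive hτ hS hT hf r
      (s := fun F => (a.1 F, b.1 F))
      (fun F => ⟨EtaleSheaf.isSecAt_of_continuous a.2.1 F,
        EtaleSheaf.isSecAt_of_continuous b.2.1 F⟩)
      ((a.2.2.union b.2.2).of_isClosed_subset isClosed_closure (by
        rw [← closure_union]
        refine closure_mono fun y hy => ?_
        by_contra h
        simp only [Set.mem_union, Set.mem_ofPred_eq, not_or, not_not] at h
        exact hy (Prod.ext h.1 h.2)))
      (fun F => Prod.ext
        (congrArg (fun b : (S.X (r + 2)).barGroup p => b.1 F) ha)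
        (sub_eq_zero.2 (congrArg (fun b : (T.X (r + 1)).barGroup p => b.1 F) hab)))
    cases r with
    | zero =>
      refine ⟨(⟨t, EtaleSheaf.continuous_of_isSecAt ht, htK⟩ : (S.X 0).barGroup p), 0,
        Subtype.ext (funext fun F => (congrArg Prod.fst (hts F)).symm), ?_⟩
      rw [map_zero, add_zero]
      exact Subtype.ext (funext fun F => (congrArg Prod.snd (hts F)).symm)
    | succ q =>
      have h1 : IsCompact (closure {F | (t F).1 ≠ 0}) :=
        htK.of_isClosed_subset isClosed_closure
          (closure_mono fun F hF h => hF (congrArg Prod.fst h))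
      have h2 : IsCompact (closure {F | (t F).2 ≠ 0}) :=
        htK.of_isClosed_subset isClosed_closure
          (closure_mono fun F hF h => hF (congrArg Prod.snd h))
      let a' : (S.X (q + 1)).barGroup p :=
        ⟨fun F => (t F).1, EtaleSheaf.continuous_of_isSecAt fun F => (ht F).1, h1⟩
      -- The sign again reconciles `coneD` with `IsConeExact`.
      let b' : (T.X q).barGroup p :=
        -⟨fun F => (t F).2, EtaleSheaf.continuous_of_isSecAt fun F => (ht F).2, h2⟩
      rw [prev_nat_succ]
      refine ⟨a', b', Subtype.ext (funext fun F => (congrArg Prod.fst (hts F)).symm),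
        Subtype.ext (funext fun F => (congrArg Prod.snd (hts F)).symm.trans ?_)⟩
      have key : ∀ (c : (T.X (q + 1)).stalk (tau X p F)) (b : (T.X q).stalk (tau X p F)),
          c - GSheaf.app (T.d q (q + 1)) _ b = c + GSheaf.app (T.d q (q + 1)) _ (-b) := by
        intro c b
        rw [map_neg, sub_eq_add_neg]
      exact key _ _

theorem isIso_totalHomology_map {S T : CochainComplex (GSheaf X) ℕ} (hS : IsCSoftComplex S)
    (hT : IsCSoftComplex T) {f : S ⟶ T} (hf : IsQuasiIso f) (n : ℤ) :
    IsIso ((totalHomology X n).map f) := by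
  have : QuasiIso (DoubleComplex.totMap ((barDoubleComplex X).map f)) :=
    DoubleComplex.quasiIso_totMap _ (isConeExact_columnMap hS hT hf)
  exact (inferInstance : IsIso (HomologicalComplex.homologyMap
    (DoubleComplex.totMap ((barDoubleComplex X).map f)) n))

end QuasiIsoInvariance

/-! ### The sheaf of all families of elements, with the groupoid action on its germs. -/

section Godement

open Filter

variable {X : Type u} [TopologicalSpace X]

section Stalks

variable (E : X → Type u) [∀ x, AddCommGroup (E x)]

/-- The families in `∏ y, E y` which vanish near `x`. -/
def vanishingNear (x : X) : AddSubgroup (∀ y, E y) where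
  carrier := {φ | ∀ᶠ y in 𝓝 x, φ y = 0}
  zero_mem' := by simp
  add_mem' h h' := by
    filter_upwards [h, h'] with y h h'
    simp [h, h']
  neg_mem' h := by
    filter_upwards [h] with y h
    simp [h]

/-- The stalk at `x` of the sheaf of all families of elements of the groups `E y`. -/
abbrev FamilyGerm (x : X) : Type u := (∀ y, E y) ⧸ vanishingNear E x

variable {E}

/-- The germ of a family. -/
def familyGerm (x : X) : (∀ y, E y) →+ FamilyGerm E x := QuotientAddGroup.mk' _

lemma familyGerm_eq_iff {x : X} {φ ψ : ∀ y, E y} :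
    familyGerm x φ = familyGerm x ψ ↔ ∀ᶠ y in 𝓝 x, φ y = ψ y := by
  rw [← sub_eq_zero, ← map_sub]
  refine (QuotientAddGroup.eq_zero_iff _).trans ?_
  change (∀ᶠ y in 𝓝 x, φ y - ψ y = 0) ↔ _
  simp only [sub_eq_zero]

lemma familyGerm_surjective (x : X) : Function.Surjective (familyGerm (E := E) x) :=
  QuotientAddGroup.mk'_surjective _

/-- The value at `x` of the germ of a family. -/
def familyEval (x : X) : FamilyGerm E x →+ E x :=
  QuotientAddGroup.lift _ (Pi.evalAddMonoidHom E x) fun _ h => h.self_of_nhds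

@[simp] lemma familyEval_familyGerm (x : X) (φ : ∀ y, E y) :
    familyEval x (familyGerm x φ) = φ x := rfl

/-- The section of the étale space of germs given by a family. -/
def familySec (φ : ∀ y, E y) (x : X) : Σ x, FamilyGerm E x := ⟨x, familyGerm x φ⟩

/-- The étale topology on the set of germs of families. -/
instance familyTopology : TopologicalSpace (Σ x, FamilyGerm E x) :=
  ⨆ φ : ∀ y, E y, TopologicalSpace.coinduced (familySec φ) inferInstance

lemma isOpen_family_iff {O : Set (Σ x, FamilyGerm E x)} :
    IsOpen O ↔ ∀ φ : ∀ y, E y, IsOpen (familySec φ ⁻¹' O) := by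
  simp only [isOpen_iSup_iff, isOpen_coinduced]

lemma continuous_familySec (φ : ∀ y, E y) : Continuous (familySec φ) :=
  continuous_def.2 fun _ hO => isOpen_family_iff.1 hO φ

lemma continuous_family_proj : Continuous fun a : Σ x, FamilyGerm E x => a.1 :=
  continuous_def.2 fun _ hV => isOpen_family_iff.2 fun _ => hV

/-- Families with the same germ at a point agree near this point, so their germs at nearby points
coincide. -/
lemma isOpen_range_familySec (φ : ∀ y, E y) : IsOpen (Set.range (familySec φ)) := by
  refine isOpen_family_iff.2 fun ψ => isOpen_iff_mem_nhds.2 ?_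
  rintro x ⟨x', hx'⟩
  obtain rfl : x' = x := congrArg Sigma.fst hx'
  have h : familyGerm x' φ = familyGerm x' ψ := eq_of_heq (Sigma.mk.inj hx').2
  filter_upwards [(familyGerm_eq_iff.1 h).eventually_nhds] with y hy
  exact ⟨y, congrArg (Sigma.mk y) (familyGerm_eq_iff.2 hy)⟩

lemma eventually_eq_familySec {φ : ∀ y, E y} {a : Σ x, FamilyGerm E x}
    (h : a = familySec φ a.1) : ∀ᶠ b in 𝓝 a, b = familySec φ b.1 := by
  filter_upwards [(isOpen_range_familySec φ).mem_nhds ⟨a.1, h.symm⟩]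
  rintro _ ⟨x, rfl⟩
  rfl

lemma exists_eq_familySec (a : Σ x, FamilyGerm E x) : ∃ φ, a = familySec φ a.1 := by
  obtain ⟨φ, hφ⟩ := familyGerm_surjective a.1 a.2
  exact ⟨φ, Sigma.ext rfl (heq_of_eq hφ.symm)⟩

lemma isLocalHomeomorph_family_proj :
    IsLocalHomeomorph fun a : Σ x, FamilyGerm E x => a.1 := by
  refine isLocalHomeomorph_iff_isOpenEmbedding_restrict.2 fun a => ?_
  obtain ⟨φ, hφ⟩ := exists_eq_familySec a
  refine ⟨Set.range (familySec φ), (isOpen_range_familySec φ).mem_nhds ⟨a.1, hφ.symm⟩, ?_⟩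
  refine .of_continuous_injective_isOpenMap
    (continuous_family_proj.comp continuous_subtype_val) ?_ ?_
  · rintro ⟨_, x, rfl⟩ ⟨_, y, rfl⟩ h
    obtain rfl : x = y := h
    rfl
  · rintro W ⟨O, hO, rfl⟩
    convert isOpen_family_iff.1 hO φ using 1
    ext x
    constructor
    · rintro ⟨⟨_, y, rfl⟩, hy, rfl⟩
      exact hy
    · intro hx
      exact ⟨⟨_, x, rfl⟩, hx, rfl⟩

/-- Continuity into the étale space is reduced to continuity of the base point wherever all values
are germs of one and the same family. -/
lemma continuousAt_of_eventually_familySec {Z : Type*} [TopologicalSpace Z]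
    {F : Z → Σ x, FamilyGerm E x} {z : Z} (φ : ∀ y, E y) (hF : ContinuousAt (fun z => (F z).1) z)
    (h : ∀ᶠ z' in 𝓝 z, F z' = familySec φ (F z').1) : ContinuousAt F z :=
  ((continuous_familySec φ).continuousAt.comp hF).congr (h.mono fun _ h => h.symm)

variable (E) in
/-- The sheaf of all families of elements of the groups `E y`. -/
def familySheaf : EtaleSheaf X where
  stalk := FamilyGerm E
  isLocalHomeomorph_proj := isLocalHomeomorph_family_proj
  continuous_zero := continuous_familySec 0
  continuous_neg := continuous_iff_continuousAt.2 fun a => by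
    obtain ⟨φ, hφ⟩ := exists_eq_familySec a
    refine continuousAt_of_eventually_familySec (-φ) continuous_family_proj.continuousAt ?_
    filter_upwards [eventually_eq_familySec hφ] with b hb
    rw [hb]
    rfl
  continuous_add := by
    let _ : TopologicalSpace (Σ x, FamilyGerm E x × FamilyGerm E x) := TopologicalSpace.induced
      (fun p : Σ x, FamilyGerm E x × FamilyGerm E x =>
        (((⟨p.1, p.2.1⟩ : Σ x, FamilyGerm E x), (⟨p.1, p.2.2⟩ : Σ x, FamilyGerm E x)) :
          (Σ x, FamilyGerm E x) × (Σ x, FamilyGerm E x))) inferInstance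
    have h0 : Continuous fun p : Σ x, FamilyGerm E x × FamilyGerm E x =>
        (((⟨p.1, p.2.1⟩ : Σ x, FamilyGerm E x), (⟨p.1, p.2.2⟩ : Σ x, FamilyGerm E x)) :
          (Σ x, FamilyGerm E x) × (Σ x, FamilyGerm E x)) := continuous_induced_dom
    have h1 := h0.fst
    have h2 := h0.snd
    refine continuous_iff_continuousAt.2 fun p => ?_
    obtain ⟨φ, hφ⟩ := exists_eq_familySec (⟨p.1, p.2.1⟩ : Σ x, FamilyGerm E x)
    obtain ⟨ψ, hψ⟩ := exists_eq_familySec (⟨p.1, p.2.2⟩ : Σ x, FamilyGerm E x)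
    refine continuousAt_of_eventually_familySec (φ + ψ)
      (continuous_family_proj.comp h1).continuousAt ?_
    filter_upwards [h1.continuousAt.eventually (eventually_eq_familySec hφ),
      h2.continuousAt.eventually (eventually_eq_familySec hψ)]
    rintro ⟨x, a, b⟩ ha hb
    obtain rfl : a = familyGerm x φ := eq_of_heq (Sigma.mk.inj ha).2
    obtain rfl : b = familyGerm x ψ := eq_of_heq (Sigma.mk.inj hb).2
    rfl

lemma familySheaf_isCSoft : (familySheaf E).IsCSoft := by
  classical
  intro K U _ hU hKU s hs
  -- A section over `U` is the germ of the family of its values, and this family extends by zero to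
  -- all of `X`; compactness plays no role.
  let φ : ∀ y, E y := fun y => if h : y ∈ U then familyEval y (s ⟨y, h⟩) else 0
  refine ⟨U, hU, hKU, subset_rfl, fun x => familyGerm x φ, continuous_familySec φ,
    fun x hx => ?_⟩
  obtain ⟨ψ, hψ⟩ := familyGerm_surjective x (s ⟨x, hx⟩)
  have hs' : Continuous fun y : U => (⟨y, s y⟩ : Σ x, FamilyGerm E x) := hs
  have h1 := (hs'.continuousAt (x := ⟨x, hx⟩)).eventually
    (eventually_eq_familySec (φ := ψ) (a := ⟨x, s ⟨x, hx⟩⟩) (Sigma.ext rfl (heq_of_eq hψ.symm)))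
  rw [nhds_subtype_eq_comap, eventually_comap] at h1
  rw [← hψ]
  refine familyGerm_eq_iff.2 ?_
  filter_upwards [h1, hU.mem_nhds hx] with y hy hyU
  have h2 : s ⟨y, hyU⟩ = familyGerm y ψ := eq_of_heq (Sigma.mk.inj (hy ⟨y, hyU⟩ rfl)).2
  simp only [φ, dif_pos hyU, h2, familyEval_familyGerm]

end Stalks

variable [Groupoid.{u} X] [TopologicalSpace (Arrow X)] (E : X ⥤ AddCommGrpCat.{u})

/-- The family `ψ` is the translate of the family `φ` by the arrows near `g`. -/
def IsTranslate (g : Arrow X) (φ ψ : ∀ y, E.obj y) : Prop :=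
  ∀ᶠ k in 𝓝 g, ψ k.right = E.map k.hom (φ k.left)

variable {E}

omit [TopologicalSpace X] in
lemma IsTranslate.add {g : Arrow X} {φ ψ φ' ψ' : ∀ y, E.obj y} (h : IsTranslate E g φ ψ)
    (h' : IsTranslate E g φ' ψ') : IsTranslate E g (φ + φ') (ψ + ψ') := by
  filter_upwards [h, h'] with k h h'
  rw [Pi.add_apply, Pi.add_apply, h, h', map_add]

variable [EtaleGroupoid X]

lemma eventually_range {g : Arrow X} {P : X → Prop} (h : ∀ᶠ k in 𝓝 g, P k.right) :
    ∀ᶠ y in 𝓝 g.right, P y := by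
  rw [← isLocalHomeomorph_range.map_nhds_eq g]
  exact h

lemma eventually_source {g : Arrow X} {P : X → Prop} (h : ∀ᶠ y in 𝓝 g.left, P y) :
    ∀ᶠ k in 𝓝 g, P k.left :=
  EtaleGroupoid.continuous_source.continuousAt.eventually h

/-- The range map is injective on an open bisection around `g`, so `φ` can be moved along its
arrows; the translate is zero off the range of the bisection. -/
lemma exists_isTranslate (g : Arrow X) (φ : ∀ y, E.obj y) : ∃ ψ, IsTranslate E g φ ψ := by
  classical
  obtain ⟨B, hB, hg, -⟩ := EtaleGroupoid.isTopologicalBasis_bisections.exists_subset_of_mem_open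
    (Set.mem_univ g) isOpen_univ
  let ψ : ∀ y, E.obj y := fun y => if h : ∃ k ∈ B, k.right = y then
    E.map (h.choose.hom ≫ eqToHom h.choose_spec.2) (φ h.choose.left) else 0
  refine ⟨ψ, ?_⟩
  filter_upwards [hB.1.mem_nhds hg] with k hk
  have h : ∃ k' ∈ B, k'.right = k.right := ⟨k, hk, rfl⟩
  simp only [ψ, dif_pos h]
  have key : ∀ (k' : Arrow X) (h : k'.right = k.right), k' = k →
      E.map (k'.hom ≫ eqToHom h) (φ k'.left) = E.map k.hom (φ k.left) := by
    rintro _ h rfl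
    rw [eqToHom_refl, Category.comp_id]
  refine key _ _ ?_
  have h1 : (⟨h.choose, h.choose_spec.1⟩ : B) = ⟨k, hk⟩ :=
    hB.2.2.injective h.choose_spec.2
  exact congrArg Subtype.val h1

/-- The source map is continuous and the range map is open, so the germ of a translate at the range
depends only on the germ at the source. This makes the action on germs well defined. -/
lemma IsTranslate.unique {g : Arrow X} {φ φ' ψ ψ' : ∀ y, E.obj y} (h : IsTranslate E g φ ψ)
    (h' : IsTranslate E g φ' ψ') (hφ : familyGerm g.left φ = familyGerm g.left φ') :
    familyGerm g.right ψ = familyGerm g.right ψ' := by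
  refine familyGerm_eq_iff.2 (eventually_range ?_)
  filter_upwards [h, h', eventually_source (familyGerm_eq_iff.1 hφ)] with k h1 h2 h3
  rw [h1, h2, h3]

variable (E) in
/-- The action of an arrow on germs of families. -/
noncomputable def translate {x y : X} (g : x ⟶ y) :
    FamilyGerm (fun x => E.obj x) x →+ FamilyGerm (fun x => E.obj x) y :=
  QuotientAddGroup.lift _
    (AddMonoidHom.mk' (fun φ => familyGerm y (exists_isTranslate (Arrow.mk g) φ).choose)
      fun φ ψ => by
        rw [← map_add]
        exact (exists_isTranslate (Arrow.mk g) _).choose_spec.unique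
          ((exists_isTranslate (Arrow.mk g) φ).choose_spec.add
            (exists_isTranslate (Arrow.mk g) ψ).choose_spec) rfl)
    (fun φ hφ => by
      have h0 : IsTranslate E (Arrow.mk g) 0 0 :=
        Eventually.of_forall fun k => (map_zero (E.map k.hom).hom).symm
      exact ((exists_isTranslate (Arrow.mk g) φ).choose_spec.unique h0
        (familyGerm_eq_iff.2 hφ)).trans (map_zero _))

lemma IsTranslate.translate_eq {x y : X} {g : x ⟶ y} {φ ψ : ∀ y, E.obj y}
    (h : IsTranslate E (Arrow.mk g) φ ψ) :
    translate E g (familyGerm x φ) = familyGerm y ψ :=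
  (exists_isTranslate (Arrow.mk g) φ).choose_spec.unique h rfl

lemma familyEval_translate {x y : X} (g : x ⟶ y) (a : FamilyGerm (fun x => E.obj x) x) :
    familyEval y (translate E g a) = E.map g (familyEval x a) := by
  obtain ⟨φ, rfl⟩ := familyGerm_surjective x a
  obtain ⟨ψ, hψ⟩ := exists_isTranslate (Arrow.mk g) φ
  rw [hψ.translate_eq]
  exact hψ.self_of_nhds

/-- The unit map is a continuous section of the local homeomorphism `range`, so all arrows near a
unit are units. -/
lemma isTranslate_id (x : X) (φ : ∀ y, E.obj y) : IsTranslate E (Arrow.mk (𝟙 x)) φ φ := by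
  have h : IsOpenEmbedding fun x : X => Arrow.mk (𝟙 x) :=
    isLocalHomeomorph_range.isOpenEmbedding_of_comp (f := fun x : X => Arrow.mk (𝟙 x))
      IsOpenEmbedding.id EtaleGroupoid.continuous_unit
  filter_upwards [h.isOpen_range.mem_nhds ⟨x, rfl⟩]
  rintro _ ⟨x, rfl⟩
  change φ x = E.map (𝟙 x) (φ x)
  rw [E.map_id]
  rfl

/-- By continuity of composition and openness of the range map, every point near `z` is the range of
a composable pair close to `(g, h)`. Comparing translates on such pairs gives `act_comp`. -/
lemma eventually_range_comp {x y z : X} (g : x ⟶ y) (h : y ⟶ z) {P Q R : Arrow X → Prop}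
    (hP : ∀ᶠ k in 𝓝 (Arrow.mk g), P k) (hQ : ∀ᶠ k in 𝓝 (Arrow.mk h), Q k)
    (hR : ∀ᶠ k in 𝓝 (Arrow.mk (g ≫ h)), R k) :
    ∀ᶠ z' in 𝓝 z, ∃ (x' y' : X) (g' : x' ⟶ y') (h' : y' ⟶ z'), P (Arrow.mk g') ∧
      Q (Arrow.mk h') ∧ R (Arrow.mk (g' ≫ h')) := by
  let p : ComposablePair X := ⟨x, y, z, g, h⟩
  have hc : ∀ᶠ p' in 𝓝 p, R p'.comp := EtaleGroupoid.continuous_comp.continuousAt.eventually hR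
  rw [nhds_induced, eventually_comap] at hc
  obtain ⟨A, hA, B, hB, hAB⟩ := mem_nhds_prod_iff.1 hc
  have h1 : ∀ᶠ k in 𝓝 (Arrow.mk h), Q k ∧ k ∈ B ∧
      ∃ g', (P g' ∧ g' ∈ A) ∧ g'.right = k.left := by
    refine hQ.and (Filter.Eventually.and hB (eventually_source (g := Arrow.mk h)
      (P := fun y' => ∃ g', (P g' ∧ g' ∈ A) ∧ g'.right = y') ?_))
    exact eventually_range (g := Arrow.mk g)
      (P := fun y' => ∃ g', (P g' ∧ g' ∈ A) ∧ g'.right = y')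
      ((hP.and hA).mono fun k hk => ⟨k, hk, rfl⟩)
  have h2 := isLocalHomeomorph_range.isOpenMap.image_mem_nhds h1
  filter_upwards [h2]
  rintro _ ⟨⟨y', z', h'⟩, ⟨hQ, hB, ⟨⟨x', y'', g'⟩, ⟨hP, hA⟩, hy⟩⟩, rfl⟩
  obtain rfl : y'' = y' := hy
  exact ⟨x', y'', g', h', hP, hQ, hAB (Set.mk_mem_prod hA hB) ⟨x', y'', z', g', h'⟩ rfl⟩

lemma continuous_translate :
    Continuous[TopologicalSpace.induced
      (fun p : Σ g : Arrow X, FamilyGerm (fun x => E.obj x) g.left =>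
        ((p.1, (⟨p.1.left, p.2⟩ : Σ x, FamilyGerm (fun x => E.obj x) x)) :
          Arrow X × (Σ x, FamilyGerm (fun x => E.obj x) x))) inferInstance, familyTopology]
      fun p => (⟨p.1.right, translate E p.1.hom p.2⟩ : Σ x, FamilyGerm (fun x => E.obj x) x) := by
  let _ : TopologicalSpace (Σ g : Arrow X, FamilyGerm (fun x => E.obj x) g.left) :=
    TopologicalSpace.induced (fun p => ((p.1, (⟨p.1.left, p.2⟩ :
      Σ x, FamilyGerm (fun x => E.obj x) x)) :
        Arrow X × (Σ x, FamilyGerm (fun x => E.obj x) x))) inferInstance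
  have h0 : Continuous fun p : Σ g : Arrow X, FamilyGerm (fun x => E.obj x) g.left =>
      ((p.1, (⟨p.1.left, p.2⟩ : Σ x, FamilyGerm (fun x => E.obj x) x)) :
        Arrow X × (Σ x, FamilyGerm (fun x => E.obj x) x)) := continuous_induced_dom
  have h1 := h0.fst
  have h2 := h0.snd
  refine continuous_iff_continuousAt.2 fun p => ?_
  obtain ⟨φ, hφ⟩ := exists_eq_familySec
    (⟨p.1.left, p.2⟩ : Σ x, FamilyGerm (fun x => E.obj x) x)
  obtain ⟨ψ, hψ⟩ := exists_isTranslate p.1 φ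
  refine continuousAt_of_eventually_familySec ψ
    (EtaleGroupoid.continuous_range.comp h1).continuousAt ?_
  filter_upwards [h1.continuousAt.eventually hψ.eventually_nhds,
    h2.continuousAt.eventually (eventually_eq_familySec hφ)]
  rintro ⟨g, a⟩ hg ha
  obtain rfl : a = familyGerm g.left φ := eq_of_heq (Sigma.mk.inj ha).2
  exact congrArg (Sigma.mk g.right) (IsTranslate.translate_eq (g := g.hom) hg)

variable (E) in
/-- The `G`-sheaf of all families of elements of the groups `E.obj y`. -/
noncomputable def godement : GSheaf X where
  toEtaleSheaf := familySheaf fun x => E.obj x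
  act g := translate E g
  act_id x := by
    refine AddMonoidHom.ext fun a => ?_
    obtain ⟨φ, rfl⟩ := familyGerm_surjective x a
    exact (isTranslate_id x φ).translate_eq
  act_comp {x y z} g h := by
    refine AddMonoidHom.ext fun a => ?_
    obtain ⟨φ, rfl⟩ := familyGerm_surjective x a
    obtain ⟨ψ, hψ⟩ := exists_isTranslate (Arrow.mk g) φ
    obtain ⟨χ, hχ⟩ := exists_isTranslate (Arrow.mk h) ψ
    obtain ⟨χ', hχ'⟩ := exists_isTranslate (Arrow.mk (g ≫ h)) φ
    change translate E (g ≫ h) (familyGerm x φ) = translate E h (translate E g (familyGerm x φ))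
    rw [hψ.translate_eq, hχ.translate_eq, hχ'.translate_eq]
    refine familyGerm_eq_iff.2 ?_
    filter_upwards [eventually_range_comp g h hψ hχ hχ']
    rintro z' ⟨x', y', g', h', h1, h2, h3⟩
    change ψ y' = E.map g' (φ x') at h1
    change χ z' = E.map h' (ψ y') at h2
    change χ' z' = E.map (g' ≫ h') (φ x') at h3
    rw [h3, h2, h1, E.map_comp]
    rfl
  continuous_act := continuous_translate

lemma godement_isCSoft : (godement E).IsCSoft := familySheaf_isCSoft

end Godement

/-! ### Cofree `G`-sheaves and their universal property. -/

section Coextension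

open Filter

variable {X : Type u} [TopologicalSpace X]

namespace EtaleSheaf

variable {S : EtaleSheaf X}

lemma IsSecAt.eventually_eq {Y : Type u} [TopologicalSpace Y] {τ : Y → X}
    {s t : ∀ y, S.stalk (τ y)} {y : Y} (hs : S.IsSecAt s y) (ht : S.IsSecAt t y)
    (h : s y = t y) : ∀ᶠ y' in 𝓝 y, s y' = t y' := by
  filter_upwards [(hs.add ht.neg).eventually_eq_zero (by simp [h])] with y' hy'
  simpa [add_neg_eq_zero] using hy'

/-- A section embeds a neighbourhood of `x` onto an open subset of the étale space, so a property
that holds along the section holds near its value. -/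
lemma IsSecAt.eventually_nhds_pt {s : ∀ x, S.stalk x} {x : X}
    (hs : S.IsSecAt (τ := fun x => x) s x) {P : S.Total → Prop}
    (h : ∀ᶠ x' in 𝓝 x, P (S.pt (s x'))) : ∀ᶠ b in 𝓝 (S.pt (s x)), P b := by
  obtain ⟨U, hU, hx, hs⟩ := hs
  have h1 : IsOpenEmbedding fun x : U => S.pt (s x) :=
    S.isLocalHomeomorph_total.isOpenEmbedding_of_comp (f := fun x : U => S.pt (s x))
      hU.isOpenEmbedding_subtypeVal (continuousOn_iff_continuous_domRestrict.1 hs)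
  have h2 : ∀ᶠ x' : U in 𝓝 (⟨x, hx⟩ : U), P (S.pt (s x'.1)) :=
    (continuousAt_subtype_val (x := (⟨x, hx⟩ : U))).eventually h
  have h3 := h1.map_nhds_eq ⟨x, hx⟩
  rw [← h3]
  exact h2

end EtaleSheaf

variable [Groupoid.{u} X] [TopologicalSpace (Arrow X)] [EtaleGroupoid X]

lemma EtaleSheaf.IsSecAt.act {B : GSheaf X} {s : ∀ x, B.stalk x} {g : Arrow X}
    (hs : B.IsSecAt (τ := fun x => x) s g.left) :
    B.IsSecAt (τ := fun k : Arrow X => k.right) (fun k => B.act k.hom (s k.left)) g := by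
  obtain ⟨U, hU, hx, hs⟩ := hs
  have hc := EtaleGroupoid.continuous_source (X := X)
  refine ⟨_, hU.preimage hc, hx, continuousOn_iff_continuous_domRestrict.2 ?_⟩
  let V : Set (Arrow X) := (fun k : Arrow X => k.left) ⁻¹' U
  exact B.continuous_pt_act (Y := V) (τ := fun k => k.1.left) (τ' := fun k => k.1.right)
    (g := fun k => k.1.hom) continuous_subtype_val (s := fun k => s k.1.left)
    (hs.comp_continuous (hc.comp continuous_subtype_val) fun k => k.2)

section ToGodement

variable {E : X ⥤ AddCommGrpCat.{u}} {B : GSheaf X} (β : ∀ x, B.stalk x →+ E.obj x)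

omit [EtaleGroupoid X] in
lemma familyGerm_eq_of_isSecAt {s t : ∀ x, B.stalk x} {x : X}
    (hs : B.IsSecAt (τ := fun x => x) s x) (ht : B.IsSecAt (τ := fun x => x) t x)
    (h : s x = t x) :
    familyGerm (E := fun x => E.obj x) x (fun y => β y (s y)) =
      familyGerm x (fun y => β y (t y)) := by
  refine familyGerm_eq_iff.2 ?_
  filter_upwards [hs.eventually_eq ht h] with y hy
  rw [hy]

/-- The homomorphism of stalks given by `β`, which sends an element of a stalk to the germ of the
image under `β` of a section through this element. -/
noncomputable def toFamilyGerm (x : X) : B.stalk x →+ FamilyGerm (fun x => E.obj x) x :=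
  AddMonoidHom.mk' (fun a => familyGerm x fun y => β y ((B.exists_isSecAt x a).choose y))
    fun a b => by
      rw [← map_add]
      refine (familyGerm_eq_of_isSecAt β (B.exists_isSecAt x (a + b)).choose_spec.1
        ((B.exists_isSecAt x a).choose_spec.1.add (B.exists_isSecAt x b).choose_spec.1) ?_).trans
          (congrArg _ (funext fun y => map_add (β y) _ _))
      rw [(B.exists_isSecAt x (a + b)).choose_spec.2, Pi.add_apply,
        (B.exists_isSecAt x a).choose_spec.2, (B.exists_isSecAt x b).choose_spec.2]

omit [EtaleGroupoid X] in
lemma toFamilyGerm_eq {s : ∀ x, B.stalk x} {x : X} (hs : B.IsSecAt (τ := fun x => x) s x) :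
    toFamilyGerm β x (s x) = familyGerm x fun y => β y (s y) :=
  familyGerm_eq_of_isSecAt β (B.exists_isSecAt x (s x)).choose_spec.1 hs
    (B.exists_isSecAt x (s x)).choose_spec.2

omit [EtaleGroupoid X] in
lemma familyEval_toFamilyGerm {x : X} (a : B.stalk x) :
    familyEval x (toFamilyGerm β x a) = β x a :=
  congrArg (β x) (B.exists_isSecAt x a).choose_spec.2

omit [EtaleGroupoid X] in
lemma continuous_toFamilyGerm : Continuous fun a : B.Total =>
    (⟨a.1, toFamilyGerm β a.1 a.2⟩ : Σ x, FamilyGerm (fun x => E.obj x) x) := by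
  refine continuous_iff_continuousAt.2 fun a => ?_
  obtain ⟨x, a⟩ := a
  obtain ⟨s, hs, rfl⟩ := B.exists_isSecAt x a
  change ContinuousAt _ (B.pt (s x))
  refine continuousAt_of_eventually_familySec (fun y => β y (s y))
    B.isLocalHomeomorph_total.continuous.continuousAt ?_
  refine hs.eventually_nhds_pt ?_
  filter_upwards [hs.eventually] with y hy
  exact congrArg (Sigma.mk y) (toFamilyGerm_eq β hy)

/-- The morphism of `G`-sheaves given by a family of equivariant homomorphisms. -/
noncomputable def toGodement
    (hβ : ∀ {x y : X} (g : x ⟶ y) (a : B.stalk x), β y (B.act g a) = E.map g (β x a)) :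
    B ⟶ godement E where
  app := toFamilyGerm β
  continuous_app := continuous_toFamilyGerm β
  equivariant {x y} g a := by
    obtain ⟨s, hs, rfl⟩ := B.exists_isSecAt x a
    obtain ⟨t, ht, hta⟩ := B.exists_isSecAt y (B.act g (s x))
    have h : IsTranslate E (Arrow.mk g) (fun y => β y (s y)) (fun y => β y (t y)) := by
      -- Near `g`, both `k ↦ t (r(k))` and `k ↦ k • s (s(k))` are sections along the range map. They
      -- agree at `g`, hence in a neighbourhood.
      have h1 := (EtaleSheaf.IsSecAt.comp (S := B.toEtaleSheaf)
        (EtaleGroupoid.continuous_range (X := X)) (z := Arrow.mk g) ht).eventually_eq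
          (EtaleSheaf.IsSecAt.act (g := Arrow.mk g) hs) hta
      filter_upwards [h1] with k hk
      exact (congrArg (β k.right) hk).trans (hβ k.hom _)
    change toFamilyGerm β y _ = translate E g (toFamilyGerm β x _)
    rw [toFamilyGerm_eq β hs, h.translate_eq, ← hta, toFamilyGerm_eq β ht]

end ToGodement

section Coinduced

variable (M : X → AddCommGrpCat.{u})

/-- The right adjoint of the functor which forgets the action of a groupoid. -/
def coinduced : X ⥤ AddCommGrpCat.{u} where
  obj y := AddCommGrpCat.of (∀ z, (z ⟶ y) → M z)
  map k := AddCommGrpCat.ofHom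
    { toFun := fun φ z g => φ z (g ≫ Groupoid.inv k)
      map_zero' := rfl
      map_add' := fun _ _ => rfl }
  map_id y := by
    refine AddCommGrpCat.hom_ext (AddMonoidHom.ext fun φ => funext fun z => funext fun g => ?_)
    change φ z (g ≫ Groupoid.inv (𝟙 y)) = φ z g
    rw [Groupoid.inv_eq_inv, IsIso.inv_id, Category.comp_id]
  map_comp k l := by
    refine AddCommGrpCat.hom_ext (AddMonoidHom.ext fun φ => funext fun z => funext fun g => ?_)
    change φ z (g ≫ Groupoid.inv (k ≫ l)) = φ z ((g ≫ Groupoid.inv l) ≫ Groupoid.inv k)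
    rw [Groupoid.inv_eq_inv, IsIso.inv_comp, Groupoid.inv_eq_inv, Groupoid.inv_eq_inv,
      Category.assoc]

/-- The flabby `G`-sheaf cofreely generated by a family of abelian groups. -/
noncomputable abbrev cofree : GSheaf X := godement (coinduced M)

/-- The universal family of homomorphisms from the stalks of the cofree `G`-sheaf. -/
noncomputable def cofreeEval (x : X) : (cofree M).stalk x →+ M x :=
  (show (∀ z, (z ⟶ x) → M z) →+ M x from
    { toFun := fun φ => φ x (𝟙 x)
      map_zero' := rfl
      map_add' := fun _ _ => rfl }).comp (familyEval (E := fun x => (coinduced M).obj x) x)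

variable {M} {B : GSheaf X}

/-- The equivariant homomorphisms to the coinduced groups given by homomorphisms from the
stalks. -/
def toCoinduced (β : ∀ x, B.stalk x →+ M x) (x : X) : B.stalk x →+ (coinduced M).obj x :=
  show B.stalk x →+ (∀ z, (z ⟶ x) → M z) from
    { toFun := fun a z g => β z (B.act (Groupoid.inv g) a)
      map_zero' := by
        funext z g
        rw [map_zero, map_zero]
        rfl
      map_add' := fun a b => by
        funext z g
        rw [map_add, map_add]
        rfl }

/-- The morphism to a cofree `G`-sheaf given by homomorphisms from the stalks. -/
noncomputable def toCofree (β : ∀ x, B.stalk x →+ M x) : B ⟶ cofree M :=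
  toGodement (E := coinduced M) (toCoinduced β)
    fun {x y} k a => by
      funext z g
      change β z (B.act (Groupoid.inv g) (B.act k a)) =
        β z (B.act (Groupoid.inv (g ≫ Groupoid.inv k)) a)
      have h : Groupoid.inv (g ≫ Groupoid.inv k) = k ≫ Groupoid.inv g := by
        simp [Groupoid.inv_eq_inv]
      rw [h, B.act_comp]
      rfl

lemma cofreeEval_toCofree (β : ∀ x, B.stalk x →+ M x) (x : X) (a : B.stalk x) :
    cofreeEval M x (GSheaf.app (toCofree β) x a) = β x a := by
  have h : cofreeEval M x (GSheaf.app (toCofree β) x a) =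
      β x (B.act (Groupoid.inv (𝟙 x)) a) :=
    congrFun (congrFun (familyEval_toFamilyGerm (E := coinduced M) (toCoinduced β) a) x) (𝟙 x)
  have h1 : Groupoid.inv (𝟙 x) = 𝟙 x := by simp [Groupoid.inv_eq_inv]
  rw [h, h1, B.act_id]
  rfl

/-- Evaluation at the unit recovers every coordinate of `φ y`, once the germ has been moved to the
source of the arrow. -/
lemma cofree_family_apply (φ : ∀ y, (coinduced M).obj y) {y z : X} (g : z ⟶ y) :
    cofreeEval M z ((cofree M).act (Groupoid.inv g) (familyGerm y φ)) =
      (φ y : ∀ z, (z ⟶ y) → M z) z g := by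
  have h := familyEval_translate (E := coinduced M) (Groupoid.inv g) (familyGerm y φ)
  have h1 : cofreeEval M z ((cofree M).act (Groupoid.inv g) (familyGerm y φ)) =
      (φ y : ∀ z, (z ⟶ y) → M z) z (𝟙 z ≫ Groupoid.inv (Groupoid.inv g)) :=
    congrFun (congrFun h z) (𝟙 z)
  rw [h1]
  congr 1
  simp [Groupoid.inv_eq_inv]

/-- The uniqueness half of the adjunction. Near `x` the images of a section `s` are germs of
families; equivariance expresses each coordinate of these families as the evaluation of the morphism
at a translate of `s y`. -/
lemma toCofree_hom_ext {f f' : B ⟶ cofree M}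
    (h : ∀ x a, cofreeEval M x (GSheaf.app f x a) = cofreeEval M x (GSheaf.app f' x a)) :
    f = f' := by
  refine GSheaf.hom_ext fun x a => ?_
  obtain ⟨s, hs, rfl⟩ := B.exists_isSecAt x a
  obtain ⟨φ, hφ⟩ := familyGerm_surjective (E := fun y => (coinduced M).obj y) x
    (GSheaf.app f x (s x))
  obtain ⟨φ', hφ'⟩ := familyGerm_surjective (E := fun y => (coinduced M).obj y) x
    (GSheaf.app f' x (s x))
  have hsec : ∀ φ : ∀ y, (coinduced M).obj y,
      (cofree M).IsSecAt (τ := fun x => x) (fun y => familyGerm y φ) x :=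
    fun φ => EtaleSheaf.isSecAt_of_continuous (S := (cofree M).toEtaleSheaf)
      (continuous_familySec φ) x
  have h1 := (hs.app f).eventually_eq (hsec φ) hφ.symm
  have h2 := (hs.app f').eventually_eq (hsec φ') hφ'.symm
  rw [← hφ, ← hφ']
  refine familyGerm_eq_iff.2 ?_
  filter_upwards [h1, h2] with y h1 h2
  funext z g
  have h3 := h z (B.act (Groupoid.inv g) (s y))
  have e1 : GSheaf.app f z (B.act (Groupoid.inv g) (s y)) =
      (cofree M).act (Groupoid.inv g) (familyGerm y φ) :=
    (GSheaf.Hom.equivariant f _ _).trans (congrArg _ h1)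
  have e2 : GSheaf.app f' z (B.act (Groupoid.inv g) (s y)) =
      (cofree M).act (Groupoid.inv g) (familyGerm y φ') :=
    (GSheaf.Hom.equivariant f' _ _).trans (congrArg _ h2)
  rw [e1, e2, cofree_family_apply, cofree_family_apply] at h3
  exact h3

end Coinduced

end Coextension

/-! ### Relatively injective `G`-sheaves and the cofree resolution. -/

section RelativeInjectives

variable {X : Type u} [TopologicalSpace X] [Groupoid.{u} X] [TopologicalSpace (Arrow X)]

/-- `β` factors through `B ⧸ α.ker`, which embeds into `C`. -/
lemma exists_extension_of_injective {B C : Type u} [AddCommGroup B] [AddCommGroup C]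
    {M : AddCommGrpCat.{u}} [Injective M] (α : B →+ C) (β : B →+ M)
    (h : ∀ b, α b = 0 → β b = 0) : ∃ γ : C →+ M, ∀ b, γ (α b) = β b := by
  let i : AddCommGrpCat.of (B ⧸ α.ker) ⟶ AddCommGrpCat.of C :=
    AddCommGrpCat.ofHom (QuotientAddGroup.kerLift α)
  have hi : Mono i := (AddCommGrpCat.mono_iff_injective i).2 (QuotientAddGroup.kerLift_injective α)
  let g : AddCommGrpCat.of (B ⧸ α.ker) ⟶ M :=
    AddCommGrpCat.ofHom (QuotientAddGroup.lift α.ker β h)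
  exact ⟨(Injective.factorThru g i).hom, fun b =>
    ab_comp_apply (Injective.comp_factorThru g i) (QuotientAddGroup.mk b)⟩

/-- A `G`-sheaf `I` is relatively injective if a morphism `B ⟶ I` factors through each morphism
`B ⟶ C` whose kernel it annihilates. -/
def IsRelInjective (I : GSheaf X) : Prop :=
  ∀ ⦃B C : GSheaf X⦄ (α : B ⟶ C) (β : B ⟶ I),
    (∀ x a, GSheaf.app α x a = 0 → GSheaf.app β x a = 0) → ∃ γ : C ⟶ I, α ≫ γ = β

section SubHom

variable {B C : GSheaf X}

/-- The images of sections form a basis of the étale space, so continuity of stalk maps can be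
checked along sections. -/
lemma continuous_of_exists_isSecAt (h : ∀ x, B.stalk x → C.stalk x)
    (hh : ∀ (x : X) (s : ∀ x, B.stalk x), B.IsSecAt (τ := fun x => x) s x →
      ∃ t : ∀ x, C.stalk x, C.IsSecAt (τ := fun x => x) t x ∧ ∀ᶠ y in 𝓝 x, h y (s y) = t y) :
    Continuous fun a : B.Total => C.pt (h a.1 a.2) := by
  refine continuous_iff_continuousAt.2 fun a => ?_
  obtain ⟨x, a⟩ := a
  obtain ⟨s, hs, rfl⟩ := B.exists_isSecAt x a
  change ContinuousAt _ (B.pt (s x))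
  obtain ⟨t, ⟨U, hU, hx, ht⟩, hst⟩ := hh x s hs
  have h1 : ContinuousAt (fun y => C.pt (t y)) x := ht.continuousAt (hU.mem_nhds hx)
  have h2 : ContinuousAt (fun b : B.Total => b.1) (B.pt (s x)) :=
    B.isLocalHomeomorph_total.continuous.continuousAt
  have h3 : ContinuousAt (fun b : B.Total => C.pt (t b.1)) (B.pt (s x)) :=
    ContinuousAt.comp (f := fun b : B.Total => b.1) (g := fun y => C.pt (t y)) h1 h2
  refine h3.congr (hs.eventually_nhds_pt ?_)
  filter_upwards [hst] with y hy
  exact congrArg (fun c => C.pt c) hy.symm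

/-- The difference of two morphisms of `G`-sheaves. -/
def subHom (f g : B ⟶ C) : B ⟶ C where
  app x := GSheaf.app f x - GSheaf.app g x
  continuous_app := continuous_of_exists_isSecAt
    (fun x a => (GSheaf.app f x - GSheaf.app g x) a) fun x s hs =>
      ⟨_, (hs.app f).add (hs.app g).neg, Filter.Eventually.of_forall fun y =>
        sub_eq_add_neg (GSheaf.app f y (s y)) _⟩
  equivariant k a := by
    rw [AddMonoidHom.sub_apply, AddMonoidHom.sub_apply, map_sub]
    exact congrArg₂ _ (GSheaf.Hom.equivariant f k a) (GSheaf.Hom.equivariant g k a)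

lemma subHom_app (f g : B ⟶ C) (x : X) (a : B.stalk x) :
    GSheaf.app (subHom f g) x a = GSheaf.app f x a - GSheaf.app g x a := rfl

end SubHom

variable [EtaleGroupoid X]

/-- By the adjunction the extension problem splits into independent problems on stalks, without any
continuity or equivariance condition. -/
lemma cofree_isRelInjective (M : X → AddCommGrpCat.{u}) [∀ x, Injective (M x)] :
    IsRelInjective (cofree M) := by
  intro B C α β h
  choose γ hγ using fun x => exists_extension_of_injective (GSheaf.app α x)
    ((cofreeEval M x).comp (GSheaf.app β x)) fun b hb => by
      rw [AddMonoidHom.comp_apply, h x b hb, map_zero]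
  refine ⟨toCofree γ, toCofree_hom_ext fun x a => ?_⟩
  exact (cofreeEval_toCofree γ x (GSheaf.app α x a)).trans (hγ x a)

section Step

variable {A B : GSheaf X} (f : A ⟶ B)

/-- The family of injective hulls of the cokernels of the stalk maps of a morphism. -/
noncomputable def injectiveCokernel (x : X) : AddCommGrpCat.{u} :=
  Injective.under (AddCommGrpCat.of (B.stalk x ⧸ (GSheaf.app f x).range))

instance (x : X) : Injective (injectiveCokernel f x) :=
  inferInstanceAs (Injective (Injective.under _))

/-- A morphism of stalks whose kernel is the image of `f`. -/
noncomputable def toInjectiveCokernel (x : X) : B.stalk x →+ injectiveCokernel f x :=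
  (Injective.ι (AddCommGrpCat.of (B.stalk x ⧸ (GSheaf.app f x).range))).hom.comp
    (QuotientAddGroup.mk' _)

omit [EtaleGroupoid X] in
lemma toInjectiveCokernel_eq_zero_iff (x : X) (b : B.stalk x) :
    toInjectiveCokernel f x b = 0 ↔ ∃ a, GSheaf.app f x a = b := by
  have h := (AddCommGrpCat.mono_iff_injective
    (Injective.ι (AddCommGrpCat.of (B.stalk x ⧸ (GSheaf.app f x).range)))).1 inferInstance
  exact (map_eq_zero_iff _ h).trans (QuotientAddGroup.eq_zero_iff b)

/-- A morphism from the target of `f` to a cofree `G`-sheaf, whose kernel is the image of `f`. -/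
noncomputable def cosyzygy : B ⟶ cofree (injectiveCokernel f) :=
  toCofree (toInjectiveCokernel f)

/-- Evaluation detects the embedding of the stalkwise cokernel, so the kernel is no larger than the
image; that the composite is zero follows from `toCofree_hom_ext`. -/
lemma exact_cosyzygy (x : X) :
    Function.Exact (GSheaf.app f x) (GSheaf.app (cosyzygy f) x) := by
  refine fun b => ⟨fun h => (toInjectiveCokernel_eq_zero_iff f x b).1 ?_, ?_⟩
  · rw [← cofreeEval_toCofree (toInjectiveCokernel f) x b]
    exact (congrArg (cofreeEval _ x) h).trans (map_zero _)
  · rintro ⟨a, rfl⟩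
    have h : f ≫ cosyzygy f = 0 := toCofree_hom_ext fun x a => by
      refine (cofreeEval_toCofree (toInjectiveCokernel f) x (GSheaf.app f x a)).trans ?_
      rw [(toInjectiveCokernel_eq_zero_iff f x _).2 ⟨a, rfl⟩, GSheaf.zero_app]
      exact (map_zero _).symm
    exact congrArg (fun g => GSheaf.app g x a) h

end Step

section Resolution

variable (A : GSheaf X)

/-- The differentials of the cofree resolution, beginning with the augmentation. -/
noncomputable def cofreeSeq : ℕ → Arrow (GSheaf X)
  -- The cokernel of the zero endomorphism is `A` itself, so this arrow is an embedding of `A` into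
  -- a cofree `G`-sheaf.
  | 0 => Arrow.mk (cosyzygy (0 : A ⟶ A))
  | n + 1 => Arrow.mk (cosyzygy (cofreeSeq n).hom)

lemma cofreeSeq_right (n : ℕ) : ∃ M : X → AddCommGrpCat.{u}, (∀ x, Injective (M x)) ∧
    (cofreeSeq A n).right = cofree M := by
  cases n with
  | zero => exact ⟨injectiveCokernel (0 : A ⟶ A), inferInstance, rfl⟩
  | succ n => exact ⟨injectiveCokernel (cofreeSeq A n).hom, inferInstance, rfl⟩

/-- The differential of the cofree resolution. -/
noncomputable def cofreeD (n : ℕ) : (cofreeSeq A n).right ⟶ (cofreeSeq A (n + 1)).right :=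
  cosyzygy (cofreeSeq A n).hom

lemma cofreeD_comp (n : ℕ) : cofreeD A n ≫ cofreeD A (n + 1) = 0 :=
  GSheaf.hom_ext fun x a => (exact_cosyzygy (cofreeD A n) x).apply_apply_eq_zero a

/-- The complex which underlies the cofree resolution. -/
noncomputable def cofreeComplex : CochainComplex (GSheaf X) ℕ :=
  CochainComplex.of (fun n => (cofreeSeq A n).right) (cofreeD A) (cofreeD_comp A)

lemma cofreeComplex_d (n : ℕ) : (cofreeComplex A).d n (n + 1) = cofreeD A n :=
  CochainComplex.of_d (fun n => (cofreeSeq A n).right) (cofreeD A) n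

/-- The cofree resolution of a `G`-sheaf. -/
noncomputable def cofreeResolution : CSoftResolution A where
  complex := cofreeComplex A
  aug := (cofreeSeq A 0).hom
  isCSoft n := by
    obtain ⟨M, -, h⟩ := cofreeSeq_right A n
    change (cofreeSeq A n).right.IsCSoft
    rw [h]
    exact godement_isCSoft (E := coinduced M)
  injective_aug x := by
    refine (injective_iff_map_eq_zero _).2 fun a ha => ?_
    obtain ⟨b, rfl⟩ := (exact_cosyzygy (0 : A ⟶ A) x a).1 ha
    rfl
  exact_zero x := by
    rw [cofreeComplex_d A 0]
    exact exact_cosyzygy (cofreeSeq A 0).hom x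
  exact_succ n x := by
    rw [cofreeComplex_d A n, cofreeComplex_d A (n + 1)]
    exact exact_cosyzygy (cofreeD A n) x

lemma cofreeResolution_isRelInjective (n : ℕ) :
    IsRelInjective ((cofreeResolution A).complex.X n) := by
  obtain ⟨M, hM, h⟩ := cofreeSeq_right A n
  change IsRelInjective (cofreeSeq A n).right
  rw [h]
  exact cofree_isRelInjective M

end Resolution

end RelativeInjectives

/-! ### Resolutions and their behaviour under quasi-isomorphisms. -/

section Comparison

variable {X : Type u} [TopologicalSpace X] [Groupoid.{u} X] [TopologicalSpace (Arrow X)]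

/-- The complex `S` together with the augmentation `ε` is a resolution of the `G`-sheaf `A`. -/
structure IsResolution {A : GSheaf X} {S : CochainComplex (GSheaf X) ℕ} (ε : A ⟶ S.X 0) :
    Prop where
  injective_aug : ∀ x, Function.Injective (GSheaf.app ε x)
  exact_zero : ∀ x, Function.Exact (GSheaf.app ε x) (GSheaf.app (S.d 0 1) x)
  exact_succ : ∀ q x, Function.Exact (GSheaf.app (S.d q (q + 1)) x)
    (GSheaf.app (S.d (q + 1) (q + 2)) x)

lemma CSoftResolution.isResolution {A : GSheaf X} (S : CSoftResolution A) :
    IsResolution S.aug :=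
  ⟨S.injective_aug, S.exact_zero, S.exact_succ⟩

variable {A : GSheaf X} {S T : CochainComplex (GSheaf X) ℕ}

namespace IsResolution

variable {ε : A ⟶ S.X 0} {η : A ⟶ T.X 0}

lemma isQuasiIso (hε : IsResolution ε) (hη : IsResolution η) (f : S ⟶ T)
    (hf : ε ≫ f.f 0 = η) : IsQuasiIso f := by
  refine (isQuasiIso_iff f).2 fun x => ?_
  have hfx : ∀ a, GSheaf.app (f.f 0) x (GSheaf.app ε x a) = GSheaf.app η x a :=
    fun a => congrArg (fun g => GSheaf.app g x a) hf
  constructor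
  · intro (a : (S.X 0).stalk x) ha hfa
    obtain ⟨b, rfl⟩ := (hε.exact_zero x a).1 ha
    have h : GSheaf.app η x b = 0 := (hfx b).symm.trans hfa
    obtain rfl : b = 0 := hη.injective_aug x (h.trans (map_zero _).symm)
    exact map_zero (GSheaf.app ε x)
  · intro r (a : (S.X (r + 1)).stalk x) (b : (T.X r).stalk x) ha hab
    obtain ⟨a', rfl⟩ := (hε.exact_succ r x a).1 ha
    have hab' : GSheaf.app (T.d r (r + 1)) x (b - GSheaf.app (f.f r) x a') = 0 := by
      rw [map_sub, sub_eq_zero]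
      exact hab.symm.trans (app_f_d f r (r + 1) x a')
    cases r with
    | zero =>
      obtain ⟨c, hc⟩ := (hη.exact_zero x _).1 hab'
      refine ⟨(a' + GSheaf.app ε x c : (S.X 0).stalk x), 0, ?_, ?_⟩
      · refine (add_zero _).symm.trans (Eq.trans ?_ (map_add (GSheaf.app (S.d 0 1) x) _ _).symm)
        exact congrArg _ ((hε.exact_zero x).apply_apply_eq_zero c).symm
      · rw [map_zero, add_zero]
        refine Eq.trans ?_ (map_add (GSheaf.app (f.f 0) x) _ _).symm
        rw [hfx, hc, add_sub_cancel]
    | succ q =>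
      obtain ⟨b', hb'⟩ := (hη.exact_succ q x _).1 hab'
      rw [prev_nat_succ]
      exact ⟨a', b', rfl, (add_sub_cancel (GSheaf.app (f.f (q + 1)) x a') b).symm.trans
        (congrArg _ hb'.symm)⟩

lemma of_isQuasiIso (hε : IsResolution ε) {f : S ⟶ T} (hf : IsQuasiIso f) :
    IsResolution (S := T) (ε ≫ f.f 0) where
  injective_aug x := by
    refine (injective_iff_map_eq_zero _).2 fun a ha => ?_
    have h := hf.eq_zero ((hε.exact_zero x).apply_apply_eq_zero a) ha
    exact hε.injective_aug x (h.trans (map_zero _).symm)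
  exact_zero x := by
    refine fun b => ⟨fun hb => ?_, ?_⟩
    · obtain ⟨a', h, h'⟩ := hf.exists_zero (a := 0) (map_zero _) ((map_zero _).trans hb.symm)
      obtain ⟨c, rfl⟩ := (hε.exact_zero x a').1 h.symm
      exact ⟨c, h'.symm⟩
    · rintro ⟨a, rfl⟩
      have h := app_f_d f 0 1 x (GSheaf.app ε x a)
      rw [(hε.exact_zero x).apply_apply_eq_zero, map_zero] at h
      exact h.symm
  exact_succ q x := by
    refine fun b => ⟨fun hb => ?_, ?_⟩
    · obtain ⟨a', b', h, h'⟩ := hf.exists_succ (a := 0) (map_zero _) ((map_zero _).trans hb.symm)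
      obtain ⟨c, rfl⟩ := (hε.exact_succ q x a').1 h.symm
      refine ⟨GSheaf.app (f.f q) x c + b', ?_⟩
      rw [map_add, h', app_f_d]
    · rintro ⟨b, rfl⟩
      exact app_d_d T _ _ _ x b

/-- The kernels of the first differentials of `S` and `T` have isomorphic stalks, so each value of
`η` has exactly one closed lift. Uniqueness makes the lift additive, equivariant and continuous. -/
lemma exists_of_isQuasiIso (hη : IsResolution η) {f : S ⟶ T} (hf : IsQuasiIso f) :
    ∃ ε : A ⟶ S.X 0, IsResolution ε := by
  have hex : ∀ x (a : A.stalk x), ∃ c : (S.X 0).stalk x, GSheaf.app (S.d 0 1) x c = 0 ∧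
      GSheaf.app (f.f 0) x c = GSheaf.app η x a := fun x a => by
    obtain ⟨c, h, h'⟩ := hf.exists_zero (a := 0) (map_zero _)
      ((map_zero _).trans ((hη.exact_zero x).apply_apply_eq_zero a).symm)
    exact ⟨c, h.symm, h'.symm⟩
  have huniq : ∀ {x} {c c' : (S.X 0).stalk x}, GSheaf.app (S.d 0 1) x c = 0 →
      GSheaf.app (S.d 0 1) x c' = 0 → GSheaf.app (f.f 0) x c = GSheaf.app (f.f 0) x c' →
        c = c' := fun {x c c'} h h' hcc => by
    refine sub_eq_zero.1 (hf.eq_zero ?_ ?_)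
    · rw [map_sub, h, h', sub_zero]
    · rw [map_sub, hcc, sub_self]
  choose c hdc hfc using hex
  let ε : A ⟶ S.X 0 :=
    { app x := AddMonoidHom.mk' (c x) fun a b => by
        refine huniq (hdc _ _) ?_ ?_
        · rw [map_add, hdc, hdc, add_zero]
        · rw [map_add, hfc, hfc, hfc, map_add]
      -- A section `t` through the lift at `x` is closed near `x` and maps to `η s` near `x`,
      -- because both hold at `x`; by uniqueness it is the lift there.
      continuous_app := continuous_of_exists_isSecAt c fun x s hs => by
        obtain ⟨t, ht, htx⟩ := (S.X 0).exists_isSecAt x (c x (s x))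
        refine ⟨t, ht, ?_⟩
        have h1 := (ht.app (S.d 0 1)).eventually_eq_zero (by rw [htx, hdc])
        have h2 := (ht.app (f.f 0)).eventually_eq (hs.app η) (by rw [htx, hfc])
        filter_upwards [h1, h2] with y h1 h2
        exact huniq (hdc _ _) h1 ((hfc _ _).trans h2.symm)
      equivariant {x y} g a := by
        refine huniq (hdc _ _) ?_ ?_
        · refine (GSheaf.Hom.equivariant (S.d 0 1) g _).trans ?_
          exact (congrArg _ (hdc x a)).trans (map_zero _)
        · refine (hfc _ _).trans (Eq.trans ?_ (GSheaf.Hom.equivariant (f.f 0) g _).symm)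
          exact (GSheaf.Hom.equivariant η g a).trans (congrArg _ (hfc x a).symm) }
  refine ⟨ε, ⟨fun x => ?_, fun x a => ⟨fun ha => ?_, ?_⟩, fun q x a => ⟨fun ha => ?_, ?_⟩⟩⟩
  · intro a a' (h : c x a = c x a')
    refine hη.injective_aug x ?_
    rw [← hfc, h, hfc]
  · obtain ⟨b, hb⟩ := (hη.exact_zero x (GSheaf.app (f.f 0) x a)).1 (by
      rw [← app_f_d, ha, map_zero])
    exact ⟨b, huniq (hdc x b) ha ((hfc x b).trans hb)⟩
  · rintro ⟨b, rfl⟩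
    exact hdc x b
  · obtain ⟨b, hb⟩ := (hη.exact_succ q x (GSheaf.app (f.f (q + 1)) x a)).1 (by
      rw [← app_f_d, ha, map_zero])
    obtain ⟨a', -, h, -⟩ := (((isQuasiIso_iff f).1 hf) x).succ q a b ha hb.symm
    exact ⟨a', h.symm⟩
  · rintro ⟨b, rfl⟩
    exact app_d_d S _ _ _ x b

end IsResolution

lemma SameQuasiIsoClass.exists_isResolution_iff (h : SameQuasiIsoClass S T) :
    (∃ ε : A ⟶ S.X 0, IsResolution ε) ↔ ∃ η : A ⟶ T.X 0, IsResolution η := by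
  induction h with
  | rel S T h =>
    obtain ⟨f, hf⟩ := h
    exact ⟨fun ⟨_, hε⟩ => ⟨_, hε.of_isQuasiIso hf⟩, fun ⟨_, hη⟩ => hη.exists_of_isQuasiIso hf⟩
  | refl => exact Iff.rfl
  | symm _ _ _ ih => exact ih.symm
  | trans _ _ _ _ _ ih ih' => exact ih.trans ih'

end Comparison

/-! ### The comparison theorem and the canonical isomorphisms. -/

section Lifting

lemma exists_dependent_sequence {α : ℕ → Type*} (r : ∀ n, α n → α (n + 1) → Prop) (a : α 0)
    (h : ∀ n b, ∃ c, r n b c) : ∃ s : ∀ n, α n, s 0 = a ∧ ∀ n, r n (s n) (s (n + 1)) := by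
  choose g hg using h
  exact ⟨fun n => Nat.rec a g n, rfl, fun n => hg n _⟩

variable {X : Type u} [TopologicalSpace X] [Groupoid.{u} X] [TopologicalSpace (Arrow X)]
  {A : GSheaf X} {S T : CochainComplex (GSheaf X) ℕ} {ε : A ⟶ S.X 0} {η : A ⟶ T.X 0}

namespace IsResolution

/-- A morphism from a resolution to a complex of relatively injective `G`-sheaves exists. -/
lemma exists_lift (hε : IsResolution ε) (hη : ∀ x a, GSheaf.app (T.d 0 1) x (GSheaf.app η x a) = 0)
    (hT : ∀ n, IsRelInjective (T.X n)) : ∃ f : S ⟶ T, ε ≫ f.f 0 = η := by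
  obtain ⟨f0, hf0⟩ := hT 0 ε η fun x a ha => by
    rw [hε.injective_aug x (ha.trans (map_zero _).symm), map_zero]
  obtain ⟨s, hs0, hs⟩ := exists_dependent_sequence
    -- The sequence carries the condition under which `f ≫ T.d` factors through `S.d` in the next
    -- step.
    (α := fun n => {f : S.X n ⟶ T.X n // ∀ x a, GSheaf.app (S.d n (n + 1)) x a = 0 →
      GSheaf.app (T.d n (n + 1)) x (GSheaf.app f x a) = 0})
    (fun n f g => S.d n (n + 1) ≫ g.1 = f.1 ≫ T.d n (n + 1))
    ⟨f0, fun x a ha => by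
      obtain ⟨b, rfl⟩ := (hε.exact_zero x a).1 ha
      have h := congrArg (fun g => GSheaf.app g x b) hf0
      exact (congrArg _ h).trans (hη x b)⟩
    (fun n f => by
      obtain ⟨g, hg⟩ := hT (n + 1) (S.d n (n + 1)) (f.1 ≫ T.d n (n + 1)) f.2
      refine ⟨⟨g, fun x a ha => ?_⟩, hg⟩
      obtain ⟨b, rfl⟩ := (hε.exact_succ n x a).1 ha
      have h := congrArg (fun g => GSheaf.app g x b) hg
      exact (congrArg _ h).trans (app_d_d T _ _ _ x _))
  refine ⟨{ f := fun n => (s n).1, comm' := ?_ }, ?_⟩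
  · rintro i j h
    obtain rfl : i + 1 = j := h
    exact (hs i).symm
  · change ε ≫ (s 0).1 = η
    rw [hs0]
    exact hf0

/-- Two morphisms from a resolution to a complex of relatively injective `G`-sheaves which are
compatible with augmentations are homotopic. -/
lemma exists_homotopy (hε : IsResolution ε) (hT : ∀ n, IsRelInjective (T.X n)) (f g : S ⟶ T)
    (hfg : ε ≫ f.f 0 = ε ≫ g.f 0) : ∃ k : ∀ n, S.X (n + 1) ⟶ T.X n,
      (∀ x a, GSheaf.app (f.f 0) x a = GSheaf.app (g.f 0) x a +
        GSheaf.app (k 0) x (GSheaf.app (S.d 0 1) x a)) ∧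
      ∀ n x a, GSheaf.app (f.f (n + 1)) x a = GSheaf.app (g.f (n + 1)) x a +
        GSheaf.app (T.d n (n + 1)) x (GSheaf.app (k n) x a) +
          GSheaf.app (k (n + 1)) x (GSheaf.app (S.d (n + 1) (n + 2)) x a) := by
  obtain ⟨k0, hk0⟩ := hT 0 (S.d 0 1) (subHom (f.f 0) (g.f 0)) fun x a ha => by
    obtain ⟨b, rfl⟩ := (hε.exact_zero x a).1 ha
    rw [subHom_app, sub_eq_zero]
    exact congrArg (fun g => GSheaf.app g x b) hfg
  replace hk0 : ∀ x a, GSheaf.app k0 x (GSheaf.app (S.d 0 1) x a) =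
      GSheaf.app (f.f 0) x a - GSheaf.app (g.f 0) x a :=
    fun x a => congrArg (fun g => GSheaf.app g x a) hk0
  obtain ⟨s, hs0, hs⟩ := exists_dependent_sequence
    -- The carried identity says that in the next degree `f - g - d k` vanishes on the image of
    -- `S.d`, which is the kernel of the following differential; relative injectivity then yields
    -- the next component.
    (α := fun n => {k : S.X (n + 1) ⟶ T.X n // ∀ x b, GSheaf.app (T.d n (n + 1)) x
      (GSheaf.app k x (GSheaf.app (S.d n (n + 1)) x b)) = GSheaf.app (T.d n (n + 1)) x
        (GSheaf.app (f.f n) x b - GSheaf.app (g.f n) x b)})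
    (fun n k l => ∀ x a, GSheaf.app l.1 x (GSheaf.app (S.d (n + 1) (n + 2)) x a) =
      GSheaf.app (f.f (n + 1)) x a - GSheaf.app (g.f (n + 1)) x a -
        GSheaf.app (T.d n (n + 1)) x (GSheaf.app k.1 x a))
    ⟨k0, fun x b => congrArg _ (hk0 x b)⟩
    (fun n k => by
      obtain ⟨l, hl⟩ := hT (n + 1) (S.d (n + 1) (n + 2))
        (subHom (subHom (f.f (n + 1)) (g.f (n + 1))) (k.1 ≫ T.d n (n + 1))) fun x a ha => by
          obtain ⟨b, rfl⟩ := (hε.exact_succ n x a).1 ha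
          rw [subHom_app, subHom_app, sub_eq_zero, app_f_d, app_f_d, ← map_sub]
          exact (k.2 x b).symm
      replace hl : ∀ x a, GSheaf.app l x (GSheaf.app (S.d (n + 1) (n + 2)) x a) =
          GSheaf.app (f.f (n + 1)) x a - GSheaf.app (g.f (n + 1)) x a -
            GSheaf.app (T.d n (n + 1)) x (GSheaf.app k.1 x a) :=
        fun x a => congrArg (fun g => GSheaf.app g x a) hl
      refine ⟨⟨l, fun x b => ?_⟩, hl⟩
      rw [hl, map_sub, app_d_d, sub_zero])
  refine ⟨fun n => (s n).1, fun x a => ?_, fun n x a => ?_⟩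
  · beta_reduce
    rw [hs0, hk0, add_sub_cancel]
  · rw [hs]
    abel

end IsResolution

variable [EtaleGroupoid X]

lemma IsResolution.totalHomology_map_eq (hε : IsResolution ε) (hT : ∀ n, IsRelInjective (T.X n))
    (f g : S ⟶ T) (hfg : ε ≫ f.f 0 = ε ≫ g.f 0) (n : ℤ) :
    (totalHomology X n).map f = (totalHomology X n).map g := by
  obtain ⟨k, hk0, hk⟩ := hε.exists_homotopy hT f g hfg
  refine DoubleComplex.homologyMap_totMap_eq ((barDoubleComplex X).map f)
    ((barDoubleComplex X).map g) (fun q => (GSheaf.barComplex X).map (k q)) ?_ ?_ n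
  · intro p (a : (S.X 0).barGroup p)
    exact Subtype.ext (funext fun F => hk0 _ (a.1 F))
  · intro r p (a : (S.X (r + 1)).barGroup p)
    exact Subtype.ext (funext fun F => hk r _ (a.1 F))

namespace CSoftResolution

variable (S T : CSoftResolution A)

/-- A morphism from a resolution to the cofree resolution. -/
lemma exists_toCofreeResolution : ∃ f : S.complex ⟶ (cofreeResolution A).complex,
    S.aug ≫ f.f 0 = (cofreeResolution A).aug :=
  S.isResolution.exists_lift
    (fun x => ((cofreeResolution A).exact_zero x).apply_apply_eq_zero)
    (cofreeResolution_isRelInjective A)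

/-- A morphism from a resolution to the cofree resolution. -/
noncomputable def toCofreeResolution : S.complex ⟶ (cofreeResolution A).complex :=
  S.exists_toCofreeResolution.choose

lemma aug_toCofreeResolution :
    S.aug ≫ S.toCofreeResolution.f 0 = (cofreeResolution A).aug :=
  S.exists_toCofreeResolution.choose_spec

/-- Compatibility with the augmentations already makes `f` a quasi-isomorphism, so the first claim
applies. -/
lemma isIso_totalHomology_map {S T : CSoftResolution A} (f : S.complex ⟶ T.complex)
    (hf : S.aug ≫ f.f 0 = T.aug) (n : ℤ) : IsIso ((totalHomology X n).map f) :=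
  CMHomology.isIso_totalHomology_map S.isCSoft T.isCSoft
    (S.isResolution.isQuasiIso T.isResolution f hf) n

/-- The homology of a resolution is that of the cofree resolution. -/
noncomputable def cofreeIso (n : ℤ) : (totalHomology X n).obj S.complex ≅
    (totalHomology X n).obj (cofreeResolution A).complex :=
  have := isIso_totalHomology_map _ S.aug_toCofreeResolution n
  asIso ((totalHomology X n).map S.toCofreeResolution)

/-- The canonical isomorphism between the homology groups of two resolutions. -/
noncomputable def comparison (n : ℤ) :
    (totalHomology X n).obj S.complex ≅ (totalHomology X n).obj T.complex :=
  S.cofreeIso n ≪≫ (T.cofreeIso n).symm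

variable {S T}

/-- The composite of `f` with the map from `T` to the cofree resolution and the chosen map from `S`
agree on the augmentation, hence are homotopic and coincide on homology. -/
lemma comparison_hom (f : S.complex ⟶ T.complex) (hf : S.aug ≫ f.f 0 = T.aug) (n : ℤ) :
    (comparison S T n).hom = (totalHomology X n).map f := by
  refine (Iso.comp_inv_eq (T.cofreeIso n)).2 ?_
  change (totalHomology X n).map S.toCofreeResolution =
    (totalHomology X n).map f ≫ (totalHomology X n).map T.toCofreeResolution
  rw [← Functor.map_comp]
  refine S.isResolution.totalHomology_map_eq (cofreeResolution_isRelInjective A) _ _ ?_ n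
  rw [HomologicalComplex.comp_f, ← Category.assoc, hf, aug_toCofreeResolution,
    aug_toCofreeResolution]

end CSoftResolution

end Lifting

end CMHomology

/-! ### The main theorem. -/

theorem mainTheorem2 {X : Type u} [TopologicalSpace X] [Groupoid.{u} X]
    [TopologicalSpace (Arrow X)] [CMHomology.EtaleGroupoid X] :
    -- a quasi-isomorphism of complexes of `c`-soft `G`-sheaves induces isomorphisms on homology
    (∀ (S T : CochainComplex (CMHomology.GSheaf X) ℕ),
      CMHomology.IsCSoftComplex S → CMHomology.IsCSoftComplex T →
      ∀ f : S ⟶ T, CMHomology.IsQuasiIso f →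
        ∀ n : ℤ, IsIso ((CMHomology.totalHomology X n).map f)) ∧
    -- the homology of a `c`-soft resolution depends only on its quasi-isomorphism class
    (∀ (A : CMHomology.GSheaf X) (S : CMHomology.CSoftResolution A)
      (T : CochainComplex (CMHomology.GSheaf X) ℕ),
      CMHomology.IsCSoftComplex T → CMHomology.SameQuasiIsoClass S.complex T →
        ∀ n : ℤ, Nonempty ((CMHomology.totalHomology X n).obj S.complex ≅
          (CMHomology.totalHomology X n).obj T)) ∧
    -- every `G`-sheaf has a `c`-soft resolution
    (∀ A : CMHomology.GSheaf X, Nonempty (CMHomology.CSoftResolution A)) ∧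
    -- the homology does not depend on the choice of the resolution, up to canonical isomorphism
    (∀ A : CMHomology.GSheaf X,
      ∃ φ : ∀ (S T : CMHomology.CSoftResolution A) (n : ℤ),
          (CMHomology.totalHomology X n).obj S.complex ≅
            (CMHomology.totalHomology X n).obj T.complex,
        (∀ S n, φ S S n = Iso.refl _) ∧
        (∀ S T U n, φ S T n ≪≫ φ T U n = φ S U n) ∧
        (∀ (S T : CMHomology.CSoftResolution A) (f : S.complex ⟶ T.complex),
          S.aug ≫ f.f 0 = T.aug →
            ∀ n, (φ S T n).hom = (CMHomology.totalHomology X n).map f)) := by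
  refine ⟨fun S T hS hT f hf n => CMHomology.isIso_totalHomology_map hS hT hf n,
    fun A S T hT hST n => ?_, fun A => ⟨CMHomology.cofreeResolution A⟩, fun A =>
      ⟨fun S T n => S.comparison T n, fun S n => Iso.self_symm_id _, fun S T U n => ?_,
        fun S T f hf n => CMHomology.CSoftResolution.comparison_hom f hf n⟩⟩
  -- The zigzag is used only to turn `T` into a `c`-soft resolution of `A`; the comparison of two
  -- resolutions does the rest.
  · obtain ⟨η, hη⟩ := hST.exists_isResolution_iff.1 ⟨S.aug, S.isResolution⟩
    let T' : CMHomology.CSoftResolution A :=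
      ⟨T, η, hT, hη.injective_aug, hη.exact_zero, hη.exact_succ⟩
    exact ⟨S.comparison T' n⟩
  · simp [CMHomology.CSoftResolution.comparison]
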